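/- Let $\gamma\in(4/3,2]$ and let $s\ge 1$ be an integer. For a real valued function $f(x)=\sum_{n\in\mathbb Z}\hat f(n)e^{inx}$ on the torus $\mathbb R/2\pi\mathbb Z$ with $\hat f(0)=0$ put $\|f\|_{H^\sigma}=\big(\sum_{n\ge 1}n^{2\sigma}|\hat f(n)|^2\big)^{1/2}$, and let $H^s$ be the space of such $f$ with $\|f\|_{H^s}<\infty$. Let $\mu_s$ be the Gaussian measure on $H^s$ induced by the random Fourier series $$\varphi_s(\omega,x)=\sum_{n\ne 0}\frac{g_n(\omega)}{|n|^{s+\gamma/2}}e^{inx},\qquad g_{-n}=\overline{g_n},\quad g_n=\tfrac1{\sqrt2}(h_n+il_n)\ (n\ge1),$$ where $(h_n)_{n\ge1},(l_n)_{n\ge1}$ are independent standard real normal variables, and for $r>0$ let $\mu_{s,r}$ be the restriction of $\mu_s$ to the set $\{u\in H^s:\ \|u\|_{L^2}^2+4\pi\|u\|_{H^{\gamma/2}}^2\le r\}$, where $\|u\|_{L^2}^2=\int_0^{2\pi}u^2\,dx$. For every $u_0\in H^s$ the equation $$\partial_t u+\partial_t|D_x|^\gamma u+\partial_x u+\partial_x(u^2)=0,\qquad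 u|_{t=0}=u_0,$$ where $|D_x|^\gamma$ is the Fourier multiplier $|n|^\gamma$, has a unique global solution $u\in C(\mathbb R;H^s)$; write $\Phi(t)u_0=u(t)$ for its flow. Moreover, for every $t\in\mathbb R$, $r>0$, $R>0$ and $\delta>0$ there exists $C>0$ such that for every Borel set $A\subset\{u\in H^s:\ \|u\|_{H^s}\le R\}$, $$\mu_{s,r}\big(\Phi(t)(A)\big)\le C\,\big(\mu_{s,r}(A)\big)^{1-\delta}.$$ (If $\delta>1$ and $\mu_{s,r}(A)=0$, the right-hand side is read as $+\infty$.) -/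

import Mathlib

open MeasureTheory ProbabilityTheory Filter Topology
open scoped ENNReal

namespace GBBM

noncomputable section

/-- The period `2π` is positive. -/
instance factTwoPiPos : Fact (0 < 2 * Real.pi) := ⟨Real.two_pi_pos⟩

/-- The one dimensional torus `ℝ / 2πℤ`. -/
abbrev Torus : Type := AddCircle (2 * Real.pi)

/-- Real valued square integrable functions on the torus (the normalisation of the measure only
affects the norm of this ambient space, which is not used in any definition below). -/
abbrev RealL2 : Type := Lp ℝ 2 (AddCircle.haarAddCircle : Measure Torus)

/-- The Fourier coefficient `(1/2π) ∫ f(x) e^{-inx} dx`, so that `f = ∑ coeff f n * e^{inx}`. -/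
def coeff (f : RealL2) (n : ℤ) : ℂ := fourierCoeff (fun x : Torus => ((f x : ℝ) : ℂ)) n

/-- The summands of the square of the homogeneous Sobolev norm of order `σ`. -/
def sobolevTerm (σ : ℝ) (f : RealL2) (n : ℕ+) : ℝ :=
  ((n : ℕ) : ℝ) ^ (2 * σ) * ‖coeff f ((n : ℕ) : ℤ)‖ ^ 2

/-- The homogeneous Sobolev norm `(∑_{n ≥ 1} n^{2σ} |f̂(n)|²)^{1/2}` (used where the sum is finite). -/
def sobolevNorm (σ : ℝ) (f : RealL2) : ℝ := Real.sqrt (∑' n : ℕ+, sobolevTerm σ f n)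

/-! Elementary facts on Fourier coefficients. -/

/-- A real valued function seen as a complex valued one. -/
def complexify : RealL2 →L[ℝ] Lp ℂ 2 (AddCircle.haarAddCircle : Measure Torus) :=
  Complex.ofRealCLM.compLpL 2 AddCircle.haarAddCircle

theorem coeff_eq_complexify (f : RealL2) (n : ℤ) : coeff f n = fourierCoeff (complexify f) n :=
  (congrFun (fourierCoeff_congr_ae (Complex.ofRealCLM.coeFn_compLpL f)) n).symm

theorem coeff_eq (f : RealL2) (n : ℤ) : coeff f n = fourierBasis.repr (complexify f) n := by
  rw [fourierBasis_repr, coeff_eq_complexify]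

theorem coeff_zero (n : ℤ) : coeff 0 n = 0 := by simp [coeff_eq]

theorem coeff_add (f g : RealL2) (n : ℤ) : coeff (f + g) n = coeff f n + coeff g n := by
  simp [coeff_eq]

theorem coeff_neg (f : RealL2) (n : ℤ) : coeff (-f) n = -coeff f n := by
  simp [coeff_eq]

theorem coeff_sub (f g : RealL2) (n : ℤ) : coeff (f - g) n = coeff f n - coeff g n := by
  simp [coeff_eq]

theorem coeff_smul (c : ℝ) (f : RealL2) (n : ℤ) : coeff (c • f) n = c * coeff f n := by
  have h : complexify (c • f) = (c : ℂ) • complexify f := by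
    rw [map_smul]; rfl
  rw [coeff_eq, coeff_eq, h, map_smul]
  rfl

theorem coeff_neg_index (f : RealL2) (n : ℤ) :
    coeff f (-n) = (starRingEnd ℂ) (coeff f n) := by
  unfold coeff fourierCoeff
  rw [← integral_conj]
  congr 1
  ext x
  simp

theorem continuous_coeff (n : ℤ) : Continuous fun f : RealL2 => coeff f n := by
  have h : (fun f : RealL2 => coeff f n) =
      fun f => inner ℂ (fourierBasis (T := 2 * Real.pi) n) (complexify f) := by
    funext f
    rw [coeff_eq, HilbertBasis.repr_apply_apply]
  rw [h]
  fun_prop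

theorem norm_complexify (f : RealL2) : ‖complexify f‖ = ‖f‖ := by
  rw [Lp.norm_def, Lp.norm_def]
  congr 1
  refine (eLpNorm_congr_ae (Complex.ofRealCLM.coeFn_compLpL f)).trans ?_
  exact eLpNorm_congr_norm_ae (Eventually.of_forall fun x => by simp)

theorem hasSum_sq_coeff (f : RealL2) : HasSum (fun n : ℤ => ‖coeff f n‖ ^ 2) (‖f‖ ^ 2) := by
  have h := lp.hasSum_norm (p := 2) (by norm_num) (fourierBasis.repr (complexify f))
  simp only [LinearIsometryEquiv.norm_map, norm_complexify, ← coeff_eq] at h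
  simpa using h

theorem norm_sq_eq (f : RealL2) (h0 : coeff f 0 = 0) :
    ‖f‖ ^ 2 = 2 * ∑' n : ℕ+, ‖coeff f ((n : ℕ) : ℤ)‖ ^ 2 := by
  rw [← (hasSum_sq_coeff f).tsum_eq]
  have h := tsum_int_eq_zero_add_two_mul_tsum_pnat (f := fun n : ℤ => ‖coeff f n‖ ^ 2)
    (fun n => by simp [coeff_neg_index]) (hasSum_sq_coeff f).summable
  simpa [h0] using h

theorem eq_zero_of_coeff (f : RealL2) (h0 : coeff f 0 = 0)
    (h : ∀ n : ℕ+, coeff f ((n : ℕ) : ℤ) = 0) : f = 0 := by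
  have := norm_sq_eq f h0
  simpa [h] using this

/-- The weighted sequence of Fourier coefficients. -/
def weighted (σ : ℝ) (f : RealL2) (n : ℕ+) : ℂ :=
  ((((n : ℕ) : ℝ) ^ σ : ℝ) : ℂ) * coeff f ((n : ℕ) : ℤ)

theorem norm_weighted_sq (σ : ℝ) (f : RealL2) (n : ℕ+) :
    ‖weighted σ f n‖ ^ 2 = sobolevTerm σ f n := by
  have hn : (0 : ℝ) ≤ ((n : ℕ) : ℝ) := by positivity
  rw [weighted, sobolevTerm, norm_mul, mul_pow, Complex.norm_real, Real.norm_eq_abs, sq_abs,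
    ← Real.rpow_natCast, ← Real.rpow_mul hn]
  congr 2
  push_cast
  ring

theorem memlp_weighted (σ : ℝ) (f : RealL2) (h : Summable (sobolevTerm σ f)) :
    Memℓp (weighted σ f) 2 := by
  apply memℓp_gen
  simpa [norm_weighted_sq] using h

theorem summable_of_memlp (σ : ℝ) (f : RealL2) (h : Memℓp (weighted σ f) 2) :
    Summable (sobolevTerm σ f) := by
  have := h.summable (by norm_num)
  simpa [norm_weighted_sq] using this

/-- The weighted sequence of Fourier coefficients as an element of `ℓ²`. -/
def toEll (σ : ℝ) (f : RealL2) (h : Summable (sobolevTerm σ f)) : lp (fun _ : ℕ+ => ℂ) 2 :=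
  ⟨weighted σ f, memlp_weighted σ f h⟩

theorem norm_toEll (σ : ℝ) (f : RealL2) (h : Summable (sobolevTerm σ f)) :
    ‖toEll σ f h‖ = sobolevNorm σ f := by
  rw [lp.norm_eq_tsum_rpow (by norm_num), sobolevNorm, Real.sqrt_eq_rpow]
  congr 1
  · refine tsum_congr fun n => ?_
    rw [← norm_weighted_sq]
    simp [toEll]

theorem weighted_add (σ : ℝ) (f g : RealL2) :
    weighted σ (f + g) = weighted σ f + weighted σ g := by
  ext n; simp [weighted, coeff_add, mul_add]

theorem weighted_smul (σ : ℝ) (c : ℝ) (f : RealL2) :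
    weighted σ (c • f) = c • weighted σ f := by
  ext n; simp [weighted, coeff_smul]; ring

/-- For `s ≥ 0`, the real valued functions `f` with `f̂(0) = 0` and `∑ |n|^{2s} |f̂(n)|² < ∞`. -/
def sobolevSubmodule (s : ℝ) : Submodule ℝ RealL2 where
  carrier := {f | coeff f 0 = 0 ∧ Summable (sobolevTerm s f)}
  zero_mem' := ⟨coeff_zero 0, by
    have h : sobolevTerm s 0 = fun _ => 0 := by funext n; simp [sobolevTerm, coeff_zero]
    rw [h]; exact summable_zero⟩
  add_mem' := by
    rintro f g ⟨hf, hf'⟩ ⟨hg, hg'⟩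
    refine ⟨by rw [coeff_add, hf, hg, add_zero], summable_of_memlp s _ ?_⟩
    rw [weighted_add]
    exact (memlp_weighted s f hf').add (memlp_weighted s g hg')
  smul_mem' := by
    rintro c f ⟨hf, hf'⟩
    refine ⟨by rw [coeff_smul, hf, mul_zero], summable_of_memlp s _ ?_⟩
    rw [weighted_smul]
    exact (memlp_weighted s f hf').const_smul c

/-- The Sobolev space `H^s` (`s ≥ 0`) of real valued functions on the torus with zero mean. It
carries its own norm and not the one of `L²`. -/
def Sobolev (s : ℝ) : Type := sobolevSubmodule s

namespace Sobolev

variable {s : ℝ}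

/-- The function underlying an element of `H^s`. -/
def toL2 (u : Sobolev s) : RealL2 := Subtype.val (p := fun f => f ∈ sobolevSubmodule s) u

instance instAddCommGroup : AddCommGroup (Sobolev s) :=
  inferInstanceAs (AddCommGroup (sobolevSubmodule s))

instance instModule : Module ℝ (Sobolev s) :=
  inferInstanceAs (Module ℝ (sobolevSubmodule s))

theorem coeff_toL2_zero (u : Sobolev s) : coeff u.toL2 0 = 0 := u.2.1

theorem summable (u : Sobolev s) : Summable (sobolevTerm s u.toL2) := u.2.2

theorem toL2_zero : (0 : Sobolev s).toL2 = 0 := rfl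

theorem toL2_add (u v : Sobolev s) : (u + v).toL2 = u.toL2 + v.toL2 := rfl

theorem toL2_neg (u : Sobolev s) : (-u).toL2 = -u.toL2 := rfl

theorem toL2_sub (u v : Sobolev s) : (u - v).toL2 = u.toL2 - v.toL2 := rfl

theorem toL2_injective : Function.Injective (toL2 : Sobolev s → RealL2) :=
  Subtype.val_injective

/-- `H^s` is normed by `(∑_{n ≥ 1} n^{2s} |f̂(n)|²)^{1/2}`. -/
def addGroupNorm (s : ℝ) : AddGroupNorm (Sobolev s) where
  toFun u := sobolevNorm s u.toL2
  map_zero' := by simp [toL2_zero, sobolevNorm, sobolevTerm, coeff_zero]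
  add_le' u v := by
    have h : toEll s (u + v).toL2 (u + v).summable =
        toEll s u.toL2 u.summable + toEll s v.toL2 v.summable :=
      Subtype.ext (weighted_add s u.toL2 v.toL2)
    rw [← norm_toEll s _ (u + v).summable, ← norm_toEll s _ u.summable,
      ← norm_toEll s _ v.summable, h]
    exact norm_add_le _ _
  neg' u := by simp [toL2_neg, sobolevNorm, sobolevTerm, coeff_neg]
  eq_zero_of_map_eq_zero' u h := by
    rw [← norm_toEll s _ u.summable, norm_eq_zero] at h
    apply toL2_injective
    rw [toL2_zero]
    refine eq_zero_of_coeff _ u.coeff_toL2_zero fun n => ?_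
    have hn : weighted s u.toL2 n = 0 := congrFun (congrArg Subtype.val h) n
    have hpos : (0 : ℝ) < ((n : ℕ) : ℝ) ^ s := Real.rpow_pos_of_pos (by exact_mod_cast n.pos) _
    rcases mul_eq_zero.1 hn with h1 | h1
    · exact absurd (Complex.ofReal_eq_zero.1 h1) hpos.ne'
    · exact h1

instance instNormedAddCommGroup : NormedAddCommGroup (Sobolev s) :=
  (addGroupNorm s).toNormedAddCommGroup

theorem norm_def (u : Sobolev s) : ‖u‖ = sobolevNorm s u.toL2 := rfl

instance instNormedSpace : NormedSpace ℝ (Sobolev s) where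
  norm_smul_le c u := by
    have h : toEll s (c • u).toL2 (c • u).summable = c • toEll s u.toL2 u.summable :=
      Subtype.ext (weighted_smul s c u.toL2)
    rw [norm_def, norm_def, ← norm_toEll s _ (c • u).summable, ← norm_toEll s _ u.summable, h,
      norm_smul]

/-- `H^s` carries its Borel σ-algebra. -/
instance instMeasurableSpace : MeasurableSpace (Sobolev s) := borel _

instance instBorelSpace : BorelSpace (Sobolev s) := ⟨rfl⟩

theorem dist_toEll (u v : Sobolev s) :
    dist (toEll s u.toL2 u.summable) (toEll s v.toL2 v.summable) = dist u v := by
  have h : toEll s (u - v).toL2 (u - v).summable =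
      toEll s u.toL2 u.summable - toEll s v.toL2 v.summable := by
    refine Subtype.ext ?_
    funext n
    simp only [toEll, toL2_sub, weighted, coeff_sub, mul_sub]
    rfl
  rw [dist_eq_norm, dist_eq_norm, norm_def, ← norm_toEll s _ (u - v).summable, h]

theorem norm_toL2_le (hs : 0 ≤ s) (u : Sobolev s) : ‖u.toL2‖ ^ 2 ≤ 2 * ‖u‖ ^ 2 := by
  have hle : ∀ n : ℕ+, ‖coeff u.toL2 ((n : ℕ) : ℤ)‖ ^ 2 ≤ sobolevTerm s u.toL2 n := fun n =>
    le_mul_of_one_le_left (by positivity)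
      (Real.one_le_rpow (by exact_mod_cast n.pos) (by positivity))
  have hnn : ∀ n : ℕ+, 0 ≤ sobolevTerm s u.toL2 n := fun n => (sq_nonneg _).trans (hle n)
  rw [norm_sq_eq _ u.coeff_toL2_zero, norm_def, sobolevNorm, Real.sq_sqrt (tsum_nonneg hnn)]
  gcongr
  · exact Summable.of_nonneg_of_le (fun n => sq_nonneg _) hle u.summable
  · exact u.summable
  · exact hle _

theorem completeSpace (hs : 0 ≤ s) : CompleteSpace (Sobolev s) := by
  refine Metric.complete_of_cauchySeq_tendsto fun u hu => ?_
  have h1 : CauchySeq fun k => toEll s (u k).toL2 (u k).summable := by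
    rw [Metric.cauchySeq_iff] at hu ⊢
    simpa only [dist_toEll] using hu
  have h2 : CauchySeq fun k => (u k).toL2 := by
    rw [Metric.cauchySeq_iff] at hu ⊢
    intro ε hε
    obtain ⟨N, hN⟩ := hu (ε / 2) (by positivity)
    refine ⟨N, fun m hm n hn => ?_⟩
    have h := norm_toL2_le hs (u m - u n)
    have h' := hN m hm n hn
    rw [dist_eq_norm] at h' ⊢
    rw [toL2_sub] at h
    nlinarith [norm_nonneg (u m - u n), norm_nonneg ((u m).toL2 - (u n).toL2)]
  obtain ⟨c, hc⟩ := cauchySeq_tendsto_of_complete h1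
  obtain ⟨f, hf⟩ := cauchySeq_tendsto_of_complete h2
  have hcoeff : ∀ n, Tendsto (fun k => coeff (u k).toL2 n) atTop (𝓝 (coeff f n)) := fun n =>
    ((continuous_coeff n).tendsto f).comp hf
  have hw : weighted s f = c := by
    funext n
    have hA : Tendsto (fun k => weighted s (u k).toL2 n) atTop (𝓝 (weighted s f n)) :=
      (hcoeff _).const_mul _
    have hB : Tendsto (fun k => weighted s (u k).toL2 n) atTop (𝓝 (c n)) := by
      rw [tendsto_iff_norm_sub_tendsto_zero] at hc ⊢
      refine squeeze_zero (fun k => norm_nonneg _) (fun k => ?_) hc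
      exact lp.norm_apply_le_norm (by norm_num)
        (toEll s (u k).toL2 (u k).summable - c) n
    exact tendsto_nhds_unique hA hB
  have h0 : coeff f 0 = 0 := by
    refine tendsto_nhds_unique (hcoeff 0) ?_
    simp only [coeff_toL2_zero]
    exact tendsto_const_nhds
  have hsum : Summable (sobolevTerm s f) :=
    summable_of_memlp s f (by rw [hw]; exact lp.memℓp c)
  let v : Sobolev s := ⟨f, h0, hsum⟩
  have hv : toEll s v.toL2 v.summable = c := Subtype.ext hw
  refine ⟨v, ?_⟩
  rw [tendsto_iff_dist_tendsto_zero] at hc ⊢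
  simpa only [← hv, dist_toEll] using hc

end Sobolev

/-- The trigonometric function `x ↦ z e^{inx} + conj(z) e^{-inx} = 2 Re (z e^{inx})`. -/
def modeFun (n : ℕ+) (z : ℂ) : C(Torus, ℝ) where
  toFun x := 2 * (z * fourier ((n : ℕ) : ℤ) x).re
  continuous_toFun := by fun_prop

theorem coeff_modeFun (n : ℕ+) (z : ℂ) (m : ℤ) :
    coeff (ContinuousMap.toLp 2 AddCircle.haarAddCircle ℝ (modeFun n z)) m =
      (if m = n then z else 0) + (if m = -n then (starRingEnd ℂ) z else 0) := by
  have h1 : coeff (ContinuousMap.toLp 2 AddCircle.haarAddCircle ℝ (modeFun n z)) m =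
      fourierCoeff (z • (fourier (T := 2 * Real.pi) ((n : ℕ) : ℤ) : Torus → ℂ) +
        (starRingEnd ℂ) z • (fourier (T := 2 * Real.pi) (-((n : ℕ) : ℤ)) : Torus → ℂ)) m := by
    refine congrFun (fourierCoeff_congr_ae ?_) m
    filter_upwards [ContinuousMap.coeFn_toLp (p := 2) (𝕜 := ℝ)
      (AddCircle.haarAddCircle : Measure Torus) (modeFun n z)] with x hx
    rw [hx]
    simp only [modeFun, ContinuousMap.coe_mk, Pi.add_apply, Pi.smul_apply, smul_eq_mul,
      fourier_neg]
    rw [← map_mul, Complex.add_conj]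
  have hint : ∀ (w : ℂ) (k : ℤ), Integrable (w • (fourier (T := 2 * Real.pi) k : Torus → ℂ))
      AddCircle.haarAddCircle := fun w k =>
    (((fourier k).continuous.const_smul w).integrable_of_hasCompactSupport
      (HasCompactSupport.of_compactSpace _))
  rw [h1, fourierCoeff.add (hint _ _) (hint _ _)]
  simp only [Pi.add_apply, fourierCoeff.const_smul, fourierCoeff_fourier,
    Pi.single_apply, smul_eq_mul, mul_ite, mul_one, mul_zero]

theorem coeff_modeFun_pos (n : ℕ+) (z : ℂ) (m : ℕ+) :
    coeff (ContinuousMap.toLp 2 AddCircle.haarAddCircle ℝ (modeFun n z)) ((m : ℕ) : ℤ) =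
      if m = n then z else 0 := by
  have h1 : ((m : ℕ) : ℤ) ≠ -((n : ℕ) : ℤ) := by
    have := m.pos
    omega
  rw [coeff_modeFun, if_neg h1, add_zero]
  simp

/-- The function `x ↦ z e^{inx} + conj(z) e^{-inx}` as an element of `H^s`. -/
def mode (s : ℝ) (n : ℕ+) (z : ℂ) : Sobolev s :=
  ⟨ContinuousMap.toLp 2 AddCircle.haarAddCircle ℝ (modeFun n z), by
    refine ⟨?_, ?_⟩
    · have := n.pos
      rw [coeff_modeFun, if_neg (by omega), if_neg (by omega), add_zero]
    · refine summable_of_ne_finset_zero (s := {n}) fun m hm => ?_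
      rw [sobolevTerm, coeff_modeFun_pos, if_neg (by simpa using hm)]
      simp⟩

theorem coeff_mode (s : ℝ) (n : ℕ+) (z : ℂ) (m : ℕ+) :
    coeff (mode s n z).toL2 ((m : ℕ) : ℤ) = if m = n then z else 0 :=
  coeff_modeFun_pos n z m

theorem continuous_mode (s : ℝ) (n : ℕ+) : Continuous (mode s n) := by
  refine (LipschitzWith.of_dist_le_mul (K := ⟨((n : ℕ) : ℝ) ^ s, by positivity⟩)
    fun z w => ?_).continuous
  rw [dist_eq_norm, Sobolev.norm_def, sobolevNorm, Sobolev.toL2_sub]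
  rw [tsum_eq_single n, ← norm_weighted_sq, Real.sqrt_sq (norm_nonneg _)]
  · simp only [weighted, coeff_sub, coeff_mode, if_true, norm_mul, Complex.norm_real, dist_eq_norm,
      Real.norm_eq_abs]
    exact (congrArg (· * _) (abs_of_nonneg (by positivity))).le
  · intro m hm
    simp [sobolevTerm, coeff_sub, coeff_mode, hm]

/-- The probability space carrying independent standard real normal variables `h_n`, `l_n`,
`n ≥ 1`: the point `ω` has `h_n = (ω n).1` and `l_n = (ω n).2`. -/
def gaussianNoise : Measure (ℕ+ → ℝ × ℝ) :=
  Measure.infinitePi fun _ => (gaussianReal 0 1).prod (gaussianReal 0 1)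

/-- The standard complex Gaussian variable `g_n = (h_n + i l_n) / √2`. -/
def gaussianVar (n : ℕ+) (ω : ℕ+ → ℝ × ℝ) : ℂ :=
  (((ω n).1 : ℂ) + Complex.I * ((ω n).2 : ℂ)) / (Real.sqrt 2 : ℂ)

/-- The random Fourier series `∑_{n ≠ 0} g_n / |n|^{s + γ/2} e^{inx}`, where
`g_{-n} = conj (g_n)`, as the limit in `H^s` of its partial sums over `0 < |n| ≤ N`. For `γ > 1` the
limit exists almost surely; elsewhere the value is arbitrary. -/
def randomSeries (γ s : ℝ) (ω : ℕ+ → ℝ × ℝ) : Sobolev s :=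
  limUnder atTop fun N : ℕ+ => ∑ n ∈ Finset.Icc 1 N,
    mode s n (gaussianVar n ω / ((((n : ℕ) : ℝ) ^ (s + γ / 2) : ℝ) : ℂ))

theorem measurable_randomSeries (γ : ℝ) {s : ℝ} (hs : 0 ≤ s) : Measurable (randomSeries γ s) := by
  have := Sobolev.completeSpace hs
  refine (StronglyMeasurable.limUnder fun N => ?_).measurable
  refine Finset.stronglyMeasurable_fun_sum _ fun n _ => ?_
  refine (continuous_mode s n).comp_stronglyMeasurable (Measurable.stronglyMeasurable ?_)
  unfold gaussianVar
  fun_prop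

/-- The Gaussian measure `μ_s` on `H^s`: the law of the random Fourier series. -/
def gaussianMeasure (γ s : ℝ) : Measure (Sobolev s) := gaussianNoise.map (randomSeries γ s)

theorem isProbabilityMeasure_gaussianMeasure (γ : ℝ) {s : ℝ} (hs : 0 ≤ s) :
    IsProbabilityMeasure (gaussianMeasure γ s) := by
  have : IsProbabilityMeasure gaussianNoise := by unfold gaussianNoise; infer_instance
  exact Measure.isProbabilityMeasure_map (measurable_randomSeries γ hs).aemeasurable

/-- The conserved quantity `‖u‖_{L²}² + 4π ‖u‖_{H^{γ/2}}²`, with the `L²` norm taken with respect to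
the Lebesgue measure of total mass `2π` on the torus. -/
def energy (γ : ℝ) {s : ℝ} (u : Sobolev s) : ℝ :=
  (∫ x : Torus, (u.toL2 x) ^ 2) + 4 * Real.pi * sobolevNorm (γ / 2) u.toL2 ^ 2

/-- The measure `μ_{s,r}`: the restriction of `μ_s` to the set where the energy is at most `r`. -/
def cutMeasure (γ s r : ℝ) : Measure (Sobolev s) :=
  (gaussianMeasure γ s).restrict {u | energy γ u ≤ r}

/-- `u ∈ C(ℝ; H^s)` is a global solution of `∂ₜu + ∂ₜ|D|^γ u + ∂ₓu + ∂ₓ(u²) = 0`. The equation is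
tested against every `e^{inx}`: the `n`-th Fourier coefficients satisfy
`d/dt [(1 + |n|^γ) û(n)] = -in (û(n) + (u²)^(n))`. -/
def IsSolution (γ : ℝ) {s : ℝ} (u : ℝ → Sobolev s) : Prop :=
  Continuous u ∧ ∀ (n : ℤ) (t : ℝ),
    HasDerivAt (fun τ => (((1 + |(n : ℝ)| ^ γ : ℝ)) : ℂ) * coeff (u τ).toL2 n)
      (-(Complex.I * n) * (coeff (u t).toL2 n +
        fourierCoeff (fun x : Torus => ((((u t).toL2 x) ^ 2 : ℝ) : ℂ)) n)) t

open Classical in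
/-- The flow `Φ(t)`: the value at time `t` of the global solution starting at `u₀` (the default
value `u₀` where there is none never occurs in the range of parameters where the equation is
globally well posed). -/
def flow (γ : ℝ) {s : ℝ} (t : ℝ) (u₀ : Sobolev s) : Sobolev s :=
  if h : ∃ u : ℝ → Sobolev s, IsSolution γ u ∧ u 0 = u₀ then h.choose t else u₀

end

end GBBM

namespace GBBM
noncomputable section

/-! ### Differential equations in Banach spaces with a field that is Lipschitz on balls -/

section Ode

open Set Metric
open scoped NNReal

variable {E F : Type*} [NormedAddCommGroup E] [NormedSpace ℝ E] [NormedAddCommGroup F]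

/-! In the rescaled coefficients `x n = n^s û(n)` the space `H^s` becomes `ℓ²` and the equation
becomes `x' = L(x + P(x, x))`. Here `L` is diagonal with entries `-iλ_n`, `λ_n = n/(1 + n^γ)`, and
`P` is multiplication of functions. As `γ > 1`, `L` is bounded and even gains `γ - 1` derivatives;
as `s ≥ 1`, `P` is bounded. So the equation is an ordinary differential equation with a quadratic
field. Its energy is conserved (`inner_energyMap_field`) and controls the sum of the absolute values
of the Fourier coefficients (`exists_wiener_le_energyMap`). By the tame product estimate the field
therefore grows only linearly along a solution, which gives a global flow that is bounded on balls
(`IsTame.norm_le_growth`).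

For the Gaussian measure, truncate to the modes `n ≤ N`. The truncated field is divergence free
(`trace_modeFieldDeriv`), so by Liouville its flow preserves Lebesgue measure. The Gaussian density
is a constant times `exp(‖x‖² - E(x))` with `E(x) = ∑ (1 + n^γ)|x n|²`, the `topEnergy`. On a ball
of initial data, the density of the transported measure with respect to the Gaussian one is at most
a constant times the exponential of the change of `E` (`lintegral_galerkinFlow_le`). By Hölder's
inequality with exponents `1/(1-δ)` and `1/δ` it suffices to bound the `1/δ`-th power of that
exponential, on the ball, by a function whose Gaussian integral is bounded uniformly in `N`.

The derivative of `E` is a trilinear form with symbol `a^(2s+1) + b^(2s+1) + c^(2s+1)` on `a + b + c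
= 0`. This symbol gains on the smallest frequency (`abs_odd_pow_sum_le`), so for `s ≥ 2` the form is
bounded on balls of `H^s` and nothing else is needed. For `s = 1` it is a multiple of `∫ (∂ₓu)³`,
which the `H^1` norm does not control. Duhamel's formula (`exists_galerkinFlow_eq`) splits `u` into
the linear evolution and a remainder whose derivative is bounded in `L²` and `L⁴`. The derivative
`w` of the linear evolution is, at each point of space-time, a Gaussian variable of variance bounded
by a multiple of `∑ n^(-γ)`. On the ball `∬ w²` is bounded, so Jensen's inequality with weight
proportional to `w²` bounds `exp(p ∬ |w|³)` by a constant times `1 + ∬ w² exp(K|w|)`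
(`exists_exp_topEnergy_sub_le`), whose expectation is finite for every `p`.

The estimate is proved for continuous functions, where the limit `N → ∞` is dominated convergence,
and is then passed to Borel sets by thickening and inner regularity. The cutoff set is invariant
under the flow, so the bound for `μ_s` gives the one for `μ_{s,r}`; the case `δ ≥ 1` is immediate
because all measures are at most one. -/

theorem gronwallBound_le {δ K ε x : ℝ} (hK : 0 ≤ K) (hε : 0 ≤ ε) :
    gronwallBound δ K ε x ≤ δ * Real.exp (K * x) + ε * x * Real.exp (K * x) := by
  rcases hK.eq_or_lt with rfl | hK
  · simp [gronwallBound_K0]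
  · rw [gronwallBound_of_K_ne_0 hK.ne']
    -- This is `1 - y ≤ exp(-y)` multiplied by `exp y`, with `y = K x`.
    have h : Real.exp (K * x) - 1 ≤ K * x * Real.exp (K * x) := by
      have h1 := Real.add_one_le_exp (-(K * x))
      have h2 : Real.exp (-(K * x)) * Real.exp (K * x) = 1 := by
        rw [← Real.exp_add]; simp
      nlinarith [Real.exp_pos (K * x)]
    have h3 : ε / K * (Real.exp (K * x) - 1) ≤ ε / K * (K * x * Real.exp (K * x)) := by gcongr
    have h4 : ε / K * (K * x * Real.exp (K * x)) = ε * x * Real.exp (K * x) := by field_simp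
    simp only
    linarith

/-- Grönwall's inequality on a symmetric interval. -/
theorem norm_le_of_norm_deriv_le {u u' : ℝ → E} {K ε T : ℝ} (hK : 0 ≤ K) (hε : 0 ≤ ε)
    (hu : ∀ t ∈ Icc (-T) T, HasDerivWithinAt u (u' t) (Icc (-T) T) t)
    (hb : ∀ t ∈ Icc (-T) T, ‖u' t‖ ≤ K * ‖u t‖ + ε) {t : ℝ} (ht : t ∈ Icc (-T) T) :
    ‖u t‖ ≤ (‖u 0‖ + ε * T) * Real.exp (K * T) := by
  have key : ∀ v v' : ℝ → E, (∀ t ∈ Icc (-T) T, HasDerivWithinAt v (v' t) (Icc (-T) T) t) →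
      (∀ t ∈ Icc (-T) T, ‖v' t‖ ≤ K * ‖v t‖ + ε) → ∀ t ∈ Icc 0 T,
      ‖v t‖ ≤ (‖v 0‖ + ε * T) * Real.exp (K * T) := by
    intro v v' hv hb t ht
    have hT : 0 ≤ T := ht.1.trans ht.2
    have hsub : Icc 0 T ⊆ Icc (-T) T := Icc_subset_Icc (by linarith) le_rfl
    have h := norm_le_gronwallBound_of_norm_deriv_right_le (f := v) (f' := v') (a := 0) (b := T)
      (fun x hx => ((hv x (hsub hx)).continuousWithinAt).mono hsub)
      (fun x hx => ((hv x (hsub (Ico_subset_Icc_self hx))).mono_of_mem_nhdsWithin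
        (mem_of_superset (Icc_mem_nhdsGE hx.2) (Icc_subset_Icc (by linarith [hx.1]) le_rfl))))
      le_rfl (fun x hx => hb x (hsub (Ico_subset_Icc_self hx))) t ht
    refine h.trans ((gronwallBound_le hK hε).trans ?_)
    rw [sub_zero, ← add_mul]
    have := ht.2
    gcongr
  rcases le_total 0 t with h0 | h0
  · exact key u u' hu hb t ⟨h0, ht.2⟩
  · have hneg : ∀ t ∈ Icc (-T) T, -t ∈ Icc (-T) T := fun t ht =>
      ⟨by linarith [ht.2], by linarith [ht.1]⟩
    have := key (fun t => u (-t)) (fun t => -u' (-t)) (fun t ht => ?_) (fun t ht => ?_) (-t)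
      ⟨by linarith, by linarith [ht.1]⟩
    · simpa using this
    · have h1 := HasDerivWithinAt.scomp t (hu (-t) (hneg t ht))
        (hasDerivAt_neg t).hasDerivWithinAt hneg
      simpa [Function.comp_def] using h1
    · simpa using hb (-t) (hneg t ht)

/-- Lipschitz continuity on bounded sets. -/
def LipschitzOnBalls (G : E → F) : Prop :=
  ∀ R : ℝ, ∃ K : ℝ≥0, LipschitzOnWith K G (closedBall 0 R)

/-- A priori bounds for all the equations `u' = c(t) G(u)` with `0 ≤ c ≤ 1`. -/
def HasAPrioriBounds (G : E → E) : Prop :=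
  ∀ r T : ℝ, ∃ M : ℝ, ∀ (c : ℝ → ℝ) (u : ℝ → E), (∀ t ∈ Icc (-T) T, 0 ≤ c t ∧ c t ≤ 1) →
    (∀ t ∈ Icc (-T) T, HasDerivWithinAt u (c t • G (u t)) (Icc (-T) T) t) → ‖u 0‖ ≤ r →
    ∀ t ∈ Icc (-T) T, ‖u t‖ ≤ M

/-- The flow of the autonomous differential equation `u' = G(u)`. -/
structure IsFlow (G : E → E) (φ : ℝ → E → E) : Prop where
  zero : ∀ x, φ 0 x = x
  hasDerivAt : ∀ x t, HasDerivAt (fun τ => φ τ x) (G (φ t x)) t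

omit [NormedSpace ℝ E] in
theorem exists_bound_of_continuous {u : ℝ → E} (hu : Continuous u) (T : ℝ) :
    ∃ M, ∀ t ∈ Icc (-T) T, ‖u t‖ ≤ M :=
  isCompact_Icc.exists_bound_of_continuousOn hu.continuousOn

theorem LipschitzOnBalls.unique {G : E → E} (hG : LipschitzOnBalls G) {u v : ℝ → E}
    (hu : ∀ t, HasDerivAt u (G (u t)) t) (hv : ∀ t, HasDerivAt v (G (v t)) t) (h0 : u 0 = v 0) :
    u = v := by
  have hcu : Continuous u := continuous_iff_continuousAt.2 fun t => (hu t).continuousAt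
  have hcv : Continuous v := continuous_iff_continuousAt.2 fun t => (hv t).continuousAt
  funext t
  obtain ⟨M, hM⟩ := exists_bound_of_continuous hcu (|t| + 1)
  obtain ⟨M', hM'⟩ := exists_bound_of_continuous hcv (|t| + 1)
  obtain ⟨K, hK⟩ := hG (max M M')
  have hw : ∀ τ ∈ Icc (-(|t| + 1)) (|t| + 1), HasDerivWithinAt (fun τ => u τ - v τ)
      (G (u τ) - G (v τ)) (Icc (-(|t| + 1)) (|t| + 1)) τ := fun τ _ =>
    ((hu τ).sub (hv τ)).hasDerivWithinAt
  have := norm_le_of_norm_deriv_le (K := K) (ε := 0) K.2 le_rfl hw (fun τ hτ => ?_)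
    (t := t) ⟨by linarith [neg_abs_le t], by linarith [le_abs_self t]⟩
  · simpa [h0, sub_eq_zero] using this
  · rw [add_zero, ← dist_eq_norm, ← dist_eq_norm]
    refine hK.dist_le_mul _ ?_ _ ?_
    · simpa using Or.inl (hM τ hτ)
    · simpa using Or.inr (hM' τ hτ)

theorem IsFlow.eq_of_hasDerivAt {G : E → E} (hG : LipschitzOnBalls G) {φ : ℝ → E → E}
    (hφ : IsFlow G φ) {u : ℝ → E} (hu : ∀ t, HasDerivAt u (G (u t)) t) (t : ℝ) :
    u t = φ t (u 0) :=
  congrFun (hG.unique hu (hφ.hasDerivAt (u 0)) (hφ.zero _).symm) t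

theorem IsFlow.add {G : E → E} (hG : LipschitzOnBalls G) {φ : ℝ → E → E}
    (hφ : IsFlow G φ) (s t : ℝ) (x : E) : φ (s + t) x = φ s (φ t x) := by
  have h : ∀ τ, HasDerivAt (fun τ => φ (τ + t) x) (G (φ (τ + t) x)) τ := fun τ =>
    (hφ.hasDerivAt x (τ + t)).comp_add_const τ t
  simpa using hφ.eq_of_hasDerivAt hG h s

theorem IsFlow.neg_apply {G : E → E} (hG : LipschitzOnBalls G) {φ : ℝ → E → E}
    (hφ : IsFlow G φ) (t : ℝ) (x : E) : φ (-t) (φ t x) = x := by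
  rw [← hφ.add hG, neg_add_cancel, hφ.zero]

theorem IsFlow.apply_neg {G : E → E} (hG : LipschitzOnBalls G) {φ : ℝ → E → E}
    (hφ : IsFlow G φ) (t : ℝ) (x : E) : φ t (φ (-t) x) = x := by
  rw [← hφ.add hG, add_neg_cancel, hφ.zero]

theorem IsFlow.exists_bound {G : E → E} (hA : HasAPrioriBounds G) {φ : ℝ → E → E}
    (hφ : IsFlow G φ) (r T : ℝ) :
    ∃ M : ℝ, ∀ x, ‖x‖ ≤ r → ∀ t ∈ Icc (-T) T, ‖φ t x‖ ≤ M := by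
  obtain ⟨M, hM⟩ := hA r T
  refine ⟨M, fun x hx => hM (fun _ => 1) (fun t => φ t x) (by simp) (fun t _ => ?_) ?_⟩
  · simpa using (hφ.hasDerivAt x t).hasDerivWithinAt
  · simpa [hφ.zero] using hx

theorem IsFlow.exists_lipschitz {G : E → E} (hG : LipschitzOnBalls G) (hA : HasAPrioriBounds G)
    {φ : ℝ → E → E} (hφ : IsFlow G φ) (r T : ℝ) :
    ∃ L : ℝ, 0 ≤ L ∧ ∀ x y, ‖x‖ ≤ r → ‖y‖ ≤ r → ∀ t ∈ Icc (-T) T,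
      ‖φ t x - φ t y‖ ≤ L * ‖x - y‖ := by
  obtain ⟨M, hM⟩ := hφ.exists_bound hA r T
  obtain ⟨K, hK⟩ := hG M
  refine ⟨Real.exp (K * T), (Real.exp_pos _).le, fun x y hx hy t ht => ?_⟩
  have := norm_le_of_norm_deriv_le (u := fun t => φ t x - φ t y) (K := K) (ε := 0) K.2 le_rfl
    (fun τ _ => ((hφ.hasDerivAt x τ).sub (hφ.hasDerivAt y τ)).hasDerivWithinAt)
    (fun τ hτ => ?_) ht
  · simpa [hφ.zero, mul_comm] using this
  · rw [add_zero, ← dist_eq_norm, ← dist_eq_norm]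
    exact hK.dist_le_mul _ (by simpa using hM x hx τ hτ) _ (by simpa using hM y hy τ hτ)

omit [NormedSpace ℝ E] in
theorem LipschitzOnBalls.exists_norm_le {G : E → F} (hG : LipschitzOnBalls G) (R : ℝ) :
    ∃ M : ℝ≥0, ∀ x ∈ closedBall (0 : E) R, ‖G x‖ ≤ M := by
  obtain ⟨K, hK⟩ := hG (max R 0)
  refine ⟨K * Real.toNNReal (max R 0) + ‖G 0‖₊, fun x hx => ?_⟩
  have hx' : ‖x‖ ≤ max R 0 := le_max_of_le_left (by simpa using hx)
  have h := hK.dist_le_mul x (by simpa using hx') 0 (by simp)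
  rw [dist_eq_norm, dist_eq_norm, sub_zero] at h
  have h2 : ‖G x‖ ≤ ‖G x - G 0‖ + ‖G 0‖ := by simpa using norm_add_le (G x - G 0) (G 0)
  have h3 : (K : ℝ) * ‖x‖ ≤ K * max R 0 := by gcongr
  simp only [NNReal.coe_add, NNReal.coe_mul, coe_nnnorm, Real.coe_toNNReal', max_assoc, max_self]
  linarith

/-- A cutoff function on `ℝ`, equal to `1` on `[0, R]` and to `0` beyond `R + 1`. -/
def ramp (R r : ℝ) : ℝ := max 0 (min 1 (R + 1 - r))

theorem ramp_mem (R r : ℝ) : 0 ≤ ramp R r ∧ ramp R r ≤ 1 :=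
  ⟨le_max_left _ _, max_le zero_le_one (min_le_left _ _)⟩

theorem ramp_of_le {R r : ℝ} (h : r ≤ R) : ramp R r = 1 := by
  rw [ramp, min_eq_left (by linarith), max_eq_right zero_le_one]

theorem ramp_of_ge {R r : ℝ} (h : R + 1 ≤ r) : ramp R r = 0 :=
  max_eq_left ((min_le_right _ _).trans (by linarith))

theorem abs_ramp_sub_le (R r r' : ℝ) : |ramp R r - ramp R r'| ≤ |r - r'| := by
  unfold ramp
  refine (abs_max_sub_max_le_max _ _ _ _).trans (max_le (by simp) ?_)
  refine (abs_min_sub_min_le_max _ _ _ _).trans (max_le (by simp) ?_)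
  rw [abs_sub_comm r]
  exact le_of_eq (by congr 1; ring)

/-- Global solvability on symmetric intervals. -/
theorem exists_solution_Icc [CompleteSpace E] {G : E → E} (hG : LipschitzOnBalls G)
    (hA : HasAPrioriBounds G) (x : E) {T : ℝ} (hT : 0 ≤ T) :
    ∃ u : ℝ → E, u 0 = x ∧ ∀ t ∈ Icc (-T) T, HasDerivWithinAt u (G (u t)) (Icc (-T) T) t := by
  obtain ⟨M, hM⟩ := hA ‖x‖ T
  obtain ⟨L, hL⟩ := hG.exists_norm_le (M + 1)
  let a : ℝ≥0 := L * ⟨T, hT⟩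
  obtain ⟨K, hK⟩ := hG (‖x‖ + a)
  obtain ⟨B, hB⟩ := hG.exists_norm_le (‖x‖ + a)
  have hsub : closedBall x a ⊆ closedBall 0 (‖x‖ + a) := by
    intro y hy
    rw [mem_closedBall, dist_eq_norm] at hy
    rw [mem_closedBall, dist_zero_right]
    have := norm_add_le (y - x) x
    rw [sub_add_cancel] at this
    linarith
  -- The cutoff makes the field bounded by `L` everywhere, so Picard–Lindelöf on a ball of radius `a
  -- = L T` reaches time `T` in one step. The a priori bound, applied with `c t = ramp M ‖u t‖`,
  -- then shows that the cutoff equals one along the solution.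
  have hPL : IsPicardLindelof (fun _ y => ramp M ‖y‖ • G y) (⟨0, by simp [hT]⟩ : Icc (-T) T)
      x a 0 L (K + B) := by
    refine ⟨fun t _ => LipschitzOnWith.of_dist_le_mul fun y hy z hz => ?_,
      fun y _ => continuousOn_const, fun t _ y _ => ?_, ?_⟩
    · rw [dist_eq_norm, dist_eq_norm]
      have h1 : ramp M ‖y‖ • G y - ramp M ‖z‖ • G z =
          ramp M ‖y‖ • (G y - G z) + (ramp M ‖y‖ - ramp M ‖z‖) • G z := by
        rw [smul_sub, sub_smul]; abel
      have h2 := hK.dist_le_mul y (hsub hy) z (hsub hz)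
      rw [dist_eq_norm, dist_eq_norm] at h2
      have h3 := (abs_ramp_sub_le M ‖y‖ ‖z‖).trans (abs_norm_sub_norm_le y z)
      have h4 := hB z (hsub hz)
      rw [h1, NNReal.coe_add, add_mul]
      refine (norm_add_le _ _).trans (add_le_add ?_ ?_)
      · rw [norm_smul, Real.norm_eq_abs, abs_of_nonneg (ramp_mem _ _).1]
        exact (mul_le_of_le_one_left (norm_nonneg _) (ramp_mem _ _).2).trans h2
      · rw [norm_smul, Real.norm_eq_abs, mul_comm]
        gcongr
    · rcases le_total (M + 1) ‖y‖ with h | h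
      · simp [ramp_of_ge h]
      · rw [norm_smul, Real.norm_eq_abs, abs_of_nonneg (ramp_mem _ _).1]
        exact (mul_le_of_le_one_left (norm_nonneg _) (ramp_mem _ _).2).trans
          (hL y (by simpa using h))
    · simp only [sub_zero, zero_sub, neg_neg, max_self, NNReal.coe_zero, a]
      exact le_rfl
  obtain ⟨u, hu0, hu⟩ := hPL.exists_eq_forall_mem_Icc_hasDerivWithinAt₀
  refine ⟨u, hu0, fun t ht => ?_⟩
  have hb := hM (fun t => ramp M ‖u t‖) u (fun t _ => ramp_mem _ _) hu (by simp at hu0; rw [hu0]) t ht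
  simpa [ramp_of_le hb] using hu t ht

/-- Solutions on the intervals `[-n, n]` agree on overlaps by Grönwall, hence glue.
Differentiability at `t` is read off the solution on `[-(N t + 1), N t + 1]`, of which `t` is an
interior point. -/
theorem exists_isFlow [CompleteSpace E] {G : E → E} (hG : LipschitzOnBalls G)
    (hA : HasAPrioriBounds G) : ∃ φ, IsFlow G φ := by
  choose U hU0 hU using fun (x : E) (n : ℕ) => exists_solution_Icc hG hA x (T := n) (by positivity)
  have hagree : ∀ x (m n : ℕ), m ≤ n → ∀ t ∈ Icc (-(m : ℝ)) m, U x m t = U x n t := by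
    intro x m n hmn t ht
    have hmn' : (m : ℝ) ≤ n := by exact_mod_cast hmn
    have hsub : Icc (-(m : ℝ)) m ⊆ Icc (-(n : ℝ)) n := Icc_subset_Icc (by linarith) hmn'
    have hd : ∀ τ ∈ Icc (-(m : ℝ)) m, HasDerivWithinAt (fun τ => U x m τ - U x n τ)
        (G (U x m τ) - G (U x n τ)) (Icc (-(m : ℝ)) m) τ := fun τ hτ =>
      (hU x m τ hτ).sub ((hU x n τ (hsub hτ)).mono hsub)
    obtain ⟨M, hM⟩ := isCompact_Icc.exists_bound_of_continuousOn (s := Icc (-(m : ℝ)) m)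
      fun τ hτ => (hU x m τ hτ).continuousWithinAt
    obtain ⟨M', hM'⟩ := isCompact_Icc.exists_bound_of_continuousOn (s := Icc (-(n : ℝ)) n)
      fun τ hτ => (hU x n τ hτ).continuousWithinAt
    obtain ⟨K, hK⟩ := hG (max M M')
    have := norm_le_of_norm_deriv_le (K := K) (ε := 0) K.2 le_rfl hd (fun τ hτ => ?_) ht
    · simpa [hU0, sub_eq_zero] using this
    · rw [add_zero, ← dist_eq_norm, ← dist_eq_norm]
      refine hK.dist_le_mul _ ?_ _ ?_
      · simpa using Or.inl (hM τ hτ)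
      · simpa using Or.inr (hM' τ (hsub hτ))
  have hmem : ∀ (n : ℕ) (t : ℝ), t ∈ Icc (-(n : ℝ)) n ↔ |t| ≤ n := fun n t => abs_le.symm
  let N : ℝ → ℕ := fun t => ⌈|t|⌉₊
  have hN : ∀ t, |t| ≤ N t := fun t => Nat.le_ceil _
  have hval : ∀ x (n : ℕ) (t : ℝ), |t| ≤ n → U x (N t) t = U x n t := fun x n t ht =>
    hagree x _ _ (Nat.ceil_le.2 ht) t ((hmem _ t).2 (hN t))
  refine ⟨fun t x => U x (N t) t, fun x => hU0 x _, fun x t => ?_⟩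
  have hlt : |t| < ((N t + 1 : ℕ) : ℝ) := by push_cast; linarith [hN t]
  have hnb : Icc (-((N t + 1 : ℕ) : ℝ)) ((N t + 1 : ℕ) : ℝ) ∈ 𝓝 t :=
    Icc_mem_nhds (abs_lt.1 hlt).1 (abs_lt.1 hlt).2
  have h := (hU x (N t + 1) t ((hmem _ _).2 hlt.le)).hasDerivAt hnb
  rw [← hval x _ t hlt.le] at h
  refine h.congr_of_eventuallyEq ?_
  filter_upwards [hnb] with τ hτ
  exact hval x _ τ ((hmem _ _).1 hτ)

end Ode

/-! ### Jacobi's formula, differentiability of flows and Liouville's theorem -/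

section Liouville

open Set Metric
open scoped NNReal

/-- The determinant is a polynomial `1 + h tr B + h² p(h)`. -/
theorem hasDerivAt_det_one_add_smul {n : Type*} [Fintype n] [DecidableEq n]
    (B : Matrix n n ℝ) : HasDerivAt (fun h : ℝ => (1 + h • B).det) B.trace 0 := by
  have h := Matrix.det_one_add_smul (R := ℝ) (n := n)
  simp only [h]
  set p := (Matrix.det (1 + (Polynomial.X : Polynomial ℝ) • B.map Polynomial.C)).divX.divX
  have h2 := (((hasDerivAt_id (0 : ℝ)).const_mul B.trace).const_add 1).add
    ((p.hasDerivAt 0).mul ((hasDerivAt_id (0 : ℝ)).pow 2))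
  refine (h2.congr_deriv ?_)
  simp

/-- The determinant is differentiable, so its derivative along a curve depends only on the velocity.
The curve may thus be replaced by the line `M + h B M`, on which the determinant factors as `det(1 +
h B) det M`. -/
theorem hasDerivAt_matrix_det {n : Type*} [Fintype n] [DecidableEq n]
    {M : ℝ → n → n → ℝ} {B : Matrix n n ℝ} {t : ℝ}
    (hM : HasDerivAt M (B * Matrix.of (M t) : Matrix n n ℝ) t) :
    HasDerivAt (fun τ => (Matrix.of (M τ)).det) (B.trace * (Matrix.of (M t)).det) t := by
  have hD : Differentiable ℝ fun A : n → n → ℝ => (Matrix.of A).det := by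
    simp only [Matrix.det_apply, Matrix.of_apply]
    fun_prop
  have h1 := (hD (M t)).hasFDerivAt.comp_hasDerivAt t hM
  refine h1.congr_deriv ?_
  let X : n → n → ℝ := (B * Matrix.of (M t) : Matrix n n ℝ)
  have hl : HasDerivAt (fun h : ℝ => M t + h • X) X 0 := by
    simpa using ((hasDerivAt_id (0 : ℝ)).smul_const X).const_add (M t)
  have h2 := HasFDerivAt.comp_hasDerivAt (x := (0 : ℝ)) (f := fun h : ℝ => M t + h • X)
    (l := fun A : n → n → ℝ => (Matrix.of A).det)
    (l' := fderiv ℝ (fun A : n → n → ℝ => (Matrix.of A).det) (M t))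
    (by simpa using (hD (M t)).hasFDerivAt) hl
  have h3 := (hasDerivAt_det_one_add_smul B).mul_const (Matrix.of (M t)).det
  refine h2.unique (h3.congr_of_eventuallyEq (Eventually.of_forall fun h => ?_))
  simp only [Function.comp_apply, ← Matrix.det_mul]
  congr 1
  rw [add_mul, one_mul, Matrix.smul_mul]
  rfl

variable {V : Type*} [NormedAddCommGroup V] [NormedSpace ℝ V] [FiniteDimensional ℝ V]

/-- **Jacobi's formula** along a curve of linear maps. -/
theorem hasDerivAt_clm_det {f : ℝ → V →L[ℝ] V} {A : V →L[ℝ] V} {t : ℝ}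
    (hf : HasDerivAt f (A ∘L f t) t) :
    HasDerivAt (fun τ => (f τ).det) (LinearMap.trace ℝ V A * (f t).det) t := by
  let b := Module.finBasis ℝ V
  have hdet : ∀ g : V →L[ℝ] V, g.det = (LinearMap.toMatrix b b (g : V →ₗ[ℝ] V)).det := fun g =>
    (LinearMap.det_toMatrix b _).symm
  simp only [hdet, LinearMap.trace_eq_matrix_trace ℝ b]
  refine hasDerivAt_matrix_det (M := fun τ => LinearMap.toMatrix b b (f τ : V →ₗ[ℝ] V))
    (B := LinearMap.toMatrix b b (A : V →ₗ[ℝ] V)) ?_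
  have hc : LinearMap.toMatrix b b (A : V →ₗ[ℝ] V) * LinearMap.toMatrix b b (f t : V →ₗ[ℝ] V) =
      LinearMap.toMatrix b b ((A ∘L f t : V →L[ℝ] V) : V →ₗ[ℝ] V) := by
    rw [← LinearMap.toMatrix_comp b b b]; rfl
  let Λ : (V →L[ℝ] V) →L[ℝ] (Fin (Module.finrank ℝ V) → Fin (Module.finrank ℝ V) → ℝ) :=
    LinearMap.toContinuousLinearMap
      ((LinearMap.toMatrix b b).toLinearMap ∘ₗ ContinuousLinearMap.coeLM ℝ)
  have := Λ.hasFDerivAt.comp_hasDerivAt t hf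
  refine this.congr_deriv ?_
  exact hc.symm

variable {G : V → V} {G' : V → V →L[ℝ] V} {φ : ℝ → V → V}

omit [FiniteDimensional ℝ V] in
theorem norm_sub_sub_le_of_lipschitz {K : ℝ≥0} {R : ℝ} (hG : ∀ x, HasFDerivAt G (G' x) x)
    (hK : LipschitzOnWith K G' (closedBall 0 R)) {x y : V} (hx : ‖x‖ ≤ R) (hy : ‖y‖ ≤ R) :
    ‖G y - G x - G' x (y - x)‖ ≤ K * ‖y - x‖ ^ 2 := by
  have hseg : segment ℝ x y ⊆ closedBall 0 R :=
    (convex_closedBall (0 : V) R).segment_subset (by simpa using hx) (by simpa using hy)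
  have := (convex_segment (𝕜 := ℝ) x y).norm_image_sub_le_of_norm_hasFDerivWithin_le' (φ := G' x)
    (f := G) (f' := G') (C := K * ‖y - x‖) (fun z _ => (hG z).hasFDerivWithinAt) (fun z hz => ?_)
    (left_mem_segment ℝ x y) (right_mem_segment ℝ x y)
  · simpa [pow_two, mul_assoc] using this
  · have h1 := hK.dist_le_mul z (hseg hz) x (by simpa using hx)
    rw [dist_eq_norm, dist_eq_norm] at h1
    have h2 : ‖z - x‖ ≤ ‖y - x‖ := by
      obtain ⟨θ, hθ, rfl⟩ := (segment_eq_image' ℝ x y ▸ hz : z ∈ _)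
      simp only [add_sub_cancel_left, norm_smul, Real.norm_eq_abs, abs_of_nonneg hθ.1]
      exact mul_le_of_le_one_left (norm_nonneg _) hθ.2
    exact h1.trans (by gcongr)

/-- The vector field of the equation together with its linearisation. -/
def variationalField (G : V → V) (G' : V → V →L[ℝ] V) (p : V × (V →L[ℝ] V)) :
    V × (V →L[ℝ] V) := (G p.1, G' p.1 ∘L p.2)

omit [FiniteDimensional ℝ V] in
theorem lipschitzOnBalls_variationalField (hG : LipschitzOnBalls G) (hG' : LipschitzOnBalls G') :
    LipschitzOnBalls (variationalField G G') := by
  intro R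
  obtain ⟨K, hK⟩ := hG R
  obtain ⟨K', hK'⟩ := hG' R
  obtain ⟨M, hM⟩ := hG'.exists_norm_le R
  refine ⟨max K (K' * R.toNNReal + M), LipschitzOnWith.of_dist_le_mul fun p hp q hq => ?_⟩
  rw [mem_closedBall_zero_iff] at hp hq
  have hp1 : p.1 ∈ closedBall (0 : V) R := by simpa using (norm_fst_le p).trans hp
  have hq1 : q.1 ∈ closedBall (0 : V) R := by simpa using (norm_fst_le q).trans hq
  have hR : 0 ≤ R := (norm_nonneg _).trans hp
  have h1 := hK.dist_le_mul _ hp1 _ hq1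
  have h2 := hK'.dist_le_mul _ hp1 _ hq1
  have hd1 : dist p.1 q.1 ≤ dist p q := le_max_left _ _
  have hd2 : dist p.2 q.2 ≤ dist p q := le_max_right _ _
  rw [Prod.dist_eq (x := variationalField G G' p)]
  refine max_le (h1.trans ?_) ?_
  · refine mul_le_mul ?_ hd1 dist_nonneg (by positivity)
    exact_mod_cast le_max_left _ _
  · have he : (variationalField G G' p).2 - (variationalField G G' q).2 =
        (G' p.1 - G' q.1) ∘L p.2 + G' q.1 ∘L (p.2 - q.2) := by
      ext v; simp [variationalField]
    rw [dist_eq_norm, he]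
    have h3 : ‖(G' p.1 - G' q.1) ∘L p.2‖ ≤ K' * R * dist p q := by
      refine (ContinuousLinearMap.opNorm_comp_le _ _).trans ?_
      rw [← dist_eq_norm, mul_right_comm]
      exact mul_le_mul (h2.trans (by gcongr)) ((norm_snd_le p).trans hp) (norm_nonneg _)
        (by positivity)
    have h4 : ‖G' q.1 ∘L (p.2 - q.2)‖ ≤ M * dist p q := by
      refine (ContinuousLinearMap.opNorm_comp_le _ _).trans ?_
      rw [← dist_eq_norm]
      exact mul_le_mul (hM _ hq1) hd2 dist_nonneg (by positivity)
    refine (norm_add_le _ _).trans ((add_le_add h3 h4).trans ?_)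
    rw [← add_mul]
    refine mul_le_mul_of_nonneg_right ?_ dist_nonneg
    rw [NNReal.coe_max]
    refine le_max_of_le_right ?_
    simp [hR]

omit [FiniteDimensional ℝ V] in
-- The first component is bounded by assumption; the second then solves a linear equation with
-- bounded coefficients, so Grönwall applies. This makes `exists_isFlow` applicable to the pair of
-- the equation and its linearisation.
theorem hasAPrioriBounds_variationalField (hA : HasAPrioriBounds G) (hG' : LipschitzOnBalls G') :
    HasAPrioriBounds (variationalField G G') := by
  intro r T
  obtain ⟨M, hM⟩ := hA r T
  obtain ⟨K, hK⟩ := hG'.exists_norm_le M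
  refine ⟨max M (r * Real.exp (K * T)), fun c u hc hu h0 t ht => ?_⟩
  have hu1 : ∀ t ∈ Icc (-T) T,
      HasDerivWithinAt (fun t => (u t).1) (c t • G (u t).1) (Icc (-T) T) t := fun t ht =>
    (ContinuousLinearMap.fst ℝ V (V →L[ℝ] V)).hasFDerivAt.comp_hasDerivWithinAt t (hu t ht)
  have hu2 : ∀ t ∈ Icc (-T) T,
      HasDerivWithinAt (fun t => (u t).2) (c t • (G' (u t).1 ∘L (u t).2)) (Icc (-T) T) t :=
    fun t ht =>
    (ContinuousLinearMap.snd ℝ V (V →L[ℝ] V)).hasFDerivAt.comp_hasDerivWithinAt t (hu t ht)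
  have hb1 := hM c _ hc hu1 ((norm_fst_le _).trans h0)
  refine max_le (le_max_of_le_left (hb1 t ht)) (le_max_of_le_right ?_)
  have := norm_le_of_norm_deriv_le (K := K) (ε := 0) K.2 le_rfl hu2 (fun τ hτ => ?_) ht
  · rw [zero_mul, add_zero] at this
    refine this.trans ?_
    gcongr
    exact (norm_snd_le _).trans h0
  · rw [add_zero, norm_smul, Real.norm_eq_abs, abs_of_nonneg (hc τ hτ).1]
    refine (mul_le_of_le_one_left (norm_nonneg _) (hc τ hτ).2).trans ?_
    refine (ContinuousLinearMap.opNorm_comp_le _ _).trans ?_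
    gcongr
    exact hK _ (by simpa using hb1 τ hτ)

/-- The flow of a divergence free vector field is differentiable, with derivative of
determinant one. -/
theorem IsFlow.exists_hasFDerivAt_det_eq_one (hGd : ∀ x, HasFDerivAt G (G' x) x)
    (hG : LipschitzOnBalls G) (hG' : LipschitzOnBalls G') (hA : HasAPrioriBounds G)
    (htr : ∀ x, LinearMap.trace ℝ V (G' x) = 0) (hφ : IsFlow G φ) (t : ℝ) (x : V) :
    ∃ J : V →L[ℝ] V, HasFDerivAt (φ t) J x ∧ J.det = 1 := by
  obtain ⟨ψ, hψ⟩ := exists_isFlow (lipschitzOnBalls_variationalField hG hG')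
    (hasAPrioriBounds_variationalField hA hG')
  let u : ℝ → V × (V →L[ℝ] V) := fun t => ψ t (x, ContinuousLinearMap.id ℝ V)
  have hu : ∀ t, HasDerivAt u (variationalField G G' (u t)) t := hψ.hasDerivAt _
  have hu0 : u 0 = (x, ContinuousLinearMap.id ℝ V) := hψ.zero _
  have hu1 : ∀ t, HasDerivAt (fun t => (u t).1) (G (u t).1) t := fun t =>
    (ContinuousLinearMap.fst ℝ V (V →L[ℝ] V)).hasFDerivAt.comp_hasDerivAt t (hu t)
  have hu2 : ∀ t, HasDerivAt (fun t => (u t).2) (G' (u t).1 ∘L (u t).2) t := fun t =>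
    (ContinuousLinearMap.snd ℝ V (V →L[ℝ] V)).hasFDerivAt.comp_hasDerivAt t (hu t)
  have hfst : ∀ t, (u t).1 = φ t x := fun t => by
    simpa [hu0] using hφ.eq_of_hasDerivAt hG hu1 t
  refine ⟨(u t).2, ?_, ?_⟩
  · obtain ⟨M, hM⟩ := hφ.exists_bound hA (‖x‖ + 1) |t|
    obtain ⟨L, hL0, hL⟩ := hφ.exists_lipschitz hG hA (‖x‖ + 1) |t|
    obtain ⟨K, hK⟩ := hG' M
    obtain ⟨B, hB⟩ := hG'.exists_norm_le M
    have ht : t ∈ Icc (-|t|) |t| := ⟨neg_abs_le t, le_abs_self t⟩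
    -- The error of the linearisation solves the linearised equation with a source which is the
    -- second order Taylor remainder of `G`, of size `‖h‖²` because the flow is Lipschitz in its
    -- initial value.
    have hquad : ∀ h : V, ‖h‖ ≤ 1 → ‖φ t (x + h) - φ t x - (u t).2 h‖ ≤
        (K * L ^ 2 * |t| * Real.exp (B * |t|)) * ‖h‖ ^ 2 := by
      intro h hh
      have hx1 : ‖x‖ ≤ ‖x‖ + 1 := by linarith
      have hx2 : ‖x + h‖ ≤ ‖x‖ + 1 := (norm_add_le _ _).trans (by linarith)
      have hd : ∀ τ ∈ Icc (-|t|) |t|,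
          HasDerivWithinAt (fun τ => φ τ (x + h) - φ τ x - (u τ).2 h)
            (G (φ τ (x + h)) - G (φ τ x) - G' (φ τ x) ((u τ).2 h)) (Icc (-|t|) |t|) τ := by
        intro τ _
        have h3 := (hu2 τ).clm_apply (hasDerivAt_const τ h)
        rw [hfst] at h3
        simp only [map_zero, add_zero, ContinuousLinearMap.comp_apply] at h3
        exact (((hφ.hasDerivAt _ τ).sub (hφ.hasDerivAt _ τ)).sub h3).hasDerivWithinAt
      have := norm_le_of_norm_deriv_le (K := B) (ε := K * L ^ 2 * ‖h‖ ^ 2) B.2 (by positivity) hd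
        (fun τ hτ => ?_) ht
      · refine this.trans (le_of_eq ?_)
        simp only [hφ.zero, hu0, ContinuousLinearMap.id_apply, add_sub_cancel_left, sub_self,
          norm_zero, zero_add]
        ring
      · have h5 := norm_sub_sub_le_of_lipschitz hGd hK (hM x hx1 τ hτ) (hM _ hx2 τ hτ)
        have h6 := hL (x + h) x hx2 hx1 τ hτ
        rw [add_sub_cancel_left] at h6
        have h7 : G (φ τ (x + h)) - G (φ τ x) - G' (φ τ x) ((u τ).2 h) =
            G' (φ τ x) (φ τ (x + h) - φ τ x - (u τ).2 h) +
              (G (φ τ (x + h)) - G (φ τ x) - G' (φ τ x) (φ τ (x + h) - φ τ x)) := by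
          simp only [map_sub]; abel
        rw [h7]
        refine (norm_add_le _ _).trans (add_le_add ?_ (h5.trans ?_))
        · refine (ContinuousLinearMap.le_opNorm _ _).trans ?_
          gcongr
          exact hB _ (by simpa using hM x hx1 τ hτ)
        · rw [mul_assoc, ← mul_pow]
          gcongr
    rw [hasFDerivAt_iff_isLittleO_nhds_zero]
    have hO : (fun h : V => φ t (x + h) - φ t x - (u t).2 h) =O[𝓝 0] fun h => ‖h‖ ^ 2 := by
      refine Asymptotics.IsBigO.of_bound (K * L ^ 2 * |t| * Real.exp (B * |t|)) ?_
      filter_upwards [closedBall_mem_nhds (0 : V) one_pos] with h hh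
      simpa using hquad h (by simpa using hh)
    exact hO.trans_isLittleO (Asymptotics.isLittleO_norm_pow_id one_lt_two)
  -- Jacobi's formula with vanishing trace: the determinant is constant in time.
  · have hdet : ∀ t, HasDerivAt (fun τ => (u τ).2.det) 0 t := fun t => by
      simpa [htr] using hasDerivAt_clm_det (hu2 t)
    have hc := is_const_of_deriv_eq_zero (fun t => (hdet t).differentiableAt)
      (fun t => (hdet t).deriv) t 0
    rw [hc, hu0]
    simp [ContinuousLinearMap.det]

/-- **Liouville's theorem**: the flow of a divergence free vector field preserves volumes. -/
theorem IsFlow.lintegral_comp [MeasurableSpace V] [BorelSpace V] {μ : Measure V}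
    [μ.IsAddHaarMeasure] (hGd : ∀ x, HasFDerivAt G (G' x) x)
    (hG : LipschitzOnBalls G) (hG' : LipschitzOnBalls G') (hA : HasAPrioriBounds G)
    (htr : ∀ x, LinearMap.trace ℝ V (G' x) = 0) (hφ : IsFlow G φ) (t : ℝ) (f : V → ℝ≥0∞) :
    ∫⁻ x, f (φ t x) ∂μ = ∫⁻ x, f x ∂μ := by
  choose J hJ hdet using hφ.exists_hasFDerivAt_det_eq_one hGd hG hG' hA htr t
  have h := lintegral_image_eq_lintegral_abs_det_fderiv_mul μ MeasurableSet.univ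
    (fun x _ => (hJ x).hasFDerivWithinAt)
    (Function.LeftInverse.injective (hφ.neg_apply hG t)).injOn f
  rw [image_univ, (Function.RightInverse.surjective (hφ.apply_neg hG t)).range_eq] at h
  simpa [hdet] using h.symm

end Liouville

/-! ### Square summable sequences, multipliers, Cauchy–Schwarz and Young -/

section Sequences

open Set

/-- Square summable sequences of complex numbers indexed by the positive integers. -/
abbrev Ell : Type := lp (fun _ : ℕ+ => ℂ) 2

theorem enorm_sq_eq_ofReal {E : Type*} [SeminormedAddCommGroup E] (z : E) :
    ‖z‖ₑ ^ 2 = ENNReal.ofReal (‖z‖ ^ 2) := by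
  rw [ENNReal.ofReal_pow (norm_nonneg _), ofReal_norm]

theorem memlp_two_of_tsum_lt_top {ι : Type*} {g : ι → ℂ} (h : ∑' n, ‖g n‖ₑ ^ 2 ≠ ∞) :
    Memℓp g 2 := by
  apply memℓp_gen
  have : Summable fun n => (‖g n‖ₑ ^ 2).toReal := ENNReal.summable_toReal h
  simpa using this

theorem hasSum_norm_sq (x : Ell) : HasSum (fun n => ‖x n‖ ^ 2) (‖x‖ ^ 2) := by
  simpa using lp.hasSum_norm (p := 2) (by norm_num) x

theorem enorm_sq_eq_tsum (x : Ell) : ‖x‖ₑ ^ 2 = ∑' n, ‖x n‖ₑ ^ 2 := by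
  simp only [enorm_sq_eq_ofReal]
  rw [← (hasSum_norm_sq x).tsum_eq,
    ENNReal.ofReal_tsum_of_nonneg (fun n => by positivity) (hasSum_norm_sq x).summable]

theorem norm_le_of_tsum_le {x : Ell} {C : ℝ} (hC : 0 ≤ C)
    (h : ∑' n, ‖x n‖ₑ ^ 2 ≤ ENNReal.ofReal (C ^ 2)) : ‖x‖ ≤ C := by
  rw [← enorm_sq_eq_tsum, enorm_sq_eq_ofReal, ENNReal.ofReal_le_ofReal_iff (by positivity)] at h
  exact (sq_le_sq₀ (norm_nonneg _) hC).1 h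

theorem norm_apply_le (x : Ell) (n : ℕ+) : ‖x n‖ ≤ ‖x‖ := lp.norm_apply_le_norm (by norm_num) x n

/-- Multiplication of a sequence by a bounded sequence. -/
def diag (m : ℕ+ → ℂ) (hm : ∃ C, ∀ n, ‖m n‖ ≤ C) : Ell →L[ℝ] Ell :=
  have key : ∀ C, (∀ n, ‖m n‖ ≤ C) → ∀ x : Ell,
      ∑' n, ‖m n * x n‖ₑ ^ 2 ≤ ENNReal.ofReal ((C * ‖x‖) ^ 2) := fun C hC x => by
    have hC0 : 0 ≤ C := (norm_nonneg _).trans (hC 1)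
    calc ∑' n, ‖m n * x n‖ₑ ^ 2 ≤ ∑' n, ENNReal.ofReal (C ^ 2) * ‖x n‖ₑ ^ 2 := by
          refine ENNReal.tsum_le_tsum fun n => ?_
          rw [enorm_mul, mul_pow, enorm_sq_eq_ofReal (m n)]
          have := hC n
          gcongr
      _ = _ := by
          rw [ENNReal.tsum_mul_left, ← enorm_sq_eq_tsum, enorm_sq_eq_ofReal, mul_pow,
            ENNReal.ofReal_mul (by positivity)]
  LinearMap.mkContinuousOfExistsBound
    { toFun := fun x => ⟨fun n => m n * x n, memlp_two_of_tsum_lt_top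
        (ne_top_of_le_ne_top ENNReal.ofReal_ne_top (key hm.choose hm.choose_spec x))⟩
      map_add' := fun x y => Subtype.ext (by funext n; exact mul_add _ _ _)
      map_smul' := fun c x => Subtype.ext (by funext n; simp; ring) }
    ⟨hm.choose, fun x => norm_le_of_tsum_le
      (mul_nonneg ((norm_nonneg _).trans (hm.choose_spec 1)) (norm_nonneg _))
      (key hm.choose hm.choose_spec x)⟩

@[simp]
theorem diag_apply (m : ℕ+ → ℂ) (hm : ∃ C, ∀ n, ‖m n‖ ≤ C) (x : Ell) (n : ℕ+) :
    diag m hm x n = m n * x n := rfl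

theorem norm_le_mul_norm_of_le {x y : Ell} {C : ℝ} (hC : 0 ≤ C) (h : ∀ n, ‖x n‖ ≤ C * ‖y n‖) :
    ‖x‖ ≤ C * ‖y‖ := by
  refine norm_le_of_tsum_le (by positivity) ?_
  rw [mul_pow, ENNReal.ofReal_mul (by positivity), ← enorm_sq_eq_ofReal, enorm_sq_eq_tsum,
    ← ENNReal.tsum_mul_left]
  refine ENNReal.tsum_le_tsum fun n => ?_
  rw [enorm_sq_eq_ofReal, enorm_sq_eq_ofReal, ← ENNReal.ofReal_mul (by positivity), ← mul_pow]
  have := h n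
  gcongr

theorem norm_diag_le {m : ℕ+ → ℂ} (hm : ∃ C, ∀ n, ‖m n‖ ≤ C) {C : ℝ} (hC : ∀ n, ‖m n‖ ≤ C)
    (x : Ell) : ‖diag m hm x‖ ≤ C * ‖x‖ := by
  refine norm_le_mul_norm_of_le ((norm_nonneg _).trans (hC 1)) fun n => ?_
  rw [diag_apply, norm_mul]
  have := hC n
  gcongr

theorem tsum_mul_sq_le {ι : Type*} (f g : ι → ℝ≥0∞) :
    (∑' i, f i * g i) ^ 2 ≤ (∑' i, f i ^ 2) * ∑' i, g i ^ 2 := by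
  let _ : MeasurableSpace ι := ⊤
  have h := ENNReal.lintegral_mul_le_Lp_mul_Lq (μ := Measure.count) (p := 2) (q := 2)
    (by norm_num [Real.holderConjugate_iff]) (f := f) (g := g) (measurable_from_top.aemeasurable)
    (measurable_from_top.aemeasurable)
  simp only [Pi.mul_apply, lintegral_count] at h
  have h2 := pow_le_pow_left' h 2
  have hsq : ∀ y : ℝ≥0∞, (y ^ (1 / 2 : ℝ)) ^ 2 = y := fun y => by
    rw [← ENNReal.rpow_natCast, ← ENNReal.rpow_mul]; norm_num
  rw [mul_pow, hsq, hsq] at h2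
  simpa only [ENNReal.rpow_two] using h2

/-- Young's inequality for the convolution of a square summable and a summable sequence. -/
theorem tsum_conv_sq_le (P Y : ℤ → ℝ≥0∞) :
    ∑' n, (∑' a, P a * Y (n - a)) ^ 2 ≤ (∑' a, P a ^ 2) * (∑' a, Y a) ^ 2 := by
  have hshift : ∀ n : ℤ, ∑' a, Y (n - a) = ∑' a, Y a := fun n => (Equiv.subLeft n).tsum_eq Y
  have hshift' : ∀ a : ℤ, ∑' n, Y (n - a) = ∑' a, Y a := fun a => (Equiv.subRight a).tsum_eq Y
  have hsq : ∀ y : ℝ≥0∞, (y ^ (1 / 2 : ℝ)) ^ 2 = y := fun y => by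
    rw [← ENNReal.rpow_natCast, ← ENNReal.rpow_mul]; norm_num
  calc ∑' n, (∑' a, P a * Y (n - a)) ^ 2
      ≤ ∑' n, (∑' a, P a ^ 2 * Y (n - a)) * ∑' a, Y a := by
        refine ENNReal.tsum_le_tsum fun n => ?_
        -- Cauchy–Schwarz with `Y` split into two square roots, one of them kept with `P`.
        have h := tsum_mul_sq_le (fun a => P a * Y (n - a) ^ (1 / 2 : ℝ))
          (fun a => Y (n - a) ^ (1 / 2 : ℝ))
        simp only [mul_assoc, mul_pow, hsq, hshift] at h
        refine le_trans (le_of_eq ?_) h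
        congr 1
        refine tsum_congr fun a => ?_
        rw [← pow_two, hsq]
    _ = (∑' a, P a ^ 2) * (∑' a, Y a) ^ 2 := by
        rw [ENNReal.tsum_mul_right, ENNReal.tsum_comm]
        simp only [ENNReal.tsum_mul_left, hshift']
        rw [ENNReal.tsum_mul_right, pow_two, mul_assoc]

theorem int_cases_pnat (a : ℤ) : a = 0 ∨ ∃ n : ℕ+, a = (n : ℕ) ∨ a = -((n : ℕ) : ℤ) := by
  rcases lt_trichotomy a 0 with h | h | h
  · exact Or.inr ⟨⟨(-a).toNat, by omega⟩, Or.inr (by simp; omega)⟩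
  · exact Or.inl h
  · exact Or.inr ⟨⟨a.toNat, by omega⟩, Or.inl (by simp; omega)⟩

theorem tsum_int_even (f : ℤ → ℝ≥0∞) (h : ∀ a, f (-a) = f a) :
    ∑' a, f a = f 0 + 2 * ∑' n : ℕ+, f ((n : ℕ) : ℤ) := by
  have h1 : ∑' n : ℕ, f (n : ℤ) = f 0 + ∑' n : ℕ+, f ((n : ℕ) : ℤ) := by
    rw [tsum_eq_zero_add' ENNReal.summable, tsum_pnat_eq_tsum_succ (f := fun n : ℕ => f n)]
    simp
  have h2 : ∑' n : ℕ, f (-((n : ℤ) + 1)) = ∑' n : ℕ+, f ((n : ℕ) : ℤ) := by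
    simp only [h]
    rw [tsum_pnat_eq_tsum_succ (f := fun n : ℕ => f n)]
    simp
  have h3 := HasSum.of_nat_of_neg_add_one (f := f) ENNReal.summable.hasSum ENNReal.summable.hasSum
  rw [h3.tsum_eq, h1, h2, two_mul, add_assoc]

end Sequences

/-! ### Fourier coefficients of products and the tame estimate -/

section Convolution

/-- The Fourier coefficients of the real valued function of mean zero whose `n`-th coefficient,
`n ≥ 1`, is `x n / n ^ s`. -/
def fc (s : ℕ) (x : ℕ+ → ℂ) (a : ℤ) : ℂ :=
  if 0 < a then ((a : ℂ) ^ s)⁻¹ * x a.toNat.toPNat'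
  else if a < 0 then (starRingEnd ℂ) (((-a : ℂ) ^ s)⁻¹ * x (-a).toNat.toPNat') else 0

variable {s : ℕ}

@[simp]
theorem fc_zero (x : ℕ+ → ℂ) : fc s x 0 = 0 := by simp [fc]

theorem fc_pnat (x : ℕ+ → ℂ) (n : ℕ+) : fc s x ((n : ℕ) : ℤ) = (((n : ℕ) : ℂ) ^ s)⁻¹ * x n := by
  have : (0 : ℤ) < ((n : ℕ) : ℤ) := by exact_mod_cast n.pos
  simp [fc]

theorem fc_neg (x : ℕ+ → ℂ) (a : ℤ) : fc s x (-a) = (starRingEnd ℂ) (fc s x a) := by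
  rcases lt_trichotomy a 0 with h | rfl | h
  · simp [fc, h, not_lt.2 h.le]
  · simp
  · simp [fc, h, not_lt.2 h.le]

theorem fc_add (x y : Ell) (a : ℤ) : fc s (x + y : Ell) a = fc s x a + fc s y a := by
  rw [lp.coeFn_add]
  rcases int_cases_pnat a with rfl | ⟨n, rfl | rfl⟩
  · simp
  · simp [fc_pnat, mul_add]
  · simp [fc_neg, fc_pnat, mul_add]

theorem fc_smul (c : ℝ) (x : Ell) (a : ℤ) : fc s (c • x : Ell) a = c * fc s x a := by
  rcases int_cases_pnat a with rfl | ⟨n, rfl | rfl⟩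
  · simp
  · simp [fc_pnat]; ring
  · simp [fc_neg, fc_pnat]; ring

theorem norm_fc_neg (x : ℕ+ → ℂ) (a : ℤ) : ‖fc s x (-a)‖ = ‖fc s x a‖ := by
  rw [fc_neg, RCLike.norm_conj]

theorem enorm_fc_neg (x : ℕ+ → ℂ) (a : ℤ) : ‖fc s x (-a)‖ₑ = ‖fc s x a‖ₑ := by
  simp only [← ofReal_norm, norm_fc_neg]

theorem norm_fc_pnat (x : ℕ+ → ℂ) (n : ℕ+) :
    ‖fc s x ((n : ℕ) : ℤ)‖ = (((n : ℕ) : ℝ) ^ s)⁻¹ * ‖x n‖ := by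
  simp [fc_pnat]

theorem norm_fc_le (x : Ell) (a : ℤ) : ‖fc s x a‖ ≤ ‖x‖ := by
  have key : ∀ n : ℕ+, (((n : ℕ) : ℝ) ^ s)⁻¹ * ‖x n‖ ≤ ‖x‖ := fun n =>
    (mul_le_of_le_one_left (norm_nonneg _)
      (inv_le_one_of_one_le₀ (one_le_pow₀ (by exact_mod_cast n.pos)))).trans (norm_apply_le x n)
  rcases int_cases_pnat a with rfl | ⟨n, rfl | rfl⟩
  · simp
  · rw [norm_fc_pnat]; exact key n
  · rw [norm_fc_neg, norm_fc_pnat]; exact key n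

/-- The absolute value of an integer in `ℝ≥0∞`. -/
def eabs (a : ℤ) : ℝ≥0∞ := (a.natAbs : ℝ≥0∞)

theorem eabs_sub_add (n a : ℤ) : eabs n ≤ eabs a + eabs (n - a) := by
  unfold eabs
  exact_mod_cast (by omega : n.natAbs ≤ a.natAbs + (n - a).natAbs)

theorem eabs_pow_le (n a : ℤ) : eabs n ^ s ≤ 2 ^ s * (eabs a ^ s + eabs (n - a) ^ s) := by
  have h : eabs n ≤ 2 * max (eabs a) (eabs (n - a)) :=
    (eabs_sub_add n a).trans (by rw [two_mul]; exact add_le_add (le_max_left _ _) (le_max_right _ _))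
  calc eabs n ^ s ≤ (2 * max (eabs a) (eabs (n - a))) ^ s := by gcongr
    _ ≤ 2 ^ s * (eabs a ^ s + eabs (n - a) ^ s) := by
      rw [mul_pow]
      gcongr
      rcases max_cases (eabs a) (eabs (n - a)) with ⟨h, _⟩ | ⟨h, _⟩ <;> rw [h]
      · exact le_self_add
      · exact le_add_self

theorem eabs_pow_mul_enorm_fc (x : ℕ+ → ℂ) (n : ℕ+) :
    eabs ((n : ℕ) : ℤ) ^ s * ‖fc s x ((n : ℕ) : ℤ)‖ₑ = ‖x n‖ₑ := by
  have hn : (0 : ℝ) < ((n : ℕ) : ℝ) ^ s := by have := n.pos; positivity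
  have : eabs ((n : ℕ) : ℤ) ^ s = ENNReal.ofReal (((n : ℕ) : ℝ) ^ s) := by
    rw [ENNReal.ofReal_pow (by positivity)]; simp [eabs]
  rw [this, ← ofReal_norm, ← ofReal_norm, ← ENNReal.ofReal_mul hn.le, norm_fc_pnat,
    mul_inv_cancel_left₀ hn.ne']

theorem eabs_neg (a : ℤ) : eabs (-a) = eabs a := by simp [eabs]

theorem tsum_eabs_pow_mul_fc_sq (x : Ell) :
    ∑' a, (eabs a ^ s * ‖fc s x a‖ₑ) ^ 2 = 2 * ‖x‖ₑ ^ 2 := by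
  rw [tsum_int_even _ (fun a => by rw [eabs_neg, enorm_fc_neg]), enorm_sq_eq_tsum]
  simp [eabs_pow_mul_enorm_fc]

/-- The sum of the absolute values of the Fourier coefficients. -/
def wiener (s : ℕ) (x : ℕ+ → ℂ) : ℝ≥0∞ := ∑' a, ‖fc s x a‖ₑ

/-- The convolution of two sequences of Fourier coefficients. -/
def conv (s : ℕ) (x y : ℕ+ → ℂ) (n : ℤ) : ℂ := ∑' a, fc s x a * fc s y (n - a)

theorem enorm_conv_le (x y : ℕ+ → ℂ) (n : ℤ) :
    ‖conv s x y n‖ₑ ≤ ∑' a, ‖fc s x a‖ₑ * ‖fc s y (n - a)‖ₑ := by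
  refine (enorm_tsum_le_tsum_enorm (f := fun a => fc s x a * fc s y (n - a))).trans ?_
  simp [enorm_mul]

theorem add_sq_le_two_mul (a b : ℝ≥0∞) : (a + b) ^ 2 ≤ 2 * (a ^ 2 + b ^ 2) := by
  rcases eq_or_ne a ∞ with rfl | ha
  · simp
  rcases eq_or_ne b ∞ with rfl | hb
  · simp
  lift a to NNReal using ha
  lift b to NNReal using hb
  exact_mod_cast add_sq_le (a := a) (b := b)

/-- Tame estimate for products in Sobolev spaces. -/
theorem tsum_eabs_pow_mul_conv_sq_le (x y : Ell) :
    ∑' n, (eabs n ^ s * ‖conv s x y n‖ₑ) ^ 2 ≤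
      4 ^ (s + 1) * (‖x‖ₑ ^ 2 * wiener s y ^ 2 + wiener s x ^ 2 * ‖y‖ₑ ^ 2) := by
  set U : ℤ → ℝ≥0∞ := fun n => ∑' a, (eabs a ^ s * ‖fc s x a‖ₑ) * ‖fc s y (n - a)‖ₑ
  set W : ℤ → ℝ≥0∞ := fun n => ∑' a, (eabs a ^ s * ‖fc s y a‖ₑ) * ‖fc s x (n - a)‖ₑ
  have hU : ∑' n, U n ^ 2 ≤ 2 * ‖x‖ₑ ^ 2 * wiener s y ^ 2 := by
    rw [← tsum_eabs_pow_mul_fc_sq]; exact tsum_conv_sq_le _ _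
  have hW : ∑' n, W n ^ 2 ≤ 2 * ‖y‖ₑ ^ 2 * wiener s x ^ 2 := by
    rw [← tsum_eabs_pow_mul_fc_sq]; exact tsum_conv_sq_le _ _
  have hW' : ∀ n, W n = ∑' a, ‖fc s x a‖ₑ * (eabs (n - a) ^ s * ‖fc s y (n - a)‖ₑ) := fun n => by
    rw [← (Equiv.subLeft n).tsum_eq]
    refine tsum_congr fun a => ?_
    simp only [Equiv.subLeft_apply, sub_sub_cancel]
    ring
  have hpt : ∀ n, (eabs n ^ s * ‖conv s x y n‖ₑ) ^ 2 ≤ 4 ^ s * 2 * (U n ^ 2 + W n ^ 2) := by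
    intro n
    -- The weight `|n|^s` is moved onto one of the two factors, as `n = a + (n - a)`. The other
    -- factor carries no weight and is summed in `ℓ¹` by Young's inequality.
    have h1 : eabs n ^ s * ‖conv s x y n‖ₑ ≤ 2 ^ s * (U n + W n) := by
      refine (mul_le_mul_right (enorm_conv_le x y n) _).trans ?_
      rw [hW', ← ENNReal.tsum_mul_left, ← ENNReal.tsum_add, ← ENNReal.tsum_mul_left]
      refine ENNReal.tsum_le_tsum fun a => ?_
      refine (mul_le_mul_left (eabs_pow_le n a) _).trans (le_of_eq ?_)
      ring
    refine (pow_le_pow_left' h1 2).trans ?_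
    rw [mul_pow, mul_assoc, ← pow_mul, mul_comm s 2, pow_mul]
    norm_num
    gcongr
    exact add_sq_le_two_mul _ _
  calc ∑' n, (eabs n ^ s * ‖conv s x y n‖ₑ) ^ 2
      ≤ ∑' n, 4 ^ s * 2 * (U n ^ 2 + W n ^ 2) := ENNReal.tsum_le_tsum hpt
    _ = 4 ^ s * 2 * (∑' n, U n ^ 2 + ∑' n, W n ^ 2) := by
        rw [ENNReal.tsum_mul_left, ENNReal.tsum_add]
    _ ≤ 4 ^ s * 2 * (2 * ‖x‖ₑ ^ 2 * wiener s y ^ 2 + 2 * ‖y‖ₑ ^ 2 * wiener s x ^ 2) := by gcongr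
    _ = _ := by ring

end Convolution

/-! ### The operators of the equation and the bounds on its vector field -/

section Operators

variable {s : ℕ}

/-- Cauchy–Schwarz against a free weight, so that one inequality serves both the norm of `H^s` (`w =
1`) and the energy (`w = energyWeight`). The factor 4 is the square of the 2 from the two signs of
the frequency. -/
theorem wiener_sq_le (w : ℕ+ → ℝ) (hw : ∀ n, 0 < w n) (x : ℕ+ → ℂ) :
    wiener s x ^ 2 ≤ 4 * (∑' n : ℕ+, ENNReal.ofReal ((((n : ℕ) : ℝ) ^ s * w n)⁻¹ ^ 2)) *
      ∑' n, ENNReal.ofReal ((w n * ‖x n‖) ^ 2) := by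
  have h1 : wiener s x = 2 * ∑' n : ℕ+, ENNReal.ofReal (((n : ℕ) : ℝ) ^ s * w n)⁻¹ *
      ENNReal.ofReal (w n * ‖x n‖) := by
    rw [wiener, tsum_int_even _ (enorm_fc_neg x)]
    simp only [fc_zero, enorm_zero, zero_add]
    congr 1
    refine tsum_congr fun n => ?_
    have hn : (0 : ℝ) < ((n : ℕ) : ℝ) ^ s := by have := n.pos; positivity
    have := hw n
    rw [← ENNReal.ofReal_mul (by positivity), ← ofReal_norm, norm_fc_pnat]
    congr 1
    field_simp
  rw [h1, mul_pow, mul_assoc]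
  norm_num
  gcongr
  refine (tsum_mul_sq_le _ _).trans (le_of_eq ?_)
  congr 1
  · refine tsum_congr fun n => ?_
    have := hw n
    rw [← ENNReal.ofReal_pow (by positivity)]
  · refine tsum_congr fun n => ?_
    have := hw n
    rw [← ENNReal.ofReal_pow (by positivity)]

theorem exists_tsum_ofReal_le {ι : Type*} {f : ι → ℝ} (hf : Summable f) (h0 : ∀ i, 0 ≤ f i) :
    ∃ Z : ℝ, 0 ≤ Z ∧ ∑' i, ENNReal.ofReal (f i) = ENNReal.ofReal Z :=
  ⟨∑' i, f i, tsum_nonneg h0, (ENNReal.ofReal_tsum_of_nonneg h0 hf).symm⟩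

theorem summable_pnat_rpow {p : ℝ} (hp : p < -1) : Summable fun n : ℕ+ => ((n : ℕ) : ℝ) ^ p :=
  (Real.summable_nat_rpow.2 hp).comp_injective PNat.coe_injective

variable [NeZero s]

/-- The weight is one and the series `∑ n^(-2s)` is dominated by `∑ n^(-2)`, as `s ≥ 1`. -/
theorem exists_wiener_le (s : ℕ) [NeZero s] :
    ∃ Z : ℝ, 0 ≤ Z ∧ ∀ x : Ell, wiener s x ^ 2 ≤ ENNReal.ofReal ((Z * ‖x‖) ^ 2) := by
  obtain ⟨Z, hZ, h⟩ := exists_tsum_ofReal_le (summable_pnat_rpow (p := -2) (by norm_num))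
    (fun n => by positivity)
  refine ⟨2 * Real.sqrt Z, by positivity, fun x => ?_⟩
  refine (wiener_sq_le (fun _ => 1) (fun _ => one_pos) x).trans ?_
  simp only [one_mul, mul_one]
  have h1 : ∑' n : ℕ+, ENNReal.ofReal ((((n : ℕ) : ℝ) ^ s)⁻¹ ^ 2) ≤ ENNReal.ofReal Z := by
    rw [← h]
    refine ENNReal.tsum_le_tsum fun n => ENNReal.ofReal_le_ofReal ?_
    have hn : (1 : ℝ) ≤ ((n : ℕ) : ℝ) := by exact_mod_cast n.pos
    rw [Real.rpow_neg (by positivity), Real.rpow_two, inv_pow]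
    have := le_self_pow₀ hn (NeZero.ne s)
    exact inv_anti₀ (by positivity) (by gcongr)
  have h2 : ∑' n, ENNReal.ofReal (‖x n‖ ^ 2) = ENNReal.ofReal (‖x‖ ^ 2) := by
    simp only [← enorm_sq_eq_ofReal, enorm_sq_eq_tsum]
  rw [h2]
  have h4 : (4 : ℝ≥0∞) = ENNReal.ofReal 4 := by norm_num
  calc _ ≤ 4 * ENNReal.ofReal Z * ENNReal.ofReal (‖x‖ ^ 2) := by gcongr
    _ = _ := by
      rw [h4, ← ENNReal.ofReal_mul (by norm_num), ← ENNReal.ofReal_mul (by positivity)]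
      congr 1
      rw [mul_pow, mul_pow, Real.sq_sqrt hZ]; norm_num

theorem wiener_ne_top (x : Ell) : wiener s x ≠ ∞ := by
  obtain ⟨Z, -, h⟩ := exists_wiener_le s
  intro hx
  have := h x
  simp [hx] at this

theorem summable_conv (x y : Ell) (n : ℤ) : Summable fun a => fc s x a * fc s y (n - a) := by
  have h1 : Summable fun a => ‖fc s x a‖ := by
    have := ENNReal.summable_toReal (wiener_ne_top (s := s) x)
    simpa using this
  refine Summable.of_norm_bounded (h1.mul_right ‖y‖) fun a => ?_
  rw [norm_mul]
  gcongr
  exact norm_fc_le _ _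

theorem conv_add_left (x y z : Ell) (n : ℤ) :
    conv s (x + y : Ell) z n = conv s x z n + conv s y z n := by
  unfold conv
  rw [← (summable_conv x z n).tsum_add (summable_conv y z n)]
  simp only [fc_add, add_mul]

theorem conv_add_right (x y z : Ell) (n : ℤ) :
    conv s z (x + y : Ell) n = conv s z x n + conv s z y n := by
  unfold conv
  rw [← (summable_conv z x n).tsum_add (summable_conv z y n)]
  simp only [fc_add, mul_add]

omit [NeZero s] in
theorem conv_smul_left (c : ℝ) (x z : Ell) (n : ℤ) :
    conv s (c • x : Ell) z n = c * conv s x z n := by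
  unfold conv
  rw [← tsum_mul_left]
  simp only [fc_smul, mul_assoc]

omit [NeZero s] in
theorem conv_smul_right (c : ℝ) (x z : Ell) (n : ℤ) :
    conv s z (c • x : Ell) n = c * conv s z x n := by
  unfold conv
  rw [← tsum_mul_left]
  simp only [fc_smul]
  exact tsum_congr fun a => by ring

omit [NeZero s] in
theorem conv_comm (x y : ℕ+ → ℂ) (n : ℤ) : conv s x y n = conv s y x n := by
  unfold conv
  rw [← (Equiv.subLeft n).tsum_eq]
  simp [mul_comm]

omit [NeZero s] in
theorem tsum_prod_le (x y : Ell) {a b : ℝ} (ha : 0 ≤ a) (hb : 0 ≤ b)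
    (hx : wiener s x ^ 2 ≤ ENNReal.ofReal (a ^ 2)) (hy : wiener s y ^ 2 ≤ ENNReal.ofReal (b ^ 2)) :
    ∑' n : ℕ+, ‖(((n : ℕ) : ℂ) ^ s) * conv s x y ((n : ℕ) : ℤ)‖ₑ ^ 2 ≤
      ENNReal.ofReal ((2 ^ (s + 1) * (‖x‖ * b + a * ‖y‖)) ^ 2) := by
  have hinj : Function.Injective fun n : ℕ+ => ((n : ℕ) : ℤ) := fun m n h => by
    simpa using h
  calc ∑' n : ℕ+, ‖(((n : ℕ) : ℂ) ^ s) * conv s x y ((n : ℕ) : ℤ)‖ₑ ^ 2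
      = ∑' n : ℕ+, (eabs ((n : ℕ) : ℤ) ^ s * ‖conv s x y ((n : ℕ) : ℤ)‖ₑ) ^ 2 := by
        refine tsum_congr fun n => ?_
        rw [enorm_mul, enorm_pow]
        congr 3
        rw [← ofReal_norm]
        simp [eabs]
    _ ≤ ∑' n : ℤ, (eabs n ^ s * ‖conv s x y n‖ₑ) ^ 2 :=
        ENNReal.tsum_comp_le_tsum_of_injective hinj _
    _ ≤ 4 ^ (s + 1) * (‖x‖ₑ ^ 2 * wiener s y ^ 2 + wiener s x ^ 2 * ‖y‖ₑ ^ 2) :=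
        tsum_eabs_pow_mul_conv_sq_le x y
    _ ≤ 4 ^ (s + 1) * (ENNReal.ofReal (‖x‖ ^ 2) * ENNReal.ofReal (b ^ 2) +
          ENNReal.ofReal (a ^ 2) * ENNReal.ofReal (‖y‖ ^ 2)) := by
        rw [enorm_sq_eq_ofReal, enorm_sq_eq_ofReal]; gcongr
    _ = ENNReal.ofReal (4 ^ (s + 1) * (‖x‖ ^ 2 * b ^ 2 + a ^ 2 * ‖y‖ ^ 2)) := by
        rw [ENNReal.ofReal_mul (by positivity), ENNReal.ofReal_pow (by norm_num),
          ENNReal.ofReal_add (by positivity) (by positivity), ENNReal.ofReal_mul (by positivity),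
          ENNReal.ofReal_mul (by positivity)]
        norm_num
    _ ≤ _ := by
        refine ENNReal.ofReal_le_ofReal ?_
        rw [mul_pow, ← pow_mul, mul_comm (s + 1) 2, pow_mul]
        norm_num
        have : 0 ≤ ‖x‖ * b * (a * ‖y‖) := by positivity
        nlinarith

/-- The constant in `wiener s x ≤ C ‖x‖`. -/
def wienerConst (s : ℕ) [NeZero s] : ℝ := (exists_wiener_le s).choose

theorem wienerConst_nonneg : 0 ≤ wienerConst s := (exists_wiener_le s).choose_spec.1

theorem wiener_sq_le_wienerConst (x : Ell) :
    wiener s x ^ 2 ≤ ENNReal.ofReal ((wienerConst s * ‖x‖) ^ 2) :=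
  (exists_wiener_le s).choose_spec.2 x

theorem tsum_prod_le_wienerConst (x y : Ell) :
    ∑' n : ℕ+, ‖(((n : ℕ) : ℂ) ^ s) * conv s x y ((n : ℕ) : ℤ)‖ₑ ^ 2 ≤
      ENNReal.ofReal ((2 ^ (s + 2) * wienerConst s * ‖x‖ * ‖y‖) ^ 2) := by
  have hc := wienerConst_nonneg (s := s)
  refine (tsum_prod_le x y (by positivity) (by positivity) (wiener_sq_le_wienerConst x)
    (wiener_sq_le_wienerConst y)).trans (le_of_eq ?_)
  congr 2
  ring

/-- The product of two functions in `H^s`, in terms of rescaled Fourier coefficients. -/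
def prodMap (s : ℕ) [NeZero s] : Ell →L[ℝ] Ell →L[ℝ] Ell :=
  LinearMap.mkContinuous₂ (LinearMap.mk₂ ℝ
    (fun x y : Ell => (⟨fun n : ℕ+ => (((n : ℕ) : ℂ) ^ s) * conv s x y ((n : ℕ) : ℤ),
      memlp_two_of_tsum_lt_top (ne_top_of_le_ne_top ENNReal.ofReal_ne_top
        (tsum_prod_le_wienerConst x y))⟩ : Ell))
    (fun x y z => Subtype.ext (by funext n; simp only [conv_add_left, mul_add]; rfl))
    (fun c x y => Subtype.ext (by
      funext n
      simp only [conv_smul_left]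
      rw [lp.coeFn_smul, Pi.smul_apply, Complex.real_smul]; ring))
    (fun x y z => Subtype.ext (by funext n; simp only [conv_add_right, mul_add]; rfl))
    (fun c x y => Subtype.ext (by
      funext n
      simp only [conv_smul_right]
      rw [lp.coeFn_smul, Pi.smul_apply, Complex.real_smul]; ring)))
    (2 ^ (s + 2) * wienerConst s)
    (fun x y => norm_le_of_tsum_le (by have := wienerConst_nonneg (s := s); positivity)
      (tsum_prod_le_wienerConst x y))

theorem prodMap_apply (x y : Ell) (n : ℕ+) :
    prodMap s x y n = (((n : ℕ) : ℂ) ^ s) * conv s x y ((n : ℕ) : ℤ) := rfl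

theorem prodMap_comm (x y : Ell) : prodMap s x y = prodMap s y x :=
  Subtype.ext (by funext n; rw [prodMap_apply, prodMap_apply, conv_comm])

theorem norm_prodMap_le (x y : Ell) {a b : ℝ} (ha : 0 ≤ a) (hb : 0 ≤ b)
    (hx : wiener s x ^ 2 ≤ ENNReal.ofReal (a ^ 2)) (hy : wiener s y ^ 2 ≤ ENNReal.ofReal (b ^ 2)) :
    ‖prodMap s x y‖ ≤ 2 ^ (s + 1) * (‖x‖ * b + a * ‖y‖) :=
  norm_le_of_tsum_le (by positivity) (tsum_prod_le x y ha hb hx hy)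

/-- The dispersion relation `n / (1 + n ^ γ)`. -/
def lam (γ : ℝ) (n : ℕ+) : ℝ := ((n : ℕ) : ℝ) / (1 + ((n : ℕ) : ℝ) ^ γ)

/-- The square root of the weight of the energy, in rescaled Fourier coefficients. -/
def energyWeight (γ : ℝ) (s : ℕ) (n : ℕ+) : ℝ :=
  Real.sqrt (1 + ((n : ℕ) : ℝ) ^ γ) / ((n : ℕ) : ℝ) ^ s

variable {γ : ℝ}

theorem one_le_pnat (n : ℕ+) : (1 : ℝ) ≤ ((n : ℕ) : ℝ) := by exact_mod_cast n.pos

theorem lam_pos (γ : ℝ) (n : ℕ+) : 0 < lam γ n := by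
  have := one_le_pnat n
  unfold lam; positivity

/-- The smoothing by `γ - 1` derivatives, behind both the convergence of the Galerkin scheme and the
`L⁴` bound of the Duhamel remainder. -/
theorem lam_le_rpow (γ : ℝ) (n : ℕ+) : lam γ n ≤ ((n : ℕ) : ℝ) ^ (1 - γ) := by
  have hn : (0 : ℝ) < ((n : ℕ) : ℝ) := one_pos.trans_le (one_le_pnat n)
  rw [lam, Real.rpow_sub hn, Real.rpow_one]
  gcongr
  linarith

theorem lam_le_one [h : Fact (1 < γ)] (n : ℕ+) : lam γ n ≤ 1 :=
  (lam_le_rpow γ n).trans (Real.rpow_le_one_of_one_le_of_nonpos (one_le_pnat n)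
    (by linarith [h.out]))

theorem energyWeight_pos (γ : ℝ) (s : ℕ) (n : ℕ+) : 0 < energyWeight γ s n := by
  have := one_le_pnat n
  unfold energyWeight; positivity

theorem energyWeight_sq (γ : ℝ) (s : ℕ) (n : ℕ+) :
    energyWeight γ s n ^ 2 = (1 + ((n : ℕ) : ℝ) ^ γ) / (((n : ℕ) : ℝ) ^ s) ^ 2 := by
  have := one_le_pnat n
  rw [energyWeight, div_pow, Real.sq_sqrt (by positivity)]

/-- The embedding of `H^s` in `H^{γ/2}`, valid since `γ/2 ≤ 1 ≤ s`. -/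
theorem energyWeight_le [h : Fact (γ ≤ 2)] (n : ℕ+) : energyWeight γ s n ≤ 2 := by
  have hn := one_le_pnat n
  have h1 : ((n : ℕ) : ℝ) ^ γ ≤ ((n : ℕ) : ℝ) ^ (2 : ℝ) := Real.rpow_le_rpow_of_exponent_le hn h.out
  rw [Real.rpow_two] at h1
  have h2 : ((n : ℕ) : ℝ) ≤ ((n : ℕ) : ℝ) ^ s := le_self_pow₀ hn (NeZero.ne s)
  rw [energyWeight, div_le_iff₀ (by positivity), Real.sqrt_le_left (by positivity)]
  nlinarith

/-- The square root of the quadratic form of the energy. -/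
def energyMap (γ : ℝ) (s : ℕ) [NeZero s] [Fact (γ ≤ 2)] : Ell →L[ℝ] Ell :=
  diag (fun n => (energyWeight γ s n : ℂ)) ⟨2, fun n => by
    simpa [abs_of_pos (energyWeight_pos γ s n)] using energyWeight_le n⟩

/-- The operator `-∂ₓ (1 + |D|^γ)⁻¹`. -/
def linMap (γ : ℝ) [Fact (1 < γ)] : Ell →L[ℝ] Ell :=
  diag (fun n => -(Complex.I * (lam γ n : ℂ))) ⟨1, fun n => by
    simpa [abs_of_pos (lam_pos γ n)] using lam_le_one n⟩

/-- The projection on the Fourier modes `n ≤ N`. -/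
def proj (N : ℕ+) : Ell →L[ℝ] Ell :=
  diag (fun n => if n ≤ N then 1 else 0) ⟨1, fun n => by split_ifs <;> simp⟩

theorem energyMap_apply [Fact (γ ≤ 2)] (x : Ell) (n : ℕ+) :
    energyMap γ s x n = (energyWeight γ s n : ℂ) * x n := rfl

theorem linMap_apply [Fact (1 < γ)] (x : Ell) (n : ℕ+) :
    linMap γ x n = -(Complex.I * (lam γ n : ℂ)) * x n := rfl

theorem proj_apply (N : ℕ+) (x : Ell) (n : ℕ+) : proj N x n = if n ≤ N then x n else 0 := by
  rw [proj, diag_apply]; split_ifs <;> simp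

theorem norm_energyMap_le [Fact (γ ≤ 2)] (x : Ell) : ‖energyMap γ s x‖ ≤ 2 * ‖x‖ :=
  norm_diag_le _ (fun n => by
    simpa [abs_of_pos (energyWeight_pos γ s n)] using energyWeight_le n) x

theorem norm_linMap_le [Fact (1 < γ)] (x : Ell) : ‖linMap γ x‖ ≤ ‖x‖ :=
  (norm_diag_le (C := 1) _ (fun n => by
    simpa [abs_of_pos (lam_pos γ n)] using lam_le_one (γ := γ) n) x).trans_eq (one_mul _)

theorem norm_proj_le (N : ℕ+) (x : Ell) : ‖proj N x‖ ≤ ‖x‖ := by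
  simpa using norm_le_mul_norm_of_le (x := proj N x) (y := x) zero_le_one fun n => by
    rw [proj_apply]; split_ifs <;> simp

theorem proj_proj (N : ℕ+) (x : Ell) : proj N (proj N x) = proj N x :=
  Subtype.ext (by funext n; simp only [proj_apply]; split_ifs <;> rfl)

theorem proj_energyMap [Fact (γ ≤ 2)] (N : ℕ+) (x : Ell) :
    proj N (energyMap γ s x) = energyMap γ s (proj N x) :=
  Subtype.ext (by funext n; simp only [proj_apply, energyMap_apply]; split_ifs <;> simp)

theorem proj_linMap [Fact (1 < γ)] (N : ℕ+) (x : Ell) :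
    proj N (linMap γ x) = linMap γ (proj N x) :=
  Subtype.ext (by funext n; simp only [proj_apply, linMap_apply]; split_ifs <;> simp)

theorem proj_eq_sum (N : ℕ+) (x : Ell) :
    proj N x = ∑ n ∈ Finset.Icc 1 N, lp.single 2 n (x n) := by
  refine Subtype.ext ?_
  funext m
  rw [proj_apply, lp.coeFn_sum, Finset.sum_apply]
  simp [lp.single_apply, Pi.single_apply]

theorem tendsto_proj (x : Ell) : Tendsto (fun N => proj N x) atTop (𝓝 x) := by
  simp only [proj_eq_sum]
  have h := lp.hasSum_single (p := 2) (by norm_num) x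
  refine h.comp (tendsto_atTop_finset_of_monotone (fun M N h => Finset.Icc_subset_Icc_right h)
    fun n => ⟨n, by simp⟩)

/-- In terms of `û` the energy has weight `1 + n^γ`, so Cauchy–Schwarz costs the series `∑ n^(-γ)`,
finite for `γ > 1`. Thus the unweighted factor in the tame estimate is controlled by a conserved
quantity. -/
theorem exists_wiener_le_energyMap (γ : ℝ) (s : ℕ) [NeZero s] [h1 : Fact (1 < γ)] [Fact (γ ≤ 2)] :
    ∃ Z : ℝ, 0 ≤ Z ∧ ∀ x : Ell, wiener s x ^ 2 ≤ ENNReal.ofReal ((Z * ‖energyMap γ s x‖) ^ 2) := by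
  obtain ⟨Z, hZ, h⟩ := exists_tsum_ofReal_le (summable_pnat_rpow (p := -γ) (by linarith [h1.out]))
    (fun n => by positivity)
  refine ⟨2 * Real.sqrt Z, by positivity, fun x => ?_⟩
  refine (wiener_sq_le (energyWeight γ s) (energyWeight_pos γ s) x).trans ?_
  have h1 : ∑' n : ℕ+, ENNReal.ofReal ((((n : ℕ) : ℝ) ^ s * energyWeight γ s n)⁻¹ ^ 2) ≤
      ENNReal.ofReal Z := by
    rw [← h]
    refine ENNReal.tsum_le_tsum fun n => ENNReal.ofReal_le_ofReal ?_
    have hn := one_le_pnat n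
    rw [Real.rpow_neg (by positivity), inv_pow, mul_pow, energyWeight_sq]
    refine inv_anti₀ (by positivity) ?_
    rw [mul_div_cancel₀ _ (by positivity)]
    linarith
  have h2 : ∑' n, ENNReal.ofReal ((energyWeight γ s n * ‖x n‖) ^ 2) =
      ENNReal.ofReal (‖energyMap γ s x‖ ^ 2) := by
    rw [← enorm_sq_eq_ofReal, enorm_sq_eq_tsum]
    refine tsum_congr fun n => ?_
    rw [enorm_sq_eq_ofReal, energyMap_apply, norm_mul, Complex.norm_real, Real.norm_eq_abs,
      abs_of_pos (energyWeight_pos γ s n)]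
  rw [h2]
  have h4 : (4 : ℝ≥0∞) = ENNReal.ofReal 4 := by norm_num
  calc _ ≤ 4 * ENNReal.ofReal Z * ENNReal.ofReal (‖energyMap γ s x‖ ^ 2) := by gcongr
    _ = _ := by
      rw [h4, ← ENNReal.ofReal_mul (by norm_num), ← ENNReal.ofReal_mul (by positivity)]
      congr 1
      rw [mul_pow, mul_pow, Real.sq_sqrt hZ]; norm_num

/-- The vector field of the equation, in rescaled Fourier coefficients. -/
def field (γ : ℝ) (s : ℕ) [NeZero s] [Fact (1 < γ)] (x : Ell) : Ell :=
  linMap γ (x + prodMap s x x)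

/-- The Galerkin truncation of the vector field. -/
def galerkin (γ : ℝ) (s : ℕ) [NeZero s] [Fact (1 < γ)] (N : ℕ+) (x : Ell) : Ell :=
  proj N (field γ s (proj N x))

theorem field_sub [Fact (1 < γ)] (x y : Ell) : field γ s x - field γ s y =
    linMap γ ((x - y) + (prodMap s (x - y) x + prodMap s y (x - y))) := by
  simp only [field, map_add, map_sub, sub_apply]
  abel

theorem norm_field_sub_le [Fact (1 < γ)] (x y : Ell) : ‖field γ s x - field γ s y‖ ≤
    (1 + ‖prodMap s‖ * (‖x‖ + ‖y‖)) * ‖x - y‖ := by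
  rw [field_sub]
  refine (norm_linMap_le _).trans ((norm_add_le _ _).trans ?_)
  rw [add_mul, one_mul]
  gcongr
  refine (norm_add_le _ _).trans ?_
  have h1 := (prodMap s).le_opNorm₂ (x - y) x
  have h2 := (prodMap s).le_opNorm₂ y (x - y)
  nlinarith

theorem norm_galerkin_sub_le [Fact (1 < γ)] (N : ℕ+) (x y : Ell) :
    ‖galerkin γ s N x - galerkin γ s N y‖ ≤ (1 + ‖prodMap s‖ * (‖x‖ + ‖y‖)) * ‖x - y‖ := by
  rw [galerkin, galerkin, ← map_sub]
  refine (norm_proj_le _ _).trans ((norm_field_sub_le _ _).trans ?_)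
  rw [← map_sub]
  gcongr <;> exact norm_proj_le _ _

theorem lipschitzOnBalls_of_quadratic {G : Ell → Ell} {C : ℝ} (hC : 0 ≤ C)
    (h : ∀ x y, ‖G x - G y‖ ≤ (1 + C * (‖x‖ + ‖y‖)) * ‖x - y‖) : LipschitzOnBalls G := by
  intro R
  refine ⟨(1 + C * (R + R)).toNNReal, LipschitzOnWith.of_dist_le_mul fun x hx y hy => ?_⟩
  rw [mem_closedBall_zero_iff] at hx hy
  rw [dist_eq_norm, dist_eq_norm]
  refine (h x y).trans ?_
  gcongr
  refine le_trans ?_ (Real.le_coe_toNNReal _)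
  gcongr

theorem lipschitzOnBalls_field [Fact (1 < γ)] : LipschitzOnBalls (field γ s) :=
  lipschitzOnBalls_of_quadratic (norm_nonneg (prodMap s)) norm_field_sub_le

theorem lipschitzOnBalls_galerkin [Fact (1 < γ)] (N : ℕ+) : LipschitzOnBalls (galerkin γ s N) :=
  lipschitzOnBalls_of_quadratic (norm_nonneg (prodMap s)) (norm_galerkin_sub_le N)

variable [Fact (1 < γ)] [Fact (γ ≤ 2)]

/-- The constant in the tame estimate for the vector field. -/
theorem exists_norm_field_le (γ : ℝ) (s : ℕ) [NeZero s] [Fact (1 < γ)] [Fact (γ ≤ 2)] :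
    ∃ C : ℝ, 0 ≤ C ∧ ∀ x : Ell, ‖field γ s x‖ ≤ (1 + C * ‖energyMap γ s x‖) * ‖x‖ := by
  obtain ⟨Z, hZ, h⟩ := exists_wiener_le_energyMap γ s
  refine ⟨2 ^ (s + 2) * Z, by positivity, fun x => ?_⟩
  refine (norm_linMap_le _).trans ((norm_add_le _ _).trans ?_)
  have := norm_prodMap_le x x (by positivity) (by positivity) (h x) (h x)
  refine (add_le_add_right this _).trans (le_of_eq ?_)
  ring

/-- The constant in the tame estimate for the vector field. -/
def tameConst (γ : ℝ) (s : ℕ) [NeZero s] [Fact (1 < γ)] [Fact (γ ≤ 2)] : ℝ :=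
  (exists_norm_field_le γ s).choose

theorem tameConst_nonneg : 0 ≤ tameConst γ s := (exists_norm_field_le γ s).choose_spec.1

theorem norm_field_le (x : Ell) :
    ‖field γ s x‖ ≤ (1 + tameConst γ s * ‖energyMap γ s x‖) * ‖x‖ :=
  (exists_norm_field_le γ s).choose_spec.2 x

theorem norm_galerkin_le (N : ℕ+) (x : Ell) :
    ‖galerkin γ s N x‖ ≤ (1 + tameConst γ s * ‖energyMap γ s x‖) * ‖x‖ := by
  have := tameConst_nonneg (γ := γ) (s := s)
  refine (norm_proj_le _ _).trans ((norm_field_le _).trans ?_)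
  rw [← proj_energyMap]
  gcongr <;> exact norm_proj_le _ _

end Operators

/-! ### Symmetries of trilinear sums over `a + b + c = 0` -/

section Trilinear

variable {u : ℤ → ℂ} {N : ℕ+}

/-- The interval of integers `[-N, N]`. -/
def modes (N : ℕ+) : Finset ℤ := Finset.Icc (-((N : ℕ) : ℤ)) ((N : ℕ) : ℤ)

theorem mem_modes {a : ℤ} : a ∈ modes N ↔ a.natAbs ≤ N := by
  rw [modes, Finset.mem_Icc]; omega

theorem neg_mem_modes {a : ℤ} : -a ∈ modes N ↔ a ∈ modes N := by
  rw [mem_modes, mem_modes, Int.natAbs_neg]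

theorem pnat_mem_modes {n : ℕ+} : ((n : ℕ) : ℤ) ∈ modes N ↔ n ≤ N := by
  rw [mem_modes, Int.natAbs_natCast, PNat.coe_le_coe]

theorem sum_modes_even {f : ℤ → ℝ} (h : ∀ a, f (-a) = f a) (h0 : f 0 = 0) :
    ∑ a ∈ modes N, f a = 2 * ∑ n ∈ Finset.Icc 1 N, f ((n : ℕ) : ℤ) := by
  let g : ℤ → ℝ := fun a => if a ∈ modes N then f a else 0
  have hg : ∀ a ∉ modes N, g a = 0 := fun a ha => if_neg ha
  have h1 : ∑ a ∈ modes N, f a = ∑' a, g a := by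
    rw [tsum_eq_sum hg]
    exact Finset.sum_congr rfl fun a ha => (if_pos ha).symm
  have h2 : ∑ n ∈ Finset.Icc 1 N, f ((n : ℕ) : ℤ) = ∑' n : ℕ+, g ((n : ℕ) : ℤ) := by
    rw [tsum_eq_sum (s := Finset.Icc 1 N) fun n hn => if_neg fun h => hn
      (by simpa using pnat_mem_modes.1 h)]
    exact Finset.sum_congr rfl fun n hn =>
      (if_pos (pnat_mem_modes.2 (Finset.mem_Icc.1 hn).2)).symm
  rw [h1, h2, tsum_int_eq_zero_add_two_mul_tsum_pnat
    (fun a => by simp only [g, neg_mem_modes, h]) (summable_of_ne_finset_zero hg)]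
  simp [g, h0]

/-- The trilinear expression `∑ m(a, c) u(a) u(c) u(-a-c)` over `|a|, |c| ≤ N`. -/
def tri (N : ℕ+) (u : ℤ → ℂ) (m : ℤ → ℤ → ℂ) : ℂ :=
  ∑ a ∈ modes N, ∑ c ∈ modes N, m a c * (u a * u c * u (-a - c))

theorem tri_add (m m' : ℤ → ℤ → ℂ) :
    tri N u (fun a c => m a c + m' a c) = tri N u m + tri N u m' := by
  simp only [tri, add_mul, Finset.sum_add_distrib]

theorem tri_swap (m : ℤ → ℤ → ℂ) : tri N u (fun a c => m c a) = tri N u m := by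
  unfold tri
  rw [Finset.sum_comm]
  refine Finset.sum_congr rfl fun a _ => Finset.sum_congr rfl fun c _ => ?_
  rw [mul_comm (u c), show -c - a = -a - c by ring]

/-- The substitution `c ↦ -a - c` does not preserve the range `|c| ≤ N`, so it is made in the sum
over all integers; the vanishing of `u` outside the range makes both sums equal. -/
theorem tri_reflect (hu : ∀ a ∉ modes N, u a = 0) (m : ℤ → ℤ → ℂ) :
    tri N u (fun a c => m a (-a - c)) = tri N u m := by
  unfold tri
  refine Finset.sum_congr rfl fun a _ => ?_
  rw [← tsum_eq_sum (L := .unconditional ℤ) (fun c hc => by simp [hu c hc]),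
    ← tsum_eq_sum (L := .unconditional ℤ) (fun c hc => by simp [hu c hc]),
    ← (Equiv.subLeft (-a)).tsum_eq]
  refine tsum_congr fun c => ?_
  simp only [Equiv.subLeft_apply, sub_sub_cancel]
  ring

/-- The symmetrised trilinear form with symbol `a^k + b^k + c^k`, `a + b + c = 0`. -/
def cubicForm (N : ℕ+) (u : ℤ → ℂ) (k : ℕ) : ℂ :=
  tri N u fun a c => (a : ℂ) ^ k + (c : ℂ) ^ k + ((-a - c : ℤ) : ℂ) ^ k

/-- The two symmetries carry each of the three powers in the symbol to the same one. -/
theorem cubicForm_eq (hu : ∀ a ∉ modes N, u a = 0) (k : ℕ) :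
    cubicForm N u k = 3 * tri N u fun _ c => (c : ℂ) ^ k := by
  have h1 := tri_swap (N := N) (u := u) fun _ c => (c : ℂ) ^ k
  have h2 := tri_reflect hu fun _ c => (c : ℂ) ^ k
  rw [cubicForm, tri_add, tri_add, h1, h2]
  ring

theorem cubicForm_one : cubicForm N u 1 = 0 := by
  unfold cubicForm tri
  refine Finset.sum_eq_zero fun a _ => Finset.sum_eq_zero fun c _ => ?_
  push_cast
  ring

/-- As `k` is odd and `u` comes from a real function, the summand is even in `n`. Doubling thus
gives the sum over all frequencies, where `conj (u n) = u (-n)` turns it into the trilinear form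
with symbol `-c^k`, which is then symmetrised. -/
theorem two_mul_sum_im_eq (hu : ∀ a ∉ modes N, u a = 0)
    (hc : ∀ a, u (-a) = (starRingEnd ℂ) (u a)) {k : ℕ} (hk : Odd k) :
    2 * ∑ n ∈ Finset.Icc 1 N, ((n : ℕ) : ℝ) ^ k *
      ((starRingEnd ℂ) (u ((n : ℕ) : ℤ)) *
        ∑ a ∈ modes N, u a * u (((n : ℕ) : ℤ) - a)).im = -(cubicForm N u k).im / 3 := by
  set f : ℤ → ℝ := fun n => (n : ℝ) ^ k *
    ((starRingEnd ℂ) (u n) * ∑ a ∈ modes N, u a * u (n - a)).im with hf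
  have hsum : ∀ n, ∑ a ∈ modes N, u a * u (-n - a) =
      (starRingEnd ℂ) (∑ a ∈ modes N, u a * u (n - a)) := fun n => by
    rw [map_sum]
    refine Finset.sum_nbij' (fun a => -a) (fun a => -a) (fun a ha => neg_mem_modes.2 ha)
      (fun a ha => neg_mem_modes.2 ha) (by simp) (by simp) fun a _ => ?_
    rw [map_mul, hc, Complex.conj_conj, show n - -a = -(-n - a) by ring, hc, Complex.conj_conj]
  have heven : ∀ n, f (-n) = f n := fun n => by
    simp only [hf, hsum, hc, Complex.conj_conj]
    rw [show u n * (starRingEnd ℂ) (∑ a ∈ modes N, u a * u (n - a)) =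
      (starRingEnd ℂ) ((starRingEnd ℂ) (u n) * ∑ a ∈ modes N, u a * u (n - a)) by simp,
      Complex.conj_im, Int.cast_neg, hk.neg_pow]
    ring
  have h0 : f 0 = 0 := by
    simp only [hf]; rw [Int.cast_zero, zero_pow hk.pos.ne', zero_mul]
  have h1 := sum_modes_even (N := N) heven h0
  simp only [hf, Int.cast_natCast] at h1
  have h3 : ∀ z : ℂ, -(3 * z).im / 3 = (-z).im := fun z => by simp; ring
  rw [← h1, cubicForm_eq hu, ← tri_swap, tri, h3, ← Finset.sum_neg_distrib, Complex.im_sum]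
  refine Finset.sum_nbij' (fun a => -a) (fun a => -a) (fun a ha => neg_mem_modes.2 ha)
      (fun a ha => neg_mem_modes.2 ha) (by simp) (by simp) fun n _ => ?_
  have : ∀ z : ℂ, (n : ℝ) ^ k * z.im = ((n : ℂ) ^ k * z).im := fun z => by
    rw [← Complex.im_ofReal_mul]; push_cast; rfl
  rw [← hc, this, Finset.mul_sum, Finset.mul_sum, ← Finset.sum_neg_distrib]
  congr 1
  refine Finset.sum_congr rfl fun a _ => ?_
  rw [neg_neg, Int.cast_neg, hk.neg_pow]
  ring

end Trilinear

/-! ### Conservation of the energy -/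

section Energy

open scoped InnerProductSpace

variable {γ : ℝ} {s : ℕ} {N : ℕ+}

theorem fc_eq_zero_of_not_mem {x : ℕ+ → ℂ} (hx : ∀ n, N < n → x n = 0) (a : ℤ) (ha : a ∉ modes N) :
    fc s x a = 0 := by
  rcases int_cases_pnat a with rfl | ⟨n, rfl | rfl⟩
  · simp
  · rw [fc_pnat, hx n (not_le.1 fun h => ha (pnat_mem_modes.2 h)), mul_zero]
  · rw [fc_neg, fc_pnat, hx n (not_le.1 fun h => ha (neg_mem_modes.2 (pnat_mem_modes.2 h))),
      mul_zero, map_zero]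

theorem conv_eq_sum {x : ℕ+ → ℂ} (hx : ∀ n, N < n → x n = 0) (n : ℤ) :
    conv s x x n = ∑ a ∈ modes N, fc s x a * fc s x (n - a) :=
  tsum_eq_sum fun a ha => by rw [fc_eq_zero_of_not_mem hx a ha, zero_mul]

variable [NeZero s] [Fact (1 < γ)]

/-- The linear part rotates each mode and drops out of the real part; only the quadratic term
survives. -/
theorem re_conj_mul_field (x : Ell) (n : ℕ+) :
    ((starRingEnd ℂ) (x n) * field γ s x n).re = lam γ n * (((n : ℕ) : ℝ) ^ s) ^ 2 *
      ((starRingEnd ℂ) (fc s x ((n : ℕ) : ℤ)) * conv s x x ((n : ℕ) : ℤ)).im := by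
  have hn : ((((n : ℕ) : ℝ) ^ s : ℝ) : ℂ) ≠ 0 := by
    have := one_le_pnat n
    exact_mod_cast (by positivity : ((n : ℕ) : ℝ) ^ s ≠ 0)
  have hx : x n = ((((n : ℕ) : ℝ) ^ s : ℝ) : ℂ) * fc s x ((n : ℕ) : ℤ) := by
    rw [fc_pnat]
    push_cast at hn ⊢
    rw [mul_inv_cancel_left₀ hn]
  rw [field, linMap_apply, lp.coeFn_add, Pi.add_apply, prodMap_apply, hx]
  generalize fc s x ((n : ℕ) : ℤ) = z
  generalize conv s x x ((n : ℕ) : ℤ) = w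
  have : (((n : ℕ) : ℂ) ^ s) = ((((n : ℕ) : ℝ) ^ s : ℝ) : ℂ) := by push_cast; rfl
  rw [this]
  generalize ((n : ℕ) : ℝ) ^ s = q
  simp only [map_mul, Complex.conj_ofReal, Complex.mul_re, Complex.mul_im, Complex.ofReal_re,
    Complex.ofReal_im, Complex.neg_re, Complex.neg_im, Complex.I_re, Complex.I_im, Complex.conj_re,
    Complex.conj_im, Complex.add_re, Complex.add_im]
  ring

/-- The growth rate of `∑ (1 + n^γ) |x n|²` along solutions is a trilinear expression. -/
theorem sum_weight_mul_re_field {x : Ell} (hx : ∀ n, N < n → x n = 0) (w : ℕ+ → ℝ) {k : ℕ}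
    (hk : Odd k) (hw : ∀ n, w n * (lam γ n * (((n : ℕ) : ℝ) ^ s) ^ 2) = ((n : ℕ) : ℝ) ^ k) :
    2 * ∑ n ∈ Finset.Icc 1 N, w n * ((starRingEnd ℂ) (x n) * field γ s x n).re =
      -(cubicForm N (fc s x) k).im / 3 := by
  rw [← two_mul_sum_im_eq (fun a ha => fc_eq_zero_of_not_mem hx a ha) (fc_neg x) hk]
  congr 1
  refine Finset.sum_congr rfl fun n _ => ?_
  rw [re_conj_mul_field, ← conv_eq_sum hx, ← hw]
  ring

theorem hasSum_inner (x y : Ell) :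
    HasSum (fun n => ((starRingEnd ℂ) (x n) * y n).re) ⟪x, y⟫_ℝ := by
  have h := lp.hasSum_inner (𝕜 := ℝ) x y
  have he : (fun n => ((starRingEnd ℂ) (x n) * y n).re) = fun n => ⟪x n, y n⟫_ℝ := by
    funext n
    rw [Complex.inner, mul_comm]
  rw [he]
  exact h

theorem inner_proj_right (x y : Ell) : ⟪x, proj N y⟫_ℝ = ⟪proj N x, proj N y⟫_ℝ := by
  rw [← (hasSum_inner _ _).tsum_eq, ← (hasSum_inner _ _).tsum_eq]
  refine tsum_congr fun n => ?_
  simp only [proj_apply]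
  split_ifs <;> simp

theorem inner_proj_left (x y : Ell) : ⟪proj N x, y⟫_ℝ = ⟪proj N x, proj N y⟫_ℝ := by
  rw [real_inner_comm, inner_proj_right, real_inner_comm]

theorem continuous_field : Continuous (field γ s) := by
  unfold field
  have : Continuous fun x : Ell => prodMap s x x := (prodMap s).continuous.clm_apply continuous_id
  fun_prop

variable [Fact (γ ≤ 2)]

/-- The energy weight cancels the denominator of `lam` and leaves the symbol `n`. Its symmetrisation
is `a + b + c = 0`. -/
theorem inner_energyMap_field_of_support {x : Ell} (hx : ∀ n, N < n → x n = 0) :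
    ⟪energyMap γ s x, energyMap γ s (field γ s x)⟫_ℝ = 0 := by
  have h := sum_weight_mul_re_field hx (fun n => energyWeight γ s n ^ 2) (k := 1) odd_one
    (γ := γ) (s := s) fun n => by
      have := one_le_pnat n
      rw [energyWeight_sq, lam]
      field_simp
  rw [cubicForm_one] at h
  rw [← (hasSum_inner _ _).tsum_eq, tsum_eq_sum (s := Finset.Icc 1 N) fun n hn => ?_]
  · have h' : ∑ n ∈ Finset.Icc 1 N,
        energyWeight γ s n ^ 2 * ((starRingEnd ℂ) (x n) * field γ s x n).re = 0 := by
      simpa using h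
    rw [← h']
    refine Finset.sum_congr rfl fun n _ => ?_
    rw [energyMap_apply, energyMap_apply, map_mul, Complex.conj_ofReal, ← Complex.re_ofReal_mul]
    congr 1
    push_cast
    ring
  · rw [energyMap_apply, hx n (by simpa using hn)]
    simp

/-- The energy is formally conserved. -/
theorem inner_energyMap_field (x : Ell) : ⟪energyMap γ s x, energyMap γ s (field γ s x)⟫_ℝ = 0 := by
  -- Both sides are continuous and finitely supported sequences are dense.
  have hc : Continuous fun x : Ell => ⟪energyMap γ s x, energyMap γ s (field γ s x)⟫_ℝ := by
    have := continuous_field (γ := γ) (s := s)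
    fun_prop
  refine tendsto_nhds_unique ((hc.tendsto x).comp (tendsto_proj x)) ?_
  refine tendsto_const_nhds.congr fun N => ?_
  exact (inner_energyMap_field_of_support (N := N) fun n hn => by
    rw [proj_apply, if_neg (not_le.2 hn)]).symm

/-- The projection is symmetric and commutes with the energy weight, so it can be moved onto `x`,
where the conservation law of the full field applies to `proj N x`. -/
theorem inner_energyMap_galerkin (x : Ell) :
    ⟪energyMap γ s x, energyMap γ s (galerkin γ s N x)⟫_ℝ = 0 := by
  rw [galerkin, ← proj_energyMap, inner_proj_right, ← inner_proj_left, proj_energyMap,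
    inner_energyMap_field]

end Energy

/-! ### Global flows and convergence of the Galerkin approximations -/

section GlobalFlow

open Set
open scoped InnerProductSpace

variable {γ : ℝ} {s : ℕ} {N : ℕ+} [NeZero s] [Fact (1 < γ)] [Fact (γ ≤ 2)]

/-- A vector field on sequences which conserves the energy and obeys the tame estimate. -/
structure IsTame (γ : ℝ) (s : ℕ) [NeZero s] [Fact (1 < γ)] [Fact (γ ≤ 2)] (G : Ell → Ell) :
    Prop where
  inner_eq_zero : ∀ x, ⟪energyMap γ s x, energyMap γ s (G x)⟫_ℝ = 0
  norm_le : ∀ x, ‖G x‖ ≤ (1 + tameConst γ s * ‖energyMap γ s x‖) * ‖x‖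

theorem isTame_field : IsTame γ s (field γ s) := ⟨inner_energyMap_field, norm_field_le⟩

theorem isTame_galerkin (N : ℕ+) : IsTame γ s (galerkin γ s N) :=
  ⟨inner_energyMap_galerkin, norm_galerkin_le N⟩

/-- The growth of the Sobolev norm of solutions of size `r` up to time `T`. -/
def growth (γ : ℝ) (s : ℕ) [NeZero s] [Fact (1 < γ)] [Fact (γ ≤ 2)] (r T : ℝ) : ℝ :=
  r * Real.exp ((1 + tameConst γ s * (2 * r)) * T)

theorem growth_mono {r r' T : ℝ} (hr : 0 ≤ r) (h : r ≤ r') (hT : 0 ≤ T) :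
    growth γ s r T ≤ growth γ s r' T := by
  have := tameConst_nonneg (γ := γ) (s := s)
  have := hr.trans h
  unfold growth
  gcongr

/-- The field is orthogonal to `x` in the energy form, and rescaling it by `c t` does not change
that. So the cut off equations used for existence conserve the energy too. -/
theorem IsTame.norm_energyMap_eq {G : Ell → Ell} (hG : IsTame γ s G) {c : ℝ → ℝ} {u : ℝ → Ell}
    {T : ℝ} (hu : ∀ t ∈ Icc (-T) T, HasDerivWithinAt u (c t • G (u t)) (Icc (-T) T) t) {t : ℝ}
    (ht : t ∈ Icc (-T) T) : ‖energyMap γ s (u t)‖ = ‖energyMap γ s (u 0)‖ := by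
  have hd : ∀ t ∈ Icc (-T) T, HasDerivWithinAt
      (fun t => ‖energyMap γ s (u t)‖ ^ 2 - ‖energyMap γ s (u 0)‖ ^ 2) 0 (Icc (-T) T) t := by
    intro t ht
    have h1 := ((energyMap γ s).hasFDerivAt.comp_hasDerivWithinAt t (hu t ht)).norm_sq.sub_const
      (‖energyMap γ s (u 0)‖ ^ 2)
    refine h1.congr_deriv ?_
    simp [inner_smul_right, hG.inner_eq_zero]
  have := norm_le_of_norm_deriv_le (K := 0) (ε := 0) le_rfl le_rfl hd (by simp) ht
  rw [sub_self, norm_zero, zero_mul, add_zero, zero_mul, norm_le_zero_iff, sub_eq_zero] at this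
  exact (sq_eq_sq₀ (norm_nonneg _) (norm_nonneg _)).1 this

/-- With the energy frozen at its initial value, the tame estimate becomes a linear differential
inequality with constant rate. -/
theorem IsTame.norm_le_growth {G : Ell → Ell} (hG : IsTame γ s G) {c : ℝ → ℝ} {u : ℝ → Ell}
    {T : ℝ} (hc : ∀ t ∈ Icc (-T) T, 0 ≤ c t ∧ c t ≤ 1)
    (hu : ∀ t ∈ Icc (-T) T, HasDerivWithinAt u (c t • G (u t)) (Icc (-T) T) t) {t : ℝ}
    (ht : t ∈ Icc (-T) T) : ‖u t‖ ≤ growth γ s ‖u 0‖ T := by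
  have hC := tameConst_nonneg (γ := γ) (s := s)
  have := norm_le_of_norm_deriv_le (K := 1 + tameConst γ s * (2 * ‖u 0‖)) (ε := 0) (by positivity)
    le_rfl hu (fun τ hτ => ?_) ht
  · simpa [growth] using this
  · rw [add_zero, norm_smul, Real.norm_eq_abs, abs_of_nonneg (hc τ hτ).1]
    refine (mul_le_of_le_one_left (norm_nonneg _) (hc τ hτ).2).trans ((hG.norm_le _).trans ?_)
    rw [hG.norm_energyMap_eq hu hτ]
    gcongr
    exact norm_energyMap_le _

theorem IsTame.hasAPrioriBounds {G : Ell → Ell} (hG : IsTame γ s G) : HasAPrioriBounds G := by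
  intro r T
  refine ⟨growth γ s r T, fun c u hc hu h0 t ht => (hG.norm_le_growth hc hu ht).trans ?_⟩
  exact growth_mono (norm_nonneg _) h0 (by linarith [ht.1, ht.2])

theorem IsTame.flow_norm_le {G : Ell → Ell} (hG : IsTame γ s G) {φ : ℝ → Ell → Ell}
    (hφ : IsFlow G φ) (x : Ell) {t T : ℝ} (ht : t ∈ Icc (-T) T) :
    ‖φ t x‖ ≤ growth γ s ‖x‖ T := by
  have := hG.norm_le_growth (c := fun _ => 1) (u := fun t => φ t x) (by simp)
    (fun τ _ => by simpa using (hφ.hasDerivAt x τ).hasDerivWithinAt) ht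
  simpa [hφ.zero] using this

theorem IsTame.flow_norm_energyMap {G : Ell → Ell} (hG : IsTame γ s G) {φ : ℝ → Ell → Ell}
    (hφ : IsFlow G φ) (x : Ell) (t : ℝ) : ‖energyMap γ s (φ t x)‖ = ‖energyMap γ s x‖ := by
  have := hG.norm_energyMap_eq (c := fun _ => 1) (u := fun t => φ t x) (T := |t|)
    (fun τ _ => by simpa using (hφ.hasDerivAt x τ).hasDerivWithinAt) ⟨neg_abs_le t, le_abs_self t⟩
  simpa [hφ.zero] using this

theorem exists_isFlow_field (γ : ℝ) (s : ℕ) [NeZero s] [Fact (1 < γ)] [Fact (γ ≤ 2)] :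
    ∃ φ, IsFlow (field γ s) φ :=
  exists_isFlow lipschitzOnBalls_field isTame_field.hasAPrioriBounds

theorem exists_isFlow_galerkin (γ : ℝ) (s : ℕ) [NeZero s] [Fact (1 < γ)] [Fact (γ ≤ 2)] (N : ℕ+) :
    ∃ φ, IsFlow (galerkin γ s N) φ :=
  exists_isFlow (lipschitzOnBalls_galerkin N) (isTame_galerkin N).hasAPrioriBounds

/-- The flow of the equation in rescaled Fourier coefficients. -/
def seqFlow (γ : ℝ) (s : ℕ) [NeZero s] [Fact (1 < γ)] [Fact (γ ≤ 2)] : ℝ → Ell → Ell :=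
  (exists_isFlow_field γ s).choose

/-- The flow of the Galerkin truncation. -/
def galerkinFlow (γ : ℝ) (s : ℕ) [NeZero s] [Fact (1 < γ)] [Fact (γ ≤ 2)] (N : ℕ+) :
    ℝ → Ell → Ell :=
  (exists_isFlow_galerkin γ s N).choose

theorem isFlow_seqFlow : IsFlow (field γ s) (seqFlow γ s) := (exists_isFlow_field γ s).choose_spec

theorem isFlow_galerkinFlow (N : ℕ+) : IsFlow (galerkin γ s N) (galerkinFlow γ s N) :=
  (exists_isFlow_galerkin γ s N).choose_spec

/-- Both sides solve the truncated equation with the same initial value. -/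
theorem proj_galerkinFlow (x : Ell) (t : ℝ) :
    proj N (galerkinFlow γ s N t (proj N x)) = galerkinFlow γ s N t (proj N x) := by
  have h : ∀ t, HasDerivAt (fun t => proj N (galerkinFlow γ s N t (proj N x)))
      (galerkin γ s N (proj N (galerkinFlow γ s N t (proj N x)))) t := fun t => by
    have := (proj N).hasFDerivAt.comp_hasDerivAt t ((isFlow_galerkinFlow (γ := γ) (s := s) N).hasDerivAt (proj N x) t)
    refine this.congr_deriv ?_
    rw [galerkin, galerkin, proj_proj, proj_proj]
  have := (isFlow_galerkinFlow N).eq_of_hasDerivAt (lipschitzOnBalls_galerkin N) h t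
  simpa [(isFlow_galerkinFlow N).zero, proj_proj] using this

omit [NeZero s] [Fact (γ ≤ 2)] in
theorem norm_linMap_sub_proj_le (x : Ell) :
    ‖linMap γ x - proj N (linMap γ x)‖ ≤ ((N : ℕ) : ℝ) ^ (1 - γ) * ‖x‖ := by
  have hγ : 1 < γ := Fact.out
  refine norm_le_mul_norm_of_le (by positivity) fun n => ?_
  rw [lp.coeFn_sub, Pi.sub_apply, proj_apply]
  split_ifs with h
  · rw [sub_self, norm_zero]; positivity
  · rw [sub_zero, linMap_apply, norm_mul, norm_neg, norm_mul, Complex.norm_I, one_mul,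
      Complex.norm_real, Real.norm_eq_abs, abs_of_pos (lam_pos γ n)]
    gcongr
    refine (lam_le_rpow γ n).trans (Real.rpow_le_rpow_of_nonpos ?_ ?_ (by linarith))
    · exact_mod_cast N.pos
    · exact_mod_cast (not_le.1 h).le

omit [NeZero s] [Fact (γ ≤ 2)] in
theorem tendsto_pnat_rpow : Tendsto (fun N : ℕ+ => ((N : ℕ) : ℝ) ^ (1 - γ)) atTop (𝓝 0) := by
  have hγ : 1 < γ := Fact.out
  have h := tendsto_rpow_neg_atTop (y := γ - 1) (by linarith)
  rw [neg_sub] at h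
  exact h.comp (tendsto_natCast_atTop_atTop.comp tendsto_PNat_val_atTop_atTop)

/-- Convergence of the Galerkin approximations. -/
theorem tendsto_galerkinFlow (t : ℝ) (x : Ell) :
    Tendsto (fun N => galerkinFlow γ s N t (proj N x)) atTop (𝓝 (seqFlow γ s t x)) := by
  set T := |t|
  have hT : 0 ≤ T := abs_nonneg t
  have ht : t ∈ Icc (-T) T := ⟨neg_abs_le t, le_abs_self t⟩
  set M := growth γ s ‖x‖ T
  have hM0 : 0 ≤ M := mul_nonneg (norm_nonneg _) (Real.exp_pos _).le
  set K := 1 + ‖prodMap s‖ * (M + M)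
  have hK : 0 ≤ K := by positivity
  set B := M + ‖prodMap s‖ * M * M
  set ε : ℕ+ → ℝ := fun N => ‖x - proj N x‖ + ((N : ℕ) : ℝ) ^ (1 - γ) * B * T
  have hu : ∀ τ ∈ Icc (-T) T, ‖seqFlow γ s τ x‖ ≤ M := fun τ hτ =>
    isTame_field.flow_norm_le isFlow_seqFlow x hτ
  have hv : ∀ N, ∀ τ ∈ Icc (-T) T, ‖galerkinFlow γ s N τ (proj N x)‖ ≤ M := fun N τ hτ =>
    ((isTame_galerkin N).flow_norm_le (isFlow_galerkinFlow N) _ hτ).trans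
      (growth_mono (norm_nonneg _) (norm_proj_le _ _) hT)
  -- The high modes of the true solution are driven by `(1 - proj N) L` applied to a bounded
  -- quantity, of size `N^(1-γ)`. The bound has no feedback term, so Grönwall is used with `K = 0`.
  have hq : ∀ N : ℕ+, ∀ τ ∈ Icc (-T) T,
      ‖seqFlow γ s τ x - proj N (seqFlow γ s τ x)‖ ≤ ε N := by
    intro N τ hτ
    have := norm_le_of_norm_deriv_le (K := 0) (ε := ((N : ℕ) : ℝ) ^ (1 - γ) * B) le_rfl
      (by positivity)
      (u := fun τ => seqFlow γ s τ x - proj N (seqFlow γ s τ x))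
      (fun τ _ => ((isFlow_seqFlow.hasDerivAt x τ).sub ((proj N).hasFDerivAt.comp_hasDerivAt τ
        (isFlow_seqFlow.hasDerivAt x τ))).hasDerivWithinAt) (fun τ hτ => ?_) hτ
    · simpa [isFlow_seqFlow.zero] using this
    · rw [zero_mul, zero_add, field]
      refine (norm_linMap_sub_proj_le _).trans ?_
      gcongr
      refine (norm_add_le _ _).trans (add_le_add (hu τ hτ) ?_)
      refine ((prodMap s).le_opNorm₂ _ _).trans ?_
      have := hu τ hτ
      gcongr
  -- The low modes are compared by Grönwall. The source is the Lipschitz constant `K` times the high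
  -- modes of the true solution, which the truncated field does not see.
  have hw : ∀ N : ℕ+, ‖galerkinFlow γ s N t (proj N x) - proj N (seqFlow γ s t x)‖ ≤
      K * ε N * T * Real.exp (K * T) := by
    intro N
    have hε : 0 ≤ ε N := by positivity
    have := norm_le_of_norm_deriv_le (K := K) (ε := K * ε N) hK (by positivity)
      (u := fun τ => galerkinFlow γ s N τ (proj N x) - proj N (seqFlow γ s τ x))
      (fun τ _ => (((isFlow_galerkinFlow N).hasDerivAt (proj N x) τ).sub
        ((proj N).hasFDerivAt.comp_hasDerivAt τ
          (isFlow_seqFlow.hasDerivAt x τ))).hasDerivWithinAt) (fun τ hτ => ?_) ht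
    · simpa [isFlow_seqFlow.zero, (isFlow_galerkinFlow N).zero] using this
    · rw [galerkin, ← map_sub]
      refine (norm_proj_le _ _).trans ((norm_field_sub_le _ _).trans ?_)
      rw [← mul_add, proj_galerkinFlow]
      have h1 := hu τ hτ
      have h2 := hv N τ hτ
      have h3 := norm_add_le (galerkinFlow γ s N τ (proj N x) - proj N (seqFlow γ s τ x))
        (proj N (seqFlow γ s τ x) - seqFlow γ s τ x)
      rw [sub_add_sub_cancel, norm_sub_rev (proj N _)] at h3
      have h4 := hq N τ hτ
      have h5 := h3.trans (add_le_add_right h4 _)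
      have h6 : 1 + ‖prodMap s‖ *
          (‖galerkinFlow γ s N τ (proj N x)‖ + ‖seqFlow γ s τ x‖) ≤ K := by
        simp only [K]
        gcongr
      exact mul_le_mul h6 h5 (norm_nonneg _) hK
  have hε0 : Tendsto ε atTop (𝓝 0) := by
    have h1 : Tendsto (fun N => ‖x - proj N x‖) atTop (𝓝 0) := by
      have := ((tendsto_const_nhds (x := x)).sub (tendsto_proj x)).norm
      simpa using this
    have h2 := ((tendsto_pnat_rpow (γ := γ)).mul_const B).mul_const T
    simpa using h1.add h2
  rw [tendsto_iff_norm_sub_tendsto_zero]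
  refine squeeze_zero (g := fun N => K * ε N * T * Real.exp (K * T) + ε N) (fun N => norm_nonneg _)
    (fun N => ?_) ?_
  · have h3 := norm_add_le (galerkinFlow γ s N t (proj N x) - proj N (seqFlow γ s t x))
      (proj N (seqFlow γ s t x) - seqFlow γ s t x)
    rw [sub_add_sub_cancel, norm_sub_rev (proj N _)] at h3
    exact h3.trans (add_le_add (hw N) (hq N t ht))
  · simpa using (((hε0.const_mul K).mul_const T).mul_const (Real.exp (K * T))).add hε0

omit [NeZero s] [Fact (1 < γ)] [Fact (γ ≤ 2)] in
theorem IsFlow.continuous {G : Ell → Ell} (hG : LipschitzOnBalls G) (hA : HasAPrioriBounds G)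
    {φ : ℝ → Ell → Ell} (hφ : IsFlow G φ) (t : ℝ) : Continuous (φ t) := by
  rw [continuous_iff_continuousAt]
  intro x
  obtain ⟨L, hL0, hL⟩ := hφ.exists_lipschitz hG hA (‖x‖ + 1) |t|
  have hlip : LipschitzOnWith L.toNNReal (φ t) (Metric.closedBall 0 (‖x‖ + 1)) :=
    LipschitzOnWith.of_dist_le_mul fun y hy z hz => by
      rw [Real.coe_toNNReal _ hL0, dist_eq_norm, dist_eq_norm]
      exact hL y z (by simpa using hy) (by simpa using hz) t ⟨neg_abs_le t, le_abs_self t⟩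
  refine hlip.continuousOn.continuousAt (Metric.closedBall_mem_nhds_of_mem ?_)
  simp

theorem continuous_seqFlow (t : ℝ) : Continuous (seqFlow γ s t) :=
  isFlow_seqFlow.continuous lipschitzOnBalls_field isTame_field.hasAPrioriBounds t

theorem continuous_galerkinFlow (N : ℕ+) (t : ℝ) : Continuous (galerkinFlow γ s N t) :=
  (isFlow_galerkinFlow N).continuous (lipschitzOnBalls_galerkin N)
    (isTame_galerkin N).hasAPrioriBounds t

end GlobalFlow

/-! ### The trilinear form for `s ≥ 2` -/

section CubicBound

/-- If `c` is smallest then `|a|` and `|b|` are comparable up to a factor 2. The exponent being odd,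
`b^(2s+1) + a^(2s+1)` is a difference of powers of `b` and `-a` and contains the factor `a + b =
-c`. -/
theorem abs_odd_pow_sum_le_of_le (s : ℕ) {a b c : ℝ} (h : a + b + c = 0) (hca : |c| ≤ |a|)
    (hcb : |c| ≤ |b|) : |a ^ (2 * s + 1) + b ^ (2 * s + 1) + c ^ (2 * s + 1)| ≤
      ((2 * s + 1) * 2 ^ s + 1) * (|a| ^ s * |b| ^ s * |c|) := by
  have hab : |a| ≤ 2 * |b| := by
    rw [show a = -(b + c) by linarith, abs_neg]
    linarith [abs_add_le b c]
  have hba : |b| ≤ 2 * |a| := by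
    rw [show b = -(a + c) by linarith, abs_neg]
    linarith [abs_add_le a c]
  have h1 := abs_pow_sub_pow_le b (-a) (2 * s + 1)
  have hodd : Odd (2 * s + 1) := ⟨s, rfl⟩
  rw [hodd.neg_pow, sub_neg_eq_add, sub_neg_eq_add, abs_neg, show b + a = -c by linarith, abs_neg,
    Nat.add_sub_cancel] at h1
  have h2 : max |b| |a| ^ (2 * s) ≤ 2 ^ s * (|a| ^ s * |b| ^ s) := by
    rcases max_cases |b| |a| with ⟨h, _⟩ | ⟨h, _⟩ <;> rw [h, two_mul, pow_add]
    · calc |b| ^ s * |b| ^ s ≤ (2 * |a|) ^ s * |b| ^ s := by gcongr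
        _ = _ := by rw [mul_pow]; ring
    · calc |a| ^ s * |a| ^ s ≤ |a| ^ s * (2 * |b|) ^ s := by gcongr
        _ = _ := by rw [mul_pow]; ring
  have h3 : |c ^ (2 * s + 1)| ≤ |a| ^ s * |b| ^ s * |c| := by
    rw [abs_pow, pow_succ, two_mul, pow_add]
    gcongr
  calc |a ^ (2 * s + 1) + b ^ (2 * s + 1) + c ^ (2 * s + 1)|
      ≤ |b ^ (2 * s + 1) + a ^ (2 * s + 1)| + |c ^ (2 * s + 1)| := by
        rw [add_comm (a ^ _)]; exact abs_add_le _ _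
    _ ≤ |c| * ((2 * s + 1 : ℕ) : ℝ) * (2 ^ s * (|a| ^ s * |b| ^ s)) + |a| ^ s * |b| ^ s * |c| :=
        add_le_add (h1.trans (by gcongr)) h3
    _ = _ := by push_cast; ring

/-- The symmetrised symbol gains on the smallest frequency. -/
theorem abs_odd_pow_sum_le (s : ℕ) {a b c : ℝ} (h : a + b + c = 0) :
    |a ^ (2 * s + 1) + b ^ (2 * s + 1) + c ^ (2 * s + 1)| ≤ ((2 * s + 1) * 2 ^ s + 1) *
      (|a| ^ s * |b| ^ s * |c| + |a| ^ s * |b| * |c| ^ s + |a| * |b| ^ s * |c| ^ s) := by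
  have ha : 0 ≤ ((2 * s + 1 : ℝ) * 2 ^ s + 1) * (|a| * |b| ^ s * |c| ^ s) := by positivity
  have hb : 0 ≤ ((2 * s + 1 : ℝ) * 2 ^ s + 1) * (|a| ^ s * |b| * |c| ^ s) := by positivity
  have hc : 0 ≤ ((2 * s + 1 : ℝ) * 2 ^ s + 1) * (|a| ^ s * |b| ^ s * |c|) := by positivity
  rw [mul_add, mul_add]
  rcases le_total |a| |b| with h1 | h1
  · rcases le_total |a| |c| with h2 | h2
    · have := abs_odd_pow_sum_le_of_le s (a := b) (b := c) (c := a) (by linarith) h1 h2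
      rw [show a ^ (2 * s + 1) + b ^ (2 * s + 1) + c ^ (2 * s + 1) =
        b ^ (2 * s + 1) + c ^ (2 * s + 1) + a ^ (2 * s + 1) by ring]
      linarith [this.trans_eq (show _ = ((2 * s + 1 : ℝ) * 2 ^ s + 1) *
        (|a| * |b| ^ s * |c| ^ s) by ring)]
    · have := abs_odd_pow_sum_le_of_le s h h2 (h2.trans h1)
      linarith
  · rcases le_total |b| |c| with h2 | h2
    · have := abs_odd_pow_sum_le_of_le s (a := a) (b := c) (c := b) (by linarith) h1 h2
      rw [show a ^ (2 * s + 1) + b ^ (2 * s + 1) + c ^ (2 * s + 1) =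
        a ^ (2 * s + 1) + c ^ (2 * s + 1) + b ^ (2 * s + 1) by ring]
      linarith [this.trans_eq (show _ = ((2 * s + 1 : ℝ) * 2 ^ s + 1) *
        (|a| ^ s * |b| * |c| ^ s) by ring)]
    · have := abs_odd_pow_sum_le_of_le s h (h2.trans h1) h2
      linarith

theorem tsum_mul_reflect_le (P : ℤ → ℝ≥0∞) (c : ℤ) :
    ∑' a, P a * P (-a - c) ≤ 2 * ∑' a, P a ^ 2 := by
  have h : ∑' a, P (-a - c) ^ 2 = ∑' a, P a ^ 2 := by
    rw [← (Equiv.subLeft (-c)).tsum_eq]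
    exact tsum_congr fun a => by rw [Equiv.subLeft_apply]; congr 2; ring
  rw [two_mul]
  nth_rewrite 2 [← h]
  rw [← ENNReal.tsum_add]
  refine ENNReal.tsum_le_tsum fun a => ?_
  rcases le_total (P a) (P (-a - c)) with h | h
  · exact (mul_le_mul_left h _).trans (by rw [← pow_two]; exact le_add_self)
  · exact (mul_le_mul_right h _).trans (by rw [← pow_two]; exact le_self_add)

/-- In each term two factors are placed in `ℓ²` and the third in `ℓ¹`; changes of variables carry
the three terms into one another. -/
theorem tsum_trilinear_le (P R : ℤ → ℝ≥0∞) :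
    ∑' a, ∑' c, (P a * P c * R (-a - c) + P a * R c * P (-a - c) + R a * P c * P (-a - c)) ≤
      6 * ((∑' a, P a ^ 2) * ∑' a, R a) := by
  set B := (∑' a, P a ^ 2) * ∑' a, R a
  have h3 : ∑' a, ∑' c, R a * P c * P (-a - c) ≤ 2 * B := by
    calc ∑' a, ∑' c, R a * P c * P (-a - c)
        = ∑' a, R a * ∑' c, P c * P (-c - a) := by
          refine tsum_congr fun a => ?_
          rw [← ENNReal.tsum_mul_left]
          refine tsum_congr fun c => ?_
          rw [mul_assoc, show -a - c = -c - a by ring]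
      _ ≤ ∑' a, R a * (2 * ∑' a, P a ^ 2) :=
          ENNReal.tsum_le_tsum fun a => mul_le_mul_right (tsum_mul_reflect_le P a) _
      _ = 2 * B := by rw [ENNReal.tsum_mul_right]; simp only [B]; ring
  have h2 : ∑' a, ∑' c, P a * R c * P (-a - c) ≤ 2 * B := by
    rw [ENNReal.tsum_comm]
    refine (le_of_eq ?_).trans h3
    refine tsum_congr fun a => tsum_congr fun c => ?_
    rw [mul_comm (P c), show -c - a = -a - c by ring]
  have h1 : ∑' a, ∑' c, P a * P c * R (-a - c) ≤ 2 * B := by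
    refine (le_of_eq ?_).trans h2
    refine tsum_congr fun a => ?_
    rw [← (Equiv.subLeft (-a)).tsum_eq]
    refine tsum_congr fun c => ?_
    simp only [Equiv.subLeft_apply, sub_sub_cancel]
    ring
  simp only [ENNReal.tsum_add]
  calc _ ≤ 2 * B + 2 * B + 2 * B := add_le_add (add_le_add h1 h2) h3
    _ = 6 * B := by ring

theorem enorm_intCast (a : ℤ) : ‖(a : ℝ)‖ₑ = eabs a := by
  rw [← ofReal_norm, Real.norm_eq_abs, ← Int.cast_abs, Int.abs_eq_natAbs, eabs, Int.cast_natCast,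
    ENNReal.ofReal_natCast]

theorem eabs_mul_enorm_fc_succ (s : ℕ) (x : ℕ+ → ℂ) (a : ℤ) :
    eabs a * ‖fc (s + 1) x a‖ₑ = ‖fc s x a‖ₑ := by
  have key : ∀ n : ℕ+, eabs ((n : ℕ) : ℤ) * ‖fc (s + 1) x ((n : ℕ) : ℤ)‖ₑ =
      ‖fc s x ((n : ℕ) : ℤ)‖ₑ := fun n => by
    have hn := one_le_pnat n
    have : eabs ((n : ℕ) : ℤ) = ENNReal.ofReal ((n : ℕ) : ℝ) := by simp [eabs]
    rw [this, ← ofReal_norm, ← ofReal_norm, ← ENNReal.ofReal_mul (by positivity), norm_fc_pnat,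
      norm_fc_pnat, pow_succ]
    congr 1
    field_simp
  rcases int_cases_pnat a with rfl | ⟨n, rfl | rfl⟩
  · simp
  · exact key n
  · rw [eabs_neg, enorm_fc_neg, enorm_fc_neg]; exact key n

/-- For `s ≥ 2` the trilinear form is bounded on `H^s`. -/
theorem exists_norm_cubicForm_le (s : ℕ) [NeZero s] : ∃ C : ℝ, 0 ≤ C ∧ ∀ (N : ℕ+) (x : Ell),
    ‖cubicForm N (fc (s + 1) x) (2 * (s + 1) + 1)‖ ≤ C * ‖x‖ ^ 3 := by
  obtain ⟨K, hK⟩ : ∃ K : ℝ, K = (2 * ((s + 1 : ℕ) : ℝ) + 1) * 2 ^ (s + 1) + 1 := ⟨_, rfl⟩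
  have hK0 : 0 ≤ K := by rw [hK]; positivity
  have hW := wienerConst_nonneg (s := s)
  refine ⟨K * 12 * wienerConst s, by positivity, fun N x => ?_⟩
  set U : ℤ → ℝ≥0∞ := fun a => ‖fc (s + 1) x a‖ₑ with hU
  set P : ℤ → ℝ≥0∞ := fun a => eabs a ^ (s + 1) * U a
  set R : ℤ → ℝ≥0∞ := fun a => eabs a * U a
  have hUneg : ∀ a, U (-a) = U a := fun a => enorm_fc_neg _ _
  have hsym : ∀ a c : ℤ, ‖(a : ℂ) ^ (2 * (s + 1) + 1) + (c : ℂ) ^ (2 * (s + 1) + 1) +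
      ((-a - c : ℤ) : ℂ) ^ (2 * (s + 1) + 1)‖ₑ ≤ ENNReal.ofReal K *
        (eabs a ^ (s + 1) * eabs c ^ (s + 1) * eabs (-a - c) +
        eabs a ^ (s + 1) * eabs c * eabs (-a - c) ^ (s + 1) +
        eabs a * eabs c ^ (s + 1) * eabs (-a - c) ^ (s + 1)) := by
    intro a c
    have h := abs_odd_pow_sum_le (s + 1) (a := a) (b := c) (c := ((-a - c : ℤ) : ℝ))
      (by push_cast; ring)
    rw [← hK] at h
    have h' := ENNReal.ofReal_le_ofReal h
    have habs : ∀ a : ℤ, ENNReal.ofReal |(a : ℝ)| = eabs a := fun a => by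
      rw [← enorm_intCast, ← ofReal_norm, Real.norm_eq_abs]
    have hprod : ∀ p q r : ℕ, ENNReal.ofReal (|(a : ℝ)| ^ p * |(c : ℝ)| ^ q *
        |((-a - c : ℤ) : ℝ)| ^ r) = eabs a ^ p * eabs c ^ q * eabs (-a - c) ^ r := fun p q r => by
      rw [ENNReal.ofReal_mul (by positivity), ENNReal.ofReal_mul (by positivity),
        ENNReal.ofReal_pow (abs_nonneg _), ENNReal.ofReal_pow (abs_nonneg _),
        ENNReal.ofReal_pow (abs_nonneg _), habs, habs, habs]
    have h1 := hprod (s + 1) (s + 1) 1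
    have h2 := hprod (s + 1) 1 (s + 1)
    have h3 := hprod 1 (s + 1) (s + 1)
    simp only [pow_one] at h1 h2 h3
    rw [ENNReal.ofReal_mul hK0, ENNReal.ofReal_add (by positivity) (by positivity),
      ENNReal.ofReal_add (by positivity) (by positivity), h1, h2, h3] at h'
    refine le_trans (le_of_eq ?_) h'
    rw [← ofReal_norm]
    congr 1
    rw [← Real.norm_eq_abs, ← Complex.norm_real]
    push_cast
    rfl
  have h1 : ‖cubicForm N (fc (s + 1) x) (2 * (s + 1) + 1)‖ₑ ≤
      ENNReal.ofReal K * (6 * ((∑' a, P a ^ 2) * ∑' a, R a)) := by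
    refine le_trans ?_ (mul_le_mul_right (tsum_trilinear_le P R) _)
    rw [← ENNReal.tsum_mul_left]
    refine le_trans ?_ (ENNReal.sum_le_tsum (modes N))
    refine (enorm_sum_le _ _).trans (Finset.sum_le_sum fun a _ => ?_)
    rw [← ENNReal.tsum_mul_left]
    refine le_trans ?_ (ENNReal.sum_le_tsum (modes N))
    refine (enorm_sum_le _ _).trans (Finset.sum_le_sum fun c _ => ?_)
    rw [enorm_mul, enorm_mul, enorm_mul]
    refine (mul_le_mul_left (hsym a c) _).trans (le_of_eq ?_)
    simp only [P, R, U]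
    ring
  have h2 : ∑' a, P a ^ 2 = 2 * ‖x‖ₑ ^ 2 := tsum_eabs_pow_mul_fc_sq x
  -- One derivative falls on the `ℓ¹` factor, which lowers the order from `s + 1` to `s`. Its Wiener
  -- norm is still finite because `s ≥ 1`, that is, because the order one started from is at least
  -- 2.
  have h3 : ∑' a, R a ≤ ENNReal.ofReal (wienerConst s * ‖x‖) := by
    have h4 := wiener_sq_le_wienerConst (s := s) x
    rw [ENNReal.ofReal_pow (by positivity)] at h4
    have h5 : wiener s x ≤ ENNReal.ofReal (wienerConst s * ‖x‖) :=
      (ENNReal.pow_le_pow_left_iff two_ne_zero).1 h4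
    simp only [R, U, eabs_mul_enorm_fc_succ]
    exact h5
  rw [h2] at h1
  have h6 : ‖cubicForm N (fc (s + 1) x) (2 * (s + 1) + 1)‖ₑ ≤
      ENNReal.ofReal (K * 12 * wienerConst s * ‖x‖ ^ 3) := by
    refine h1.trans ((mul_le_mul_right (mul_le_mul_right (mul_le_mul_right h3 _) _) _).trans
      (le_of_eq ?_))
    have h2' : (2 : ℝ≥0∞) * ‖x‖ₑ ^ 2 = ENNReal.ofReal (2 * ‖x‖ ^ 2) := by
      rw [enorm_sq_eq_ofReal, ENNReal.ofReal_mul (by norm_num)]; norm_num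
    rw [h2', show (6 : ℝ≥0∞) = ENNReal.ofReal 6 by norm_num, ← ENNReal.ofReal_mul (by positivity),
      ← ENNReal.ofReal_mul (by positivity), ← ENNReal.ofReal_mul (by positivity)]
    congr 1
    ring
  rw [← ofReal_norm] at h6
  exact (ENNReal.ofReal_le_ofReal_iff (by positivity)).1 h6

end CubicBound

/-! ### Integrals of powers of trigonometric polynomials -/

section TrigSum

/-- The normalised Haar measure on the torus. -/
abbrev haarT : Measure Torus := AddCircle.haarAddCircle

/-- A trigonometric polynomial. -/
def trigSum (J : Finset ℤ) (q : ℤ → ℂ) (θ : Torus) : ℂ := ∑ m ∈ J, q m * fourier m θ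

theorem integral_fourier (m : ℤ) : ∫ θ : Torus, fourier m θ ∂haarT = if m = 0 then 1 else 0 := by
  have h := congrFun (fourierCoeff_fourier (T := 2 * Real.pi) m) 0
  rw [fourierCoeff] at h
  simp only [neg_zero, fourier_zero, one_smul, Pi.single_apply] at h
  rw [h]
  simp [eq_comm]

theorem integrable_of_continuous_torus {E : Type*} [NormedAddCommGroup E] {f : Torus → E}
    (hf : Continuous f) : Integrable f haarT :=
  hf.integrable_of_hasCompactSupport (HasCompactSupport.of_compactSpace _)

theorem integral_trigSum_mul (J J' : Finset ℤ) (q p : ℤ → ℂ) (hp : ∀ a ∉ J', p a = 0) :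
    ∫ θ, trigSum J q θ * trigSum J' p θ ∂haarT = ∑ m ∈ J, q m * p (-m) := by
  have h : ∀ θ, trigSum J q θ * trigSum J' p θ =
      ∑ m ∈ J, ∑ a ∈ J', q m * p a * fourier (m + a) θ := fun θ => by
    rw [trigSum, trigSum, Finset.sum_mul_sum]
    refine Finset.sum_congr rfl fun m _ => Finset.sum_congr rfl fun a _ => ?_
    rw [fourier_add]; ring
  simp only [h]
  rw [integral_finsetSum _ fun m _ => integrable_of_continuous_torus (by fun_prop)]
  refine Finset.sum_congr rfl fun m _ => ?_
  rw [integral_finsetSum _ fun m _ => integrable_of_continuous_torus (by fun_prop)]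
  simp only [integral_const_mul, integral_fourier]
  by_cases hm : -m ∈ J'
  · rw [Finset.sum_eq_single (-m)]
    · simp
    · intro a _ ha
      rw [if_neg (by intro h; exact ha (by linarith)), mul_zero]
    · exact fun h => absurd hm h
  · rw [hp _ hm, mul_zero]
    refine Finset.sum_eq_zero fun a ha => ?_
    rw [if_neg, mul_zero]
    intro h
    exact hm (by rwa [show -m = a by linarith])

/-- The square has frequencies up to `2N`, hence the larger range on the right. -/
theorem trigSum_sq {N : ℕ+} {d : ℤ → ℂ} (hd : ∀ a ∉ modes N, d a = 0) (θ : Torus) :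
    trigSum (modes N) d θ * trigSum (modes N) d θ =
      trigSum (modes (N + N)) (fun m => ∑ a ∈ modes N, d a * d (m - a)) θ := by
  have hR : trigSum (modes (N + N)) (fun m => ∑ a ∈ modes N, d a * d (m - a)) θ =
      ∑ a ∈ modes N, ∑ m ∈ modes (N + N), d a * d (m - a) * fourier m θ := by
    simp only [trigSum, Finset.sum_mul]
    exact Finset.sum_comm
  rw [hR, trigSum, Finset.sum_mul_sum]
  refine Finset.sum_congr rfl fun a ha => ?_
  have hsub : (modes N).map (Equiv.addLeft a).toEmbedding ⊆ modes (N + N) := by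
    intro m hm
    obtain ⟨c, hc, rfl⟩ := Finset.mem_map.1 hm
    rw [mem_modes] at ha hc ⊢
    rw [PNat.add_coe]
    simp only [Equiv.toEmbedding_apply, Equiv.coe_addLeft]
    omega
  rw [← Finset.sum_subset hsub]
  · rw [Finset.sum_map]
    refine Finset.sum_congr rfl fun c _ => ?_
    simp only [Equiv.toEmbedding_apply, Equiv.coe_addLeft, add_sub_cancel_left, fourier_add]
    ring
  · intro m _ hm
    rw [hd (m - a), mul_zero, zero_mul]
    intro h
    exact hm (Finset.mem_map.2 ⟨m - a, h, by simp⟩)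

theorem integral_trigSum_cube {N : ℕ+} {d : ℤ → ℂ} (hd : ∀ a ∉ modes N, d a = 0) :
    ∫ θ, trigSum (modes N) d θ ^ 3 ∂haarT = tri N d fun _ _ => 1 := by
  simp only [pow_succ, pow_zero, one_mul, trigSum_sq hd]
  rw [integral_trigSum_mul _ _ _ _ hd, ← tri_swap, tri]
  have hsub : modes N ⊆ modes (N + N) := fun a ha => by
    rw [mem_modes] at ha ⊢; rw [PNat.add_coe]; omega
  rw [← Finset.sum_subset hsub]
  · refine Finset.sum_nbij' (fun a => -a) (fun a => -a) (fun a ha => neg_mem_modes.2 ha)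
      (fun a ha => neg_mem_modes.2 ha) (by simp) (by simp) fun m _ => ?_
    rw [Finset.sum_mul]
    refine Finset.sum_congr rfl fun a _ => ?_
    rw [neg_neg]; ring
  · intro m _ hm
    rw [hd (-m) (fun h => hm (neg_mem_modes.1 h)), mul_zero]

theorem norm_sum_mul_neg_le (J : Finset ℤ) (q : ℤ → ℂ) :
    ‖∑ m ∈ J, q m * q (-m)‖ₑ ≤ 2 * ∑' m, ‖q m‖ₑ ^ 2 := by
  refine le_trans ?_ (tsum_mul_reflect_le (fun m => ‖q m‖ₑ) 0)
  refine le_trans ?_ (ENNReal.sum_le_tsum J)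
  refine (enorm_sum_le _ _).trans (Finset.sum_le_sum fun m _ => ?_)
  rw [enorm_mul, sub_zero]

theorem enorm_integral_sq_le {N : ℕ+} {d : ℤ → ℂ} (hd : ∀ a ∉ modes N, d a = 0) :
    ‖∫ θ, trigSum (modes N) d θ ^ 2 ∂haarT‖ₑ ≤ 2 * ∑' m, ‖d m‖ₑ ^ 2 := by
  simp only [pow_two (trigSum _ _ _)]
  rw [integral_trigSum_mul _ _ _ _ hd]
  exact norm_sum_mul_neg_le _ _

/-- The fourth power is the square of the square, so Parseval reduces the integral to the `ℓ²` norm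
of the self-convolution of the coefficients. -/
theorem enorm_integral_pow_four_le {N : ℕ+} {d : ℤ → ℂ} (hd : ∀ a ∉ modes N, d a = 0) :
    ‖∫ θ, trigSum (modes N) d θ ^ 4 ∂haarT‖ₑ ≤
      2 * ∑' m : ℤ, (∑' a, ‖d a‖ₑ * ‖d (m - a)‖ₑ) ^ 2 := by
  set q : ℤ → ℂ := fun m => ∑ a ∈ modes N, d a * d (m - a) with hq
  have hq0 : ∀ m ∉ modes (N + N), q m = 0 := by
    intro m hm
    refine Finset.sum_eq_zero fun a ha => ?_
    rw [hd (m - a), mul_zero]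
    intro h
    rw [mem_modes] at ha h hm
    rw [PNat.add_coe] at hm
    omega
  have h4 : ∀ θ, trigSum (modes N) d θ ^ 4 =
      trigSum (modes (N + N)) q θ * trigSum (modes (N + N)) q θ := fun θ => by
    rw [← trigSum_sq hd]; ring
  simp only [h4]
  rw [integral_trigSum_mul _ _ _ _ hq0]
  refine (norm_sum_mul_neg_le _ _).trans ?_
  gcongr with m
  refine (enorm_sum_le _ _).trans ?_
  simp only [enorm_mul]
  exact ENNReal.sum_le_tsum _

end TrigSum

/-! ### The space derivative, its `L²` and `L⁴` bounds, and the cubic integral for `s = 1` -/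

section Derivative

variable {N : ℕ+}

/-- The derivative of the real trigonometric polynomial whose `n`-th Fourier coefficient is
`y n / n`, `1 ≤ n ≤ N`. -/
def dfun (N : ℕ+) (y : ℕ+ → ℂ) (θ : Torus) : ℝ :=
  ∑ n ∈ Finset.Icc 1 N, 2 * (Complex.I * y n * fourier ((n : ℕ) : ℤ) θ).re

/-- The Fourier coefficients of `dfun`. -/
def dcoeff (N : ℕ+) (y : ℕ+ → ℂ) : ℤ → ℂ := fc 0 fun n => if n ≤ N then Complex.I * y n else 0

theorem dcoeff_eq_zero (y : ℕ+ → ℂ) (a : ℤ) (ha : a ∉ modes N) : dcoeff N y a = 0 :=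
  fc_eq_zero_of_not_mem (fun _ hn => if_neg (not_le.2 hn)) a ha

theorem continuous_dfun (N : ℕ+) (y : ℕ+ → ℂ) : Continuous (dfun N y) := by
  unfold dfun
  refine continuous_finsetSum _ fun n _ => continuous_const.mul (Complex.continuous_re.comp ?_)
  fun_prop

theorem ofReal_dfun (y : ℕ+ → ℂ) (θ : Torus) :
    (dfun N y θ : ℂ) = trigSum (modes N) (dcoeff N y) θ := by
  have hconj : ∀ a, dcoeff N y (-a) * fourier (-a) θ =
      (starRingEnd ℂ) (dcoeff N y a * fourier a θ) := fun a => by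
    rw [map_mul, fourier_neg, dcoeff, fc_neg]
  refine Complex.ext ?_ ?_
  · rw [Complex.ofReal_re, trigSum, Complex.re_sum, dfun,
      sum_modes_even (fun a => by rw [hconj, Complex.conj_re]) (by simp [dcoeff]), Finset.mul_sum]
    refine Finset.sum_congr rfl fun n hn => ?_
    rw [dcoeff, fc_pnat, if_pos (Finset.mem_Icc.1 hn).2, pow_zero, inv_one, one_mul]
  · rw [Complex.ofReal_im, trigSum, Complex.im_sum]
    have h : ∑ a ∈ modes N, (dcoeff N y a * fourier a θ).im =
        ∑ a ∈ modes N, -(dcoeff N y a * fourier a θ).im := by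
      refine Finset.sum_nbij' (fun a => -a) (fun a => -a) (fun a ha => neg_mem_modes.2 ha)
        (fun a ha => neg_mem_modes.2 ha) (by simp) (by simp) fun m _ => ?_
      rw [hconj, Complex.conj_im, neg_neg]
    rw [Finset.sum_neg_distrib] at h
    linarith

theorem ofReal_integral_dfun_pow (y : ℕ+ → ℂ) (p : ℕ) :
    ((∫ θ, dfun N y θ ^ p ∂haarT : ℝ) : ℂ) = ∫ θ, trigSum (modes N) (dcoeff N y) θ ^ p ∂haarT := by
  rw [← integral_complex_ofReal]
  simp [ofReal_dfun]

theorem dfun_add (y z : ℕ+ → ℂ) (θ : Torus) : dfun N (y + z) θ = dfun N y θ + dfun N z θ := by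
  unfold dfun
  rw [← Finset.sum_add_distrib]
  refine Finset.sum_congr rfl fun n _ => ?_
  rw [Pi.add_apply, mul_add, add_mul, Complex.add_re]
  ring

theorem dfun_congr {y z : ℕ+ → ℂ} (h : ∀ n ≤ N, y n = z n) (θ : Torus) :
    dfun N y θ = dfun N z θ :=
  Finset.sum_congr rfl fun n hn => by rw [h n (Finset.mem_Icc.1 hn).2]

theorem enorm_dcoeff_le (x : ℕ+ → ℂ) (a : ℤ) : ‖dcoeff N x a‖ₑ ≤ ‖fc 0 x a‖ₑ := by
  have key : ∀ n : ℕ+, ‖dcoeff N x ((n : ℕ) : ℤ)‖ₑ ≤ ‖fc 0 x ((n : ℕ) : ℤ)‖ₑ := fun n => by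
    rw [dcoeff, fc_pnat, fc_pnat, enorm_mul, enorm_mul]
    gcongr
    split_ifs
    · rw [enorm_mul]
      simp [← ofReal_norm]
    · simp
  rcases int_cases_pnat a with rfl | ⟨n, rfl | rfl⟩
  · simp [dcoeff]
  · exact key n
  · rw [dcoeff, enorm_fc_neg, enorm_fc_neg]; exact key n

theorem tsum_enorm_fc_zero_sq (x : Ell) : ∑' a, ‖fc 0 x a‖ₑ ^ 2 = 2 * ‖x‖ₑ ^ 2 := by
  rw [← tsum_eabs_pow_mul_fc_sq (s := 0)]
  simp

theorem integral_dfun_sq_le (x : Ell) : ∫ θ, dfun N x θ ^ 2 ∂haarT ≤ 4 * ‖x‖ ^ 2 := by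
  have h := enorm_integral_sq_le (dcoeff_eq_zero (N := N) x)
  rw [← ofReal_integral_dfun_pow] at h
  have h2 : 2 * ∑' m, ‖dcoeff N x m‖ₑ ^ 2 ≤ ENNReal.ofReal (4 * ‖x‖ ^ 2) := by
    calc 2 * ∑' m, ‖dcoeff N x m‖ₑ ^ 2 ≤ 2 * ∑' a, ‖fc 0 x a‖ₑ ^ 2 := by
          gcongr with a; exact enorm_dcoeff_le x a
      _ = ENNReal.ofReal (4 * ‖x‖ ^ 2) := by
        rw [tsum_enorm_fc_zero_sq, enorm_sq_eq_ofReal, ENNReal.ofReal_mul (by norm_num), ← mul_assoc]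
        norm_num
  have h3 := h.trans h2
  rw [← ofReal_norm, ENNReal.ofReal_le_ofReal_iff (by positivity), Complex.norm_real] at h3
  exact (le_abs_self _).trans h3

/-- Sobolev embedding in `L⁴` for the range of `(1 + |D|^γ)⁻¹ ∂ₓ`. -/
theorem exists_integral_dfun_pow_four_le {γ : ℝ} (hγ : 4 / 3 < γ) [Fact (1 < γ)] :
    ∃ C : ℝ, 0 ≤ C ∧ ∀ (N : ℕ+) (x : Ell),
      ∫ θ, dfun N (linMap γ x) θ ^ 4 ∂haarT ≤ C * ‖x‖ ^ 4 := by
  set L : ℤ → ℝ≥0∞ := fun a => ‖fc 0 (fun n => (lam γ n : ℂ)) a‖ₑ with hL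
  -- The multipliers must be in `ℓ⁴`: `λ_n ≤ n^(1-γ)` and `4(γ - 1) > 1`, which `4/3 < γ` provides.
  obtain ⟨Z, hZ0, hZ⟩ := exists_tsum_ofReal_le
    (summable_pnat_rpow (p := 4 * (1 - γ)) (by linarith)) (fun n => by positivity)
  have hLsum : ∑' a, (L a ^ 2) ^ 2 ≤ ENNReal.ofReal (2 * Z) := by
    rw [tsum_int_even _ (fun a => by simp only [hL, enorm_fc_neg]), ENNReal.ofReal_mul (by norm_num),
      ← hZ]
    simp only [hL, fc_zero, enorm_zero, ne_eq, OfNat.ofNat_ne_zero, not_false_eq_true, zero_pow,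
      zero_add, ENNReal.ofReal_ofNat]
    gcongr with n
    rw [← pow_mul, ← ofReal_norm, ← ENNReal.ofReal_pow (norm_nonneg _), norm_fc_pnat, pow_zero,
      inv_one, one_mul, Complex.norm_real, Real.norm_eq_abs, abs_of_pos (lam_pos γ n)]
    refine ENNReal.ofReal_le_ofReal ?_
    have := lam_le_rpow γ n
    have h0 := (lam_pos γ n).le
    rw [mul_comm (4 : ℝ), Real.rpow_mul (by positivity)]
    norm_num
    gcongr
  refine ⟨2 * (4 * (2 * (2 * Z))), by positivity, fun N x => ?_⟩
  set X : ℤ → ℝ≥0∞ := fun a => ‖fc 0 x a‖ₑ with hX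
  have hF : ∀ a, ‖dcoeff N (linMap γ x) a‖ₑ ≤ X a * L a := fun a => by
    refine (enorm_dcoeff_le _ _).trans (le_of_eq ?_)
    simp only [hX, hL]
    have key : ∀ n : ℕ+, ‖fc 0 (linMap γ x) ((n : ℕ) : ℤ)‖ₑ = ‖fc 0 x ((n : ℕ) : ℤ)‖ₑ *
        ‖fc 0 (fun n => (lam γ n : ℂ)) ((n : ℕ) : ℤ)‖ₑ := fun n => by
      rw [fc_pnat, fc_pnat, fc_pnat, linMap_apply]
      simp only [pow_zero, inv_one, one_mul, enorm_mul, neg_mul, enorm_neg]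
      have : ‖Complex.I‖ₑ = 1 := by simp [← ofReal_norm]
      rw [this, one_mul, mul_comm]
    rcases int_cases_pnat a with rfl | ⟨n, rfl | rfl⟩
    · simp
    · exact key n
    · simp only [enorm_fc_neg]; exact key n
  have h := enorm_integral_pow_four_le (dcoeff_eq_zero (N := N) (linMap γ x))
  rw [← ofReal_integral_dfun_pow] at h
  -- Cauchy–Schwarz separates the sequence `X` from the multiplier `L`. The multiplier part is
  -- bounded in terms of `∑ L⁴` uniformly in `m`, and the rest sums over `m` to `(∑ X²)²`.
  have hm : ∀ m : ℤ, (∑' a, ‖dcoeff N (linMap γ x) a‖ₑ * ‖dcoeff N (linMap γ x) (m - a)‖ₑ) ^ 2 ≤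
      (∑' a, X a ^ 2 * X (m - a) ^ 2) * (2 * ENNReal.ofReal (2 * Z)) := fun m => by
    calc _ ≤ (∑' a, (X a * X (m - a)) * (L a * L (m - a))) ^ 2 := by
          refine pow_le_pow_left' (ENNReal.tsum_le_tsum fun a => ?_) 2
          refine (mul_le_mul' (hF a) (hF (m - a))).trans (le_of_eq ?_)
          ring
      _ ≤ (∑' a, (X a * X (m - a)) ^ 2) * ∑' a, (L a * L (m - a)) ^ 2 := tsum_mul_sq_le _ _
      _ ≤ _ := by
        simp only [mul_pow]
        gcongr
        refine le_trans ?_ (mul_le_mul_right hLsum 2)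
        refine le_trans (le_of_eq ?_) (tsum_mul_reflect_le (fun a => L a ^ 2) (-m))
        refine tsum_congr fun a => ?_
        have : ∀ b, L (-b) = L b := fun b => enorm_fc_neg _ _
        rw [show m - a = -a - -m by ring]
  have hXX : ∑' m, ∑' a, X a ^ 2 * X (m - a) ^ 2 = (2 * ‖x‖ₑ ^ 2) ^ 2 := by
    rw [ENNReal.tsum_comm]
    simp only [ENNReal.tsum_mul_left]
    have hshift : ∀ a : ℤ, ∑' m, X (m - a) ^ 2 = ∑' a, X a ^ 2 := fun a =>
      (Equiv.subRight a).tsum_eq fun a => X a ^ 2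
    simp only [hshift]
    rw [ENNReal.tsum_mul_right, ← pow_two, tsum_enorm_fc_zero_sq]
  have h2 := h.trans (mul_le_mul_right (ENNReal.tsum_le_tsum hm) 2)
  rw [ENNReal.tsum_mul_right, hXX] at h2
  have h3 : 2 * ((2 * ‖x‖ₑ ^ 2) ^ 2 * (2 * ENNReal.ofReal (2 * Z))) =
      ENNReal.ofReal (2 * (4 * (2 * (2 * Z))) * ‖x‖ ^ 4) := by
    have h4 : (2 * ‖x‖ₑ ^ 2) ^ 2 = ENNReal.ofReal (4 * ‖x‖ ^ 4) := by
      rw [enorm_sq_eq_ofReal, mul_pow, ← ENNReal.ofReal_pow (by positivity),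
        ENNReal.ofReal_mul (by norm_num), ← pow_mul]
      norm_num
    have h5 : 2 * ENNReal.ofReal (2 * Z) = ENNReal.ofReal (2 * (2 * Z)) := by
      rw [ENNReal.ofReal_mul (p := 2) (q := 2 * Z) (by norm_num)]; norm_num
    have h6 : ∀ r : ℝ, 2 * ENNReal.ofReal r = ENNReal.ofReal (2 * r) := fun r => by
      rw [ENNReal.ofReal_mul (by norm_num)]; norm_num
    rw [h4, h5, ← ENNReal.ofReal_mul (by positivity), h6]
    congr 1
    ring
  rw [h3, ← ofReal_norm, ENNReal.ofReal_le_ofReal_iff (by positivity), Complex.norm_real] at h2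
  exact (le_abs_self _).trans h2

/-- For `s = 1` the trilinear form is the integral of the cube of the derivative. -/
theorem cubicForm_three_im {x : Ell} (hx : ∀ n, N < n → x n = 0) :
    (cubicForm N (fc 1 x) 3).im = 3 * ∫ θ, dfun N x θ ^ 3 ∂haarT := by
  have hd : ∀ a, dcoeff N x a = Complex.I * a * fc 1 x a := by
    have key : ∀ n : ℕ+, dcoeff N x ((n : ℕ) : ℤ) = Complex.I * ((n : ℕ) : ℤ) * fc 1 x ((n : ℕ) : ℤ) := by
      intro n
      have hn : ((n : ℕ) : ℂ) ≠ 0 := by exact_mod_cast n.pos.ne'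
      rw [dcoeff, fc_pnat, fc_pnat]
      split_ifs with h
      · push_cast; field_simp
      · rw [hx n (not_le.1 h)]; simp
    intro a
    rcases int_cases_pnat a with rfl | ⟨n, rfl | rfl⟩
    · simp [dcoeff]
    · exact key n
    · rw [fc_neg, dcoeff, fc_neg, ← dcoeff, key]
      simp
  have h := ofReal_integral_dfun_pow (N := N) x 3
  rw [integral_trigSum_cube (dcoeff_eq_zero x)] at h
  -- On `a + b + c = 0` one has `a³ + b³ + c³ = 3abc`, while `(ia)(ib)(ic) = -i abc`.
  have h2 : cubicForm N (fc 1 x) 3 = 3 * Complex.I * tri N (dcoeff N x) fun _ _ => 1 := by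
    simp only [cubicForm, tri, Finset.mul_sum]
    refine Finset.sum_congr rfl fun a _ => Finset.sum_congr rfl fun c _ => ?_
    rw [hd, hd, hd]
    generalize fc 1 x a = p
    generalize fc 1 x c = q
    generalize fc 1 x (-a - c) = r
    have hI : Complex.I ^ 4 = 1 := Complex.I_pow_four
    push_cast
    linear_combination (-3 * p * q * r * (a : ℂ) * c * (-a - c)) * hI
  rw [h2, ← h, mul_assoc, ← Complex.ofReal_ofNat, Complex.im_ofReal_mul, Complex.im_mul_ofReal]
  simp

end Derivative

/-! ### The linear evolution -/

section LinearFlow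

open Set

variable {γ : ℝ} [Fact (1 < γ)]

/-- The flow of the linear part of the equation. -/
def linFlow (γ : ℝ) [Fact (1 < γ)] (t : ℝ) : Ell →L[ℝ] Ell := NormedSpace.exp (t • linMap γ)

theorem hasDerivAt_linFlow (x : Ell) (t : ℝ) :
    HasDerivAt (fun t => linFlow γ t x) (linMap γ (linFlow γ t x)) t := by
  have h := hasDerivAt_exp_smul_const' (𝕂 := ℝ) (linMap γ) t
  exact ((ContinuousLinearMap.apply ℝ Ell x).hasFDerivAt.comp_hasDerivAt t h)

theorem linFlow_zero (x : Ell) : linFlow γ 0 x = x := by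
  simp [linFlow]

/-- Each coordinate solves a scalar linear equation, so its product with the inverse exponential is
constant. -/
theorem linFlow_apply (t : ℝ) (x : Ell) (n : ℕ+) :
    linFlow γ t x n = Complex.exp (-(Complex.I * (lam γ n : ℂ)) * t) * x n := by
  set c : ℂ := -(Complex.I * (lam γ n : ℂ)) with hc
  have h1 : ∀ t : ℝ, HasDerivAt (fun t : ℝ => linFlow γ t x n) (c * linFlow γ t x n) t := fun t =>
    (lp.evalCLM ℝ (fun _ : ℕ+ => ℂ) 2 n).hasFDerivAt.comp_hasDerivAt t (hasDerivAt_linFlow x t)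
  have h2 : ∀ t : ℝ, HasDerivAt (fun t : ℝ => Complex.exp (-(c * t))) (-c * Complex.exp (-(c * t))) t :=
    fun t => by
      have h3 : HasDerivAt (fun t : ℝ => -(c * (t : ℂ))) (-c) t := by
        have h := ((Complex.ofRealCLM.hasDerivAt (x := t)).const_mul c).neg
        rw [Complex.ofRealCLM_apply, Complex.ofReal_one, mul_one] at h
        exact h
      simpa [mul_comm] using h3.cexp
  have h4 : ∀ t : ℝ, HasDerivAt (fun t : ℝ => Complex.exp (-(c * t)) * linFlow γ t x n) 0 t :=
    fun t => ((h2 t).mul (h1 t)).congr_deriv (by ring)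
  have h5 := is_const_of_deriv_eq_zero (fun t => (h4 t).differentiableAt) (fun t => (h4 t).deriv) t 0
  simp only [Complex.ofReal_zero, mul_zero, neg_zero, Complex.exp_zero, one_mul, linFlow_zero] at h5
  rw [← h5, ← mul_assoc, ← Complex.exp_add]
  simp

/-- The inverse of `linMap` on the Fourier modes `n ≤ N`. -/
def invLin (γ : ℝ) (N : ℕ+) : Ell →L[ℝ] Ell :=
  diag (fun n => if n ≤ N then Complex.I / (lam γ n : ℂ) else 0) (by
    refine ⟨∑ n ∈ Finset.Icc 1 N, ‖Complex.I / (lam γ n : ℂ)‖, fun n => ?_⟩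
    split_ifs with h
    · exact Finset.single_le_sum (f := fun n => ‖Complex.I / (lam γ n : ℂ)‖)
        (fun _ _ => norm_nonneg _) (Finset.mem_Icc.2 ⟨one_le, h⟩)
    · rw [norm_zero]; exact Finset.sum_nonneg fun _ _ => norm_nonneg _)

theorem linMap_invLin (N : ℕ+) (x : Ell) : linMap γ (invLin γ N x) = proj N x := by
  refine Subtype.ext (funext fun n => ?_)
  have := (lam_pos γ n).ne'
  rw [linMap_apply, invLin, diag_apply, proj_apply]
  split_ifs
  · have h : (lam γ n : ℂ) ≠ 0 := by exact_mod_cast this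
    field_simp
    simp
  · simp

theorem invLin_linMap (N : ℕ+) (x : Ell) : invLin γ N (linMap γ x) = proj N x := by
  refine Subtype.ext (funext fun n => ?_)
  have := (lam_pos γ n).ne'
  rw [invLin, diag_apply, linMap_apply, proj_apply]
  split_ifs
  · have h : (lam γ n : ℂ) ≠ 0 := by exact_mod_cast this
    field_simp
    simp
  · simp

theorem proj_linFlow (N : ℕ+) (t : ℝ) (x : Ell) : proj N (linFlow γ t x) = linFlow γ t (proj N x) := by
  refine Subtype.ext (funext fun n => ?_)
  simp only [linFlow_apply, proj_apply]
  split_ifs <;> simp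

end LinearFlow

/-! ### Duhamel's formula and the growth of the trilinear form along the flow -/

section Duhamel

open Set

variable {γ : ℝ} {s : ℕ} [NeZero s] [Fact (1 < γ)] [Fact (γ ≤ 2)]

/-- The solution of the truncated equation is the linear evolution up to the image under `linMap`
of a bounded remainder. -/
theorem exists_galerkinFlow_eq (r T : ℝ) (hr : 0 ≤ r) (hT : 0 ≤ T) :
    ∃ D : ℝ, 0 ≤ D ∧ ∀ (N : ℕ+) (x : Ell), ‖x‖ ≤ r → ∀ t ∈ Icc (-T) T,
      ∃ z : Ell, ‖z‖ ≤ D ∧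
        galerkinFlow γ s N t (proj N x) = linFlow γ t (proj N x) + linMap γ z := by
  set M := growth γ s r T
  have hM0 : 0 ≤ M := mul_nonneg hr (Real.exp_pos _).le
  refine ⟨‖prodMap s‖ * M ^ 2 * T * Real.exp T, by positivity, fun N x hx t ht => ?_⟩
  set v : ℝ → Ell := fun t => galerkinFlow γ s N t (proj N x) with hv
  have hpv : ∀ t, proj N (v t) = v t := fun t => proj_galerkinFlow x t
  have hvM : ∀ t ∈ Icc (-T) T, ‖v t‖ ≤ M := fun t ht =>
    ((isTame_galerkin N).flow_norm_le (isFlow_galerkinFlow N) _ ht).trans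
      (growth_mono (norm_nonneg _) ((norm_proj_le N x).trans hx) hT)
  -- Dividing the remainder by `L` gives an equation `z' = L z + proj N (v·v)` in which the inverse
  -- of `L` no longer occurs. Hence the bound on `z` does not depend on `N`, although the norm of
  -- `invLin γ N` may.
  set z : ℝ → Ell := fun t => invLin γ N (v t - linFlow γ t (proj N x)) with hz
  have hLz : ∀ t, linMap γ (z t) = v t - linFlow γ t (proj N x) := fun t => by
    rw [hz]
    simp only [linMap_invLin]
    rw [map_sub, hpv, proj_linFlow, proj_proj]
  have hd : ∀ t, HasDerivAt z (linMap γ (z t) + proj N (prodMap s (v t) (v t))) t := fun t => by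
    have h1 := (isFlow_galerkinFlow (γ := γ) (s := s) N).hasDerivAt (proj N x) t
    have h2 := (invLin γ N).hasFDerivAt.comp_hasDerivAt t (h1.sub (hasDerivAt_linFlow (γ := γ) (proj N x) t))
    refine h2.congr_deriv ?_
    change invLin γ N (galerkin γ s N (v t) - linMap γ (linFlow γ t (proj N x))) = _
    rw [galerkin, hpv, field, map_sub, proj_linMap, invLin_linMap, invLin_linMap, proj_proj, hLz,
      map_add, hpv, proj_linFlow, proj_proj]
    abel
  have hz0 : z 0 = 0 := by
    simp [hz, hv, (isFlow_galerkinFlow (γ := γ) (s := s) N).zero, linFlow_zero]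
  refine ⟨z t, ?_, ?_⟩
  · have := norm_le_of_norm_deriv_le (K := 1) (ε := ‖prodMap s‖ * M ^ 2) zero_le_one (by positivity)
      (fun t _ => (hd t).hasDerivWithinAt) (fun t ht => ?_) ht
    · simpa [hz0] using this
    · refine (norm_add_le _ _).trans ?_
      rw [one_mul]
      gcongr
      · exact norm_linMap_le _
      · refine (norm_proj_le _ _).trans (((prodMap s).le_opNorm₂ _ _).trans ?_)
        rw [mul_assoc, ← pow_two]
        gcongr
        exact hvM t ht
  · rw [hLz]; abel

/-- Here `b` will be the Duhamel remainder, for which only the even powers 2 and 4 have been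
estimated; they dominate the cube. -/
theorem abs_add_cube_le (a b : ℝ) : |(a + b) ^ 3| ≤ 4 * |a| ^ 3 + 4 * (b ^ 2 + b ^ 4) := by
  have h1 : |(a + b) ^ 3| ≤ (|a| + |b|) ^ 3 := by
    rw [abs_pow]; gcongr; exact abs_add_le a b
  have ha := abs_nonneg a
  have hb := abs_nonneg b
  have h2 : (|a| + |b|) ^ 3 ≤ 4 * |a| ^ 3 + 4 * |b| ^ 3 := by
    nlinarith [mul_nonneg (add_nonneg ha hb) (sq_nonneg (|a| - |b|))]
  have h3 : |b| ^ 3 ≤ b ^ 2 + b ^ 4 := by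
    rw [← sq_abs b, show b ^ 4 = |b| ^ 4 by rw [pow_abs, abs_of_nonneg (by positivity)]]
    nlinarith [mul_nonneg (sq_nonneg |b|) (sq_nonneg (|b| - 1)), sq_nonneg |b|]
  linarith

/-- Bound of the derivative of the top energy by the cube of the derivative of the linear evolution;
the latter is only needed for `s = 1`. -/
theorem exists_abs_cubicForm_galerkinFlow_le (hγ : 4 / 3 < γ) (r T : ℝ) (hr : 0 ≤ r) (hT : 0 ≤ T) :
    ∃ C : ℝ, 0 ≤ C ∧ ∀ (N : ℕ+) (x : Ell), ‖x‖ ≤ r → ∀ t ∈ Icc (-T) T,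
      |(cubicForm N (fc s (galerkinFlow γ s N t (proj N x))) (2 * s + 1)).im / 3| ≤
        C + 4 * ∫ θ, |dfun N (linFlow γ t x) θ| ^ 3 ∂haarT := by
  have hnn : ∀ (N : ℕ+) (y : Ell), 0 ≤ 4 * ∫ θ, |dfun N y θ| ^ 3 ∂haarT := fun N y => by positivity
  -- For `s ≥ 2` the deterministic bound of the form on balls suffices, and the integral is only
  -- added as a nonnegative term. For `s = 1` the cube of the linear part has to be kept.
  rcases Nat.lt_or_ge 1 s with hs | hs
  · obtain ⟨p, rfl⟩ : ∃ p, s = p + 1 := ⟨s - 1, by omega⟩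
    have : NeZero p := ⟨by omega⟩
    obtain ⟨C, hC0, hC⟩ := exists_norm_cubicForm_le p
    set M := growth γ (p + 1) r T
    have hM0 : 0 ≤ M := mul_nonneg hr (Real.exp_pos _).le
    refine ⟨C * M ^ 3, by positivity, fun N x hx t ht => ?_⟩
    have h1 : ‖galerkinFlow γ (p + 1) N t (proj N x)‖ ≤ M :=
      ((isTame_galerkin N).flow_norm_le (isFlow_galerkinFlow N) _ ht).trans
        (growth_mono (norm_nonneg _) ((norm_proj_le N x).trans hx) hT)
    have h2 := hC N (galerkinFlow γ (p + 1) N t (proj N x))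
    have h3 := Complex.abs_im_le_norm
      (cubicForm N (fc (p + 1) (galerkinFlow γ (p + 1) N t (proj N x))) (2 * (p + 1) + 1))
    have h4 : C * ‖galerkinFlow γ (p + 1) N t (proj N x)‖ ^ 3 ≤ C * M ^ 3 := by gcongr
    rw [abs_div, abs_of_pos (by norm_num : (0 : ℝ) < 3)]
    have h5 := hnn N (linFlow γ t x)
    have h6 := abs_nonneg
      (cubicForm N (fc (p + 1) (galerkinFlow γ (p + 1) N t (proj N x))) (2 * (p + 1) + 1)).im
    linarith
  · obtain rfl : s = 1 := le_antisymm hs (NeZero.pos s)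
    obtain ⟨D, hD0, hD⟩ := exists_galerkinFlow_eq (γ := γ) (s := 1) r T hr hT
    obtain ⟨C, hC0, hC⟩ := exists_integral_dfun_pow_four_le hγ
    refine ⟨4 * (4 * D ^ 2 + C * D ^ 4), by positivity, fun N x hx t ht => ?_⟩
    obtain ⟨z, hz, hv⟩ := hD N x hx t ht
    have hsupp : ∀ n, N < n → galerkinFlow γ 1 N t (proj N x) n = 0 := fun n hn => by
      rw [← proj_galerkinFlow, proj_apply, if_neg (not_le.2 hn)]
    rw [cubicForm_three_im hsupp, mul_div_cancel_left₀ _ (by norm_num), hv]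
    have hsum : ∀ θ, dfun N (linFlow γ t (proj N x) + linMap γ z : Ell) θ =
        dfun N (linFlow γ t x) θ + dfun N (linMap γ z) θ := fun θ => by
      rw [lp.coeFn_add, dfun_add]
      congr 1
      refine dfun_congr (fun n hn => ?_) θ
      rw [← proj_linFlow, proj_apply, if_pos hn]
    simp only [hsum]
    have hi : ∀ (y : ℕ+ → ℂ) (k : ℕ), Integrable (fun θ => dfun N y θ ^ k) haarT := fun y k =>
      integrable_of_continuous_torus ((continuous_dfun N y).pow k)
    have hi3 : Integrable (fun θ => |dfun N (linFlow γ t x) θ| ^ 3) haarT :=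
      integrable_of_continuous_torus ((continuous_dfun N _).abs.pow 3)
    have hzz := norm_linMap_le (γ := γ) z
    have hi2 : Integrable (fun θ => 4 * (dfun N (linMap γ z) θ ^ 2 + dfun N (linMap γ z) θ ^ 4))
        haarT := ((hi _ 2).add (hi _ 4)).const_mul 4
    calc |∫ θ, (dfun N (linFlow γ t x) θ + dfun N (linMap γ z) θ) ^ 3 ∂haarT|
        ≤ ∫ θ, |(dfun N (linFlow γ t x) θ + dfun N (linMap γ z) θ) ^ 3| ∂haarT :=
          abs_integral_le_integral_abs
      _ ≤ ∫ θ, (4 * |dfun N (linFlow γ t x) θ| ^ 3 +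
            4 * (dfun N (linMap γ z) θ ^ 2 + dfun N (linMap γ z) θ ^ 4)) ∂haarT := by
          refine integral_mono ?_ ?_ fun θ => abs_add_cube_le _ _
          · exact integrable_of_continuous_torus
              (((continuous_dfun N _).add (continuous_dfun N _)).pow 3).abs
          · exact (hi3.const_mul 4).add hi2
      _ = 4 * (∫ θ, dfun N (linMap γ z) θ ^ 2 ∂haarT + ∫ θ, dfun N (linMap γ z) θ ^ 4 ∂haarT) +
            4 * ∫ θ, |dfun N (linFlow γ t x) θ| ^ 3 ∂haarT := by
          rw [integral_add (hi3.const_mul 4) hi2,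
            integral_const_mul, integral_const_mul, integral_add (hi _ 2) (hi _ 4)]
          ring
      _ ≤ _ := by
          have e1 : ∫ θ, dfun N (linMap γ z) θ ^ 2 ∂haarT ≤ 4 * D ^ 2 :=
            (integral_dfun_sq_le _).trans (by gcongr; exact hzz.trans hz)
          have e2 : ∫ θ, dfun N (linMap γ z) θ ^ 4 ∂haarT ≤ C * D ^ 4 :=
            (hC N z).trans (by gcongr)
          linarith

end Duhamel

/-! ### The energy of order `s + γ/2` along the flow, and its exponential -/

section TopEnergy

open Set

variable {γ : ℝ} {s : ℕ} {N : ℕ+}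

/-- The square of the norm of order `s + γ / 2` of the first Fourier modes. -/
def topEnergy (γ : ℝ) (N : ℕ+) (x : Ell) : ℝ :=
  ∑ n ∈ Finset.Icc 1 N, (1 + ((n : ℕ) : ℝ) ^ γ) * ‖x n‖ ^ 2

theorem continuous_coord (n : ℕ+) : Continuous fun x : Ell => x n :=
  (lp.evalCLM ℝ (fun _ : ℕ+ => ℂ) 2 n).continuous

section

variable [NeZero s] [Fact (1 < γ)] [Fact (γ ≤ 2)]

/-- The weight `1 + n^γ` cancels the denominator of `lam`, so the symbol is the odd power `n^(2s+1)`
and the symmetrised form applies. -/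
theorem hasDerivAt_topEnergy (x : Ell) (t : ℝ) :
    HasDerivAt (fun t => topEnergy γ N (galerkinFlow γ s N t (proj N x)))
      (-(cubicForm N (fc s (galerkinFlow γ s N t (proj N x))) (2 * s + 1)).im / 3) t := by
  set v := galerkinFlow γ s N t (proj N x) with hv
  have hpv : proj N v = v := proj_galerkinFlow x t
  have hsupp : ∀ n, N < n → v n = 0 := fun n hn => by
    rw [← hpv, proj_apply, if_neg (not_le.2 hn)]
  rw [← sum_weight_mul_re_field (γ := γ) (s := s) hsupp (fun n => 1 + ((n : ℕ) : ℝ) ^ γ)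
    (odd_two_mul_add_one s) (fun n => by
      have := one_le_pnat n
      have : 0 < 1 + ((n : ℕ) : ℝ) ^ γ := by positivity
      rw [lam]; field_simp; ring), Finset.mul_sum]
  refine HasDerivAt.fun_sum fun n hn => ?_
  have h1 := (lp.evalCLM ℝ (fun _ : ℕ+ => ℂ) 2 n).hasFDerivAt.comp_hasDerivAt t
    ((isFlow_galerkinFlow (γ := γ) (s := s) N).hasDerivAt (proj N x) t)
  refine (h1.norm_sq.const_mul (1 + ((n : ℕ) : ℝ) ^ γ)).congr_deriv ?_
  have h2 : galerkin γ s N v n = field γ s v n := by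
    rw [galerkin, hpv, proj_apply, if_pos (Finset.mem_Icc.1 hn).2]
  change _ * (2 * inner ℝ (v n) (galerkin γ s N v n)) = _
  rw [h2, Complex.inner, mul_comm (field γ s v n)]
  ring

end

variable [Fact (1 < γ)]

theorem norm_linFlow_le (t : ℝ) (x : Ell) : ‖linFlow γ t x‖ ≤ ‖x‖ := by
  simpa using norm_le_mul_norm_of_le (x := linFlow γ t x) (y := x) zero_le_one fun n => by
    rw [linFlow_apply, norm_mul, Complex.norm_exp]
    simp

/-- The derivative of the linear evolution, as a function of space and time. -/
def linDer (γ : ℝ) [Fact (1 < γ)] (N : ℕ+) (x : Ell) (q : ℝ × Torus) : ℝ :=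
  dfun N (linFlow γ q.1 x) q.2

/-- The measure on space and time, over the time interval `[-T, T]`. -/
def spaceTime (T : ℝ) : Measure (ℝ × Torus) := (volume.restrict (Icc (-T) T)).prod haarT

instance isFiniteMeasure_spaceTime (T : ℝ) : IsFiniteMeasure (spaceTime T) := by
  unfold spaceTime; infer_instance

theorem continuous_linDer (x : Ell) : Continuous (linDer γ N x) := by
  unfold linDer dfun
  simp only [linFlow_apply]
  refine continuous_finsetSum _ fun n _ => continuous_const.mul (Complex.continuous_re.comp ?_)
  have : Continuous fun q : ℝ × Torus => (fourier ((n : ℕ) : ℤ) q.2 : ℂ) :=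
    (fourier ((n : ℕ) : ℤ)).continuous.comp continuous_snd
  fun_prop

theorem abs_linDer_le (x : Ell) (q : ℝ × Torus) :
    |linDer γ N x q| ≤ ∑ n ∈ Finset.Icc 1 N, 2 * ‖x n‖ := by
  rw [linDer, dfun]
  refine (Finset.abs_sum_le_sum_abs _ _).trans (Finset.sum_le_sum fun n _ => ?_)
  rw [abs_mul, abs_two]
  gcongr
  refine (Complex.abs_re_le_norm _).trans ?_
  rw [linFlow_apply, norm_mul, norm_mul, norm_mul, Complex.norm_exp, fourier_apply, Circle.norm_coe]
  simp

theorem integrable_comp_linDer (T : ℝ) (x : Ell) {F : ℝ → ℝ} (hF : Continuous F) :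
    Integrable (fun q => F (linDer γ N x q)) (spaceTime T) := by
  obtain ⟨C, hC⟩ := (isCompact_Icc (a := -∑ n ∈ Finset.Icc 1 N, 2 * ‖x n‖)
    (b := ∑ n ∈ Finset.Icc 1 N, 2 * ‖x n‖)).exists_bound_of_continuousOn hF.continuousOn
  exact Integrable.of_bound (hF.comp (continuous_linDer x)).aestronglyMeasurable C
    (Eventually.of_forall fun q => hC _ (abs_le.1 (abs_linDer_le x q)))

/-- The linear evolution does not increase the norm. This deterministic bound on the mass of the
square is what permits Jensen's inequality with that square as weight. -/
theorem integral_linDer_sq_le {T : ℝ} (hT : 0 ≤ T) (x : Ell) :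
    ∫ q, linDer γ N x q ^ 2 ∂spaceTime T ≤ 8 * T * ‖x‖ ^ 2 := by
  have hi := integrable_comp_linDer (γ := γ) (N := N) T x (continuous_pow 2)
  rw [spaceTime] at hi ⊢
  have hi' : Integrable (fun t => ∫ θ, linDer γ N x (t, θ) ^ 2 ∂haarT)
    (volume.restrict (Icc (-T) T)) := hi.integral_prod_left
  rw [integral_prod _ hi]
  have hb : ∀ t, ∫ θ, linDer γ N x (t, θ) ^ 2 ∂haarT ≤ 4 * ‖x‖ ^ 2 := fun t =>
    (integral_dfun_sq_le (linFlow γ t x)).trans (by gcongr; exact norm_linFlow_le t x)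
  calc _ ≤ ∫ _ in Icc (-T) T, 4 * ‖x‖ ^ 2 := integral_mono hi' (integrable_const _) hb
    _ = 8 * T * ‖x‖ ^ 2 := by
        rw [integral_const, smul_eq_mul, measureReal_restrict_apply_univ, Measure.real,
          Real.volume_Icc, ENNReal.toReal_ofReal (by linarith)]
        ring

variable [NeZero s] [Fact (γ ≤ 2)]

theorem abs_topEnergy_sub_le {C T : ℝ} {x : Ell}
    (hC : ∀ t ∈ Icc (-T) T,
      |(cubicForm N (fc s (galerkinFlow γ s N t (proj N x))) (2 * s + 1)).im / 3| ≤
        C + 4 * ∫ θ, |dfun N (linFlow γ t x) θ| ^ 3 ∂haarT) {t : ℝ} (ht : t ∈ Icc (-T) T) :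
    |topEnergy γ N (galerkinFlow γ s N t (proj N x)) - topEnergy γ N (proj N x)| ≤
      2 * T * C + 4 * ∫ q, |linDer γ N x q| ^ 3 ∂spaceTime T := by
  have hT : 0 ≤ T := by linarith [ht.1, ht.2]
  set v : ℝ → Ell := fun t => galerkinFlow γ s N t (proj N x) with hv
  have hvc : Continuous v := continuous_iff_continuousAt.2 fun t =>
    ((isFlow_galerkinFlow (γ := γ) (s := s) N).hasDerivAt (proj N x) t).continuousAt
  set g : ℝ → ℝ := fun t => -(cubicForm N (fc s (v t)) (2 * s + 1)).im / 3 with hg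
  have hfc : ∀ a, Continuous fun t => fc s (v t) a := fun a => by
    rcases int_cases_pnat a with rfl | ⟨n, rfl | rfl⟩
    · simp only [fc_zero]; exact continuous_const
    · simp only [fc_pnat]; exact continuous_const.mul ((continuous_coord n).comp hvc)
    · simp only [fc_neg, fc_pnat]
      exact Complex.continuous_conj.comp (continuous_const.mul ((continuous_coord n).comp hvc))
  have hgc : Continuous g := by
    have : Continuous fun t => cubicForm N (fc s (v t)) (2 * s + 1) := by
      unfold cubicForm tri
      fun_prop
    exact ((Complex.continuous_im.comp this).neg).div_const 3
  have hi := integrable_comp_linDer (γ := γ) (N := N) T x (F := fun y => |y| ^ 3)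
    (continuous_abs.pow 3)
  have hFTC := intervalIntegral.integral_eq_sub_of_hasDerivAt (a := 0) (b := t) (f' := g)
    (fun t _ => hasDerivAt_topEnergy (γ := γ) (s := s) (N := N) x t) (hgc.intervalIntegrable _ _)
  rw [(isFlow_galerkinFlow N).zero] at hFTC
  rw [← hFTC, ← Real.norm_eq_abs]
  rw [spaceTime] at hi ⊢
  rw [integral_prod _ hi]
  have h0 : (0 : ℝ) ∈ Icc (-T) T := ⟨by linarith, hT⟩
  calc ‖∫ τ in (0 : ℝ)..t, g τ‖ ≤ ∫ τ in uIoc 0 t, ‖g τ‖ :=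
        intervalIntegral.norm_integral_le_integral_norm_uIoc
    _ ≤ ∫ τ in Icc (-T) T, ‖g τ‖ := by
        refine setIntegral_mono_set (hgc.norm.integrableOn_Icc)
          (Eventually.of_forall fun _ => norm_nonneg _) (LE.le.eventuallyLE ?_)
        exact uIoc_subset_uIcc.trans (uIcc_subset_Icc h0 ht)
    _ ≤ ∫ τ in Icc (-T) T, (C + 4 * ∫ θ, |linDer γ N x (τ, θ)| ^ 3 ∂haarT) := by
        refine setIntegral_mono_on hgc.norm.integrableOn_Icc
          ((integrable_const _).add (hi.integral_prod_left.const_mul 4)) measurableSet_Icc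
          fun τ hτ => ?_
        simp only [hg, Real.norm_eq_abs, neg_div, abs_neg]
        exact hC τ hτ
    _ = _ := by
        rw [integral_add (integrable_const _) (hi.integral_prod_left.const_mul 4), integral_const,
          smul_eq_mul, measureReal_restrict_apply_univ, Measure.real, Real.volume_Icc,
          ENNReal.toReal_ofReal (by linarith), integral_const_mul]
        ring

omit [NeZero s] [Fact (γ ≤ 2)] [Fact (1 < γ)] in
-- Jensen's inequality for a weight of mass `m ≤ 1`. The tangent line of the exponential at `b`
-- leaves the defect `(1 - m) exp b (1 - b)`, and `exp b (1 - b) ≤ 1`, which accounts for the 1 on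
-- the right.
theorem exp_integral_mul_le {α : Type*} [MeasurableSpace α] {μ : Measure α} {w f : α → ℝ}
    (hw : Integrable w μ) (hwf : Integrable (fun a => w a * f a) μ)
    (hwe : Integrable (fun a => w a * Real.exp (f a)) μ) (h0 : ∀ a, 0 ≤ w a) (h1 : ∫ a, w a ∂μ ≤ 1) :
    Real.exp (∫ a, w a * f a ∂μ) ≤ 1 + ∫ a, w a * Real.exp (f a) ∂μ := by
  set m := ∫ a, w a ∂μ
  set b := ∫ a, w a * f a ∂μ
  have hm : 0 ≤ m := integral_nonneg h0
  have h2 : ∫ a, (Real.exp b * (1 - b) * w a + Real.exp b * (w a * f a)) ∂μ ≤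
      ∫ a, w a * Real.exp (f a) ∂μ := by
    refine integral_mono ((hw.const_mul _).add (hwf.const_mul _)) hwe fun a => ?_
    have h3 := Real.add_one_le_exp (f a - b)
    have h4 : Real.exp (f a) = Real.exp b * Real.exp (f a - b) := by rw [← Real.exp_add]; ring_nf
    calc Real.exp b * (1 - b) * w a + Real.exp b * (w a * f a)
        = w a * (Real.exp b * (f a - b + 1)) := by ring
      _ ≤ w a * (Real.exp b * Real.exp (f a - b)) := by
          have := h0 a
          gcongr
      _ = _ := by rw [h4]
  rw [integral_add (hw.const_mul _) (hwf.const_mul _), integral_const_mul, integral_const_mul] at h2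
  have h5 : Real.exp b * (1 - b) ≤ 1 := by
    have := Real.add_one_le_exp (-b)
    calc Real.exp b * (1 - b) ≤ Real.exp b * Real.exp (-b) := by gcongr; linarith
      _ = 1 := by rw [← Real.exp_add]; simp
  nlinarith

/-- Writing `|w|³ = w² |w|` and normalising `w²` by a bound `m` of its mass on the ball, Jensen's
inequality replaces the exponential of a cubic integral, which need not be integrable for a Gaussian
field, by an integral of exponentials of linear quantities. The ball enters through `m`, and every
power `p` is allowed. -/
theorem exists_exp_topEnergy_sub_le (hγ : 4 / 3 < γ) {r T p : ℝ} (hr : 0 ≤ r) (hT : 0 ≤ T)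
    (hp : 0 ≤ p) :
    ∃ A K : ℝ, 0 ≤ A ∧ 0 ≤ K ∧ ∀ (N : ℕ+) (x : Ell), ‖x‖ ≤ r → ∀ t ∈ Icc (-T) T,
      Real.exp (p * |topEnergy γ N (galerkinFlow γ s N t (proj N x)) - topEnergy γ N (proj N x)|) ≤
        A * (1 + ∫ q, linDer γ N x q ^ 2 * Real.exp (K * |linDer γ N x q|) ∂spaceTime T) := by
  obtain ⟨C, hC0, hC⟩ := exists_abs_cubicForm_galerkinFlow_le (γ := γ) (s := s) hγ r T hr hT
  -- The summand 1 makes `m ≥ 1`, so that `m` is invertible and the factor `m⁻¹` can be dropped from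
  -- the result.
  set m : ℝ := 8 * T * r ^ 2 + 1 with hm
  have hm1 : 1 ≤ m := by rw [hm]; nlinarith [mul_nonneg hT (sq_nonneg r)]
  have hm0 : 0 < m := by linarith
  refine ⟨Real.exp (p * (2 * T * C)), p * 4 * m, by positivity, by positivity, fun N x hx t ht => ?_⟩
  set f := linDer γ N x with hf
  have hE := abs_topEnergy_sub_le (fun t ht => hC N x hx t ht) ht
  have hwi := integrable_comp_linDer (γ := γ) (N := N) T x (F := fun y => m⁻¹ * y ^ 2) (by fun_prop)
  have h1 : Real.exp (∫ q, m⁻¹ * f q ^ 2 * (p * 4 * m * |f q|) ∂spaceTime T) ≤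
      1 + ∫ q, m⁻¹ * f q ^ 2 * Real.exp (p * 4 * m * |f q|) ∂spaceTime T := by
    refine exp_integral_mul_le hwi
      (integrable_comp_linDer T x (F := fun y => m⁻¹ * y ^ 2 * (p * 4 * m * |y|)) (by fun_prop))
      (integrable_comp_linDer T x (F := fun y => m⁻¹ * y ^ 2 * Real.exp (p * 4 * m * |y|))
        (by fun_prop)) (fun q => by positivity) ?_
    rw [integral_const_mul, inv_mul_le_one₀ hm0]
    refine (integral_linDer_sq_le hT x).trans ?_
    have : 8 * T * ‖x‖ ^ 2 ≤ 8 * T * r ^ 2 := by gcongr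
    linarith
  have h2 : ∫ q, m⁻¹ * f q ^ 2 * (p * 4 * m * |f q|) ∂spaceTime T =
      p * (4 * ∫ q, |f q| ^ 3 ∂spaceTime T) := by
    rw [← mul_assoc, ← integral_const_mul]
    congr 1
    funext q
    rw [← sq_abs]
    field_simp
  have h3 : ∫ q, m⁻¹ * f q ^ 2 * Real.exp (p * 4 * m * |f q|) ∂spaceTime T ≤
      ∫ q, f q ^ 2 * Real.exp (p * 4 * m * |f q|) ∂spaceTime T := by
    refine integral_mono (integrable_comp_linDer T x
      (F := fun y => m⁻¹ * y ^ 2 * Real.exp (p * 4 * m * |y|)) (by fun_prop))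
      (integrable_comp_linDer T x (F := fun y => y ^ 2 * Real.exp (p * 4 * m * |y|)) (by fun_prop))
      fun q => ?_
    rw [mul_assoc]
    exact mul_le_of_le_one_left (by positivity) (inv_le_one_of_one_le₀ hm1)
  calc _ ≤ Real.exp (p * (2 * T * C + 4 * ∫ q, |f q| ^ 3 ∂spaceTime T)) := by gcongr
    _ = Real.exp (p * (2 * T * C)) * Real.exp (p * (4 * ∫ q, |f q| ^ 3 ∂spaceTime T)) := by
        rw [mul_add, Real.exp_add]
    _ ≤ _ := by
        rw [← h2]
        gcongr
        linarith

end TopEnergy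

/-! ### Real coordinates on the first modes, scaled to make the Gaussian standard -/

section Coordinates

open Set

/-- Real coordinates for the first Fourier modes. -/
abbrev Modes (N : ℕ+) : Type := Finset.Icc 1 N → ℝ × ℝ

variable {γ : ℝ} {s : ℕ} {N : ℕ+}

/-- The standard deviation of the `n`-th coordinate of the random series. -/
def modeScale (γ : ℝ) (n : ℕ+) : ℝ := (Real.sqrt 2 * ((n : ℕ) : ℝ) ^ (γ / 2))⁻¹

theorem modeScale_pos (γ : ℝ) (n : ℕ+) : 0 < modeScale γ n := by
  have := one_le_pnat n
  unfold modeScale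
  positivity

theorem modeScale_sq (γ : ℝ) (n : ℕ+) : modeScale γ n ^ 2 = (2 * ((n : ℕ) : ℝ) ^ γ)⁻¹ := by
  have := one_le_pnat n
  rw [modeScale, inv_pow, mul_pow, Real.sq_sqrt (by norm_num), ← Real.rpow_natCast,
    ← Real.rpow_mul (by positivity)]
  norm_num

/-- The sequence whose first coordinates are the given ones, rescaled. -/
def embed (γ : ℝ) (N : ℕ+) : Modes N →L[ℝ] Ell :=
  ∑ i : Finset.Icc 1 N, (lp.singleContinuousLinearMap ℝ (fun _ : ℕ+ => ℂ) 2 (i : ℕ+)) ∘L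
    (modeScale γ i • (Complex.equivRealProdCLM.symm : ℝ × ℝ →L[ℝ] ℂ)) ∘L
      ContinuousLinearMap.proj i

/-- The rescaled first coordinates of a sequence. -/
def coords (γ : ℝ) (N : ℕ+) : Ell →L[ℝ] Modes N :=
  ContinuousLinearMap.pi fun i => ((modeScale γ i)⁻¹ • (Complex.equivRealProdCLM : ℂ →L[ℝ] ℝ × ℝ)) ∘L
    lp.evalCLM ℝ (fun _ : ℕ+ => ℂ) 2 (i : ℕ+)

theorem coords_apply (x : Ell) (i : Finset.Icc 1 N) :
    coords γ N x i = (modeScale γ i)⁻¹ • Complex.equivRealProdCLM (x i) := rfl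

theorem embed_eq_sum (y : Modes N) : embed γ N y = ∑ i : Finset.Icc 1 N,
    lp.single 2 (i : ℕ+) (modeScale γ i • Complex.equivRealProdCLM.symm (y i)) := by
  rw [embed, sum_apply]
  rfl

theorem embed_apply (y : Modes N) (i : Finset.Icc 1 N) :
    embed γ N y (i : ℕ+) = modeScale γ i • Complex.equivRealProdCLM.symm (y i) := by
  rw [embed_eq_sum, lp.coeFn_sum, Finset.sum_apply, Finset.sum_eq_single i]
  · rw [lp.single_apply_self]
  · intro j _ hj
    rw [lp.single_apply_ne _ _ _ (fun h => hj (Subtype.ext h.symm))]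
  · simp

theorem embed_apply_of_lt (y : Modes N) {n : ℕ+} (hn : N < n) : embed γ N y n = 0 := by
  rw [embed_eq_sum, lp.coeFn_sum, Finset.sum_apply]
  refine Finset.sum_eq_zero fun i _ => ?_
  rw [lp.single_apply_ne]
  rintro rfl
  exact absurd (Finset.mem_Icc.1 i.2).2 (not_le.2 hn)

theorem embed_single (i : Finset.Icc 1 N) (w : ℝ × ℝ) : embed γ N (Pi.single i w) =
    lp.single 2 (i : ℕ+) (modeScale γ i • Complex.equivRealProdCLM.symm w) := by
  rw [embed_eq_sum, Finset.sum_eq_single i]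
  · rw [Pi.single_eq_same]
  · intro j _ hj
    rw [Pi.single_eq_of_ne hj]
    simp
  · simp

theorem coords_embed (y : Modes N) : coords γ N (embed γ N y) = y := by
  funext i
  rw [coords_apply, embed_apply, map_smul, smul_smul, inv_mul_cancel₀ (modeScale_pos γ i).ne']
  simp

theorem embed_coords (x : Ell) : embed γ N (coords γ N x) = proj N x := by
  refine Subtype.ext (funext fun n => ?_)
  rw [proj_apply]
  split_ifs with h
  · rw [embed_apply _ ⟨n, Finset.mem_Icc.2 ⟨one_le, h⟩⟩, coords_apply, map_smul, smul_smul,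
      mul_inv_cancel₀ (modeScale_pos γ n).ne', one_smul]
    exact Complex.equivRealProdCLM.symm_apply_apply _
  · exact embed_apply_of_lt _ (not_le.1 h)

theorem proj_embed (y : Modes N) : proj N (embed γ N y) = embed γ N y := by
  rw [← embed_coords (γ := γ), coords_embed]

theorem fc_single (n : ℕ+) (z : ℂ) (a : ℤ) : fc s (lp.single 2 n z : Ell) a =
    (if a = n then (((n : ℕ) : ℂ) ^ s)⁻¹ * z else 0) +
      (if a = -n then (starRingEnd ℂ) ((((n : ℕ) : ℂ) ^ s)⁻¹ * z) else 0) := by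
  have key : ∀ m : ℕ+, (((m : ℕ) : ℂ) ^ s)⁻¹ * (lp.single 2 n z : Ell) m =
      if ((m : ℕ) : ℤ) = n then (((n : ℕ) : ℂ) ^ s)⁻¹ * z else 0 := fun m => by
    rcases eq_or_ne m n with rfl | h
    · rw [lp.single_apply_self, if_pos rfl]
    · rw [lp.single_apply_ne _ _ _ h, if_neg, mul_zero]
      exact fun h' => h (PNat.eq (by exact_mod_cast h'))
  have hn := n.pos
  rcases int_cases_pnat a with rfl | ⟨m, rfl | rfl⟩
  · rw [fc_zero, if_neg (by omega), if_neg (by omega), add_zero]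
  · have := m.pos
    rw [fc_pnat, key, if_neg (c := ((m : ℕ) : ℤ) = -((n : ℕ) : ℤ)) (by omega), add_zero]
  · have := m.pos
    rw [fc_neg, fc_pnat, key, if_neg (c := -((m : ℕ) : ℤ) = ((n : ℕ) : ℤ)) (by omega), zero_add]
    simp only [neg_inj]
    split_ifs <;> simp

/-- Of the two frequencies `n` and `-n` of the single mode, `n` would pair with the zero frequency,
where `x` has no coefficient. Only `-n` remains, so the dependence on `z` is conjugate linear. -/
theorem conv_single (x : Ell) (n : ℕ+) (z : ℂ) : conv s x (lp.single 2 n z : Ell) ((n : ℕ) : ℤ) =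
    fc s x (2 * ((n : ℕ) : ℤ)) * (starRingEnd ℂ) ((((n : ℕ) : ℂ) ^ s)⁻¹ * z) := by
  have hn := n.pos
  rw [conv, tsum_eq_single (2 * ((n : ℕ) : ℤ))]
  · rw [fc_single, if_neg (by omega), if_pos (by ring), zero_add]
  · intro a ha
    rw [fc_single, if_neg (c := ((n : ℕ) : ℤ) - a = -((n : ℕ) : ℤ)) (by omega), add_zero]
    split_ifs with h
    · rw [show a = 0 by omega, fc_zero, zero_mul]
    · rw [mul_zero]

end Coordinates

/-! ### The truncated flow preserves Lebesgue measure -/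

section FiniteFlow

open Set

variable {γ : ℝ} {s : ℕ} [NeZero s] [Fact (1 < γ)] {N : ℕ+}

/-- The truncated vector field in real coordinates. -/
def modeField (γ : ℝ) (s : ℕ) [NeZero s] [Fact (1 < γ)] (N : ℕ+) (y : Modes N) : Modes N :=
  coords γ N (field γ s (embed γ N y))

/-- The derivative of `modeField`. -/
def modeFieldDeriv (γ : ℝ) (s : ℕ) [NeZero s] [Fact (1 < γ)] (N : ℕ+) (y : Modes N) :
    Modes N →L[ℝ] Modes N :=
  (coords γ N ∘L linMap γ) ∘L
    (ContinuousLinearMap.id ℝ Ell + (2 : ℝ) • prodMap s (embed γ N y)) ∘L embed γ N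

theorem embed_modeField (y : Modes N) :
    embed γ N (modeField γ s N y) = galerkin γ s N (embed γ N y) := by
  rw [modeField, embed_coords, galerkin, proj_embed]

theorem hasFDerivAt_modeField (y : Modes N) :
    HasFDerivAt (modeField γ s N) (modeFieldDeriv γ s N y) y := by
  have h1 : HasFDerivAt (fun y => embed γ N y) (embed γ N) y := (embed γ N).hasFDerivAt
  have h2 := (((prodMap s).hasFDerivAt.comp y h1).clm_apply h1)
  have h3 := ((coords γ N ∘L linMap γ).hasFDerivAt.comp y (h1.add h2))
  refine h3.congr_fderiv ?_
  ext1 v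
  simp only [modeFieldDeriv, ContinuousLinearMap.comp_apply, add_apply,
    smul_apply, ContinuousLinearMap.id_apply, ContinuousLinearMap.flip_apply,
    Function.comp_apply]
  rw [prodMap_comm (embed γ N v) (embed γ N y), two_smul]

theorem lipschitzOnBalls_modeField : LipschitzOnBalls (modeField γ s N) := by
  intro R
  obtain ⟨K, hK⟩ := lipschitzOnBalls_field (γ := γ) (s := s) (‖embed γ N‖ * R)
  refine ⟨‖coords γ N‖₊ * (K * ‖embed γ N‖₊), (coords γ N).lipschitz.comp_lipschitzOnWith
    (hK.comp (embed γ N).lipschitz.lipschitzOnWith fun y hy => ?_)⟩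
  rw [mem_closedBall_zero_iff] at hy ⊢
  exact (embed γ N).le_of_opNorm_le_of_le le_rfl hy

theorem lipschitzOnBalls_modeFieldDeriv : LipschitzOnBalls (modeFieldDeriv γ s N) := by
  intro R
  refine ⟨‖coords γ N ∘L linMap γ‖₊ * (2 * (‖prodMap s‖₊ * ‖embed γ N‖₊)) * ‖embed γ N‖₊,
    LipschitzOnWith.of_dist_le_mul fun y _ y' _ => ?_⟩
  have h : modeFieldDeriv γ s N y - modeFieldDeriv γ s N y' = (coords γ N ∘L linMap γ) ∘L
      (((2 : ℝ) • prodMap s (embed γ N (y - y'))) ∘L embed γ N) := by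
    ext1 v
    simp only [modeFieldDeriv, ContinuousLinearMap.comp_apply, add_apply, sub_apply,
      smul_apply, ContinuousLinearMap.id_apply, map_sub, map_add, smul_sub]
    abel
  rw [dist_eq_norm, dist_eq_norm, h]
  calc _ ≤ ‖coords γ N ∘L linMap γ‖ *
        ((2 * (‖prodMap s‖ * (‖embed γ N‖ * ‖y - y'‖))) * ‖embed γ N‖) := by
        refine (ContinuousLinearMap.opNorm_comp_le _ _).trans ?_
        gcongr
        refine (ContinuousLinearMap.opNorm_comp_le _ _).trans ?_
        gcongr
        rw [norm_smul, Real.norm_two]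
        gcongr
        refine ((prodMap s).le_opNorm _).trans ?_
        gcongr
        exact (embed γ N).le_opNorm _
    _ = _ := by push_cast; ring

theorem trace_modes (A : Modes N →ₗ[ℝ] Modes N) : LinearMap.trace ℝ _ A =
    ∑ i, ((A (Pi.single i (1, 0)) i).1 + (A (Pi.single i (0, 1)) i).2) := by
  rw [LinearMap.trace_eq_matrix_trace ℝ (Pi.basis fun _ : Finset.Icc 1 N => Module.Basis.finTwoProd ℝ)]
  simp [Matrix.trace, LinearMap.toMatrix_apply, Fintype.sum_sigma]

/-- The diagonal block at the mode `n` is `z ↦ -iλ(z + β conj z)`. Its linear part has real trace `2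
Re(-iλ) = 0`, and a conjugate linear map of `ℂ` always has real trace zero. -/
theorem trace_modeFieldDeriv (y : Modes N) : LinearMap.trace ℝ _ (modeFieldDeriv γ s N y :
    Modes N →ₗ[ℝ] Modes N) = 0 := by
  rw [trace_modes]
  refine Finset.sum_eq_zero fun i _ => ?_
  set n : ℕ+ := i.1
  set β : ℂ := 2 * (((n : ℕ) : ℂ) ^ s * fc s (embed γ N y) (2 * ((n : ℕ) : ℤ)) *
    (((n : ℕ) : ℂ) ^ s)⁻¹) with hβ
  have key : ∀ w, modeFieldDeriv γ s N y (Pi.single i w) i = Complex.equivRealProdCLM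
      (-(Complex.I * (lam γ n : ℂ)) * (Complex.equivRealProdCLM.symm w +
        β * (starRingEnd ℂ) (Complex.equivRealProdCLM.symm w))) := by
    intro w
    set z := Complex.equivRealProdCLM.symm w
    have h1 : modeFieldDeriv γ s N y (Pi.single i w) = coords γ N (linMap γ
      (lp.single 2 n (modeScale γ n • z) +
        (2 : ℝ) • prodMap s (embed γ N y) (lp.single 2 n (modeScale γ n • z)))) := by
      rw [← embed_single]; rfl
    rw [h1, coords_apply, show (i : ℕ+) = n from rfl, linMap_apply, lp.coeFn_add, Pi.add_apply, lp.single_apply_self,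
      lp.coeFn_smul, Pi.smul_apply, prodMap_apply, conv_single, ← map_smul]
    congr 1
    have hk : (modeScale γ n : ℂ) ≠ 0 := by exact_mod_cast (modeScale_pos γ n).ne'
    simp only [Complex.real_smul, map_mul, map_inv₀, map_pow, map_natCast, Complex.conj_ofReal, hβ,
      Complex.ofReal_inv]
    field_simp
    push_cast
    ring
  simp only [ContinuousLinearMap.coe_coe, key]
  simp [Complex.equivRealProdCLM_symm_apply]

variable [Fact (γ ≤ 2)]

theorem hasAPrioriBounds_modeField : HasAPrioriBounds (modeField γ s N) := by
  intro r T
  obtain ⟨M, hM⟩ := (isTame_galerkin (γ := γ) (s := s) N).hasAPrioriBounds (‖embed γ N‖ * r) T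
  refine ⟨‖coords γ N‖ * M, fun c u hc hu h0 t ht => ?_⟩
  have h := hM c (fun t => embed γ N (u t)) hc (fun t ht => ?_)
    ((embed γ N).le_of_opNorm_le_of_le le_rfl h0) t ht
  · rw [← coords_embed (γ := γ) (u t)]
    exact (coords γ N).le_of_opNorm_le_of_le le_rfl h
  · refine ((embed γ N).hasFDerivAt.comp_hasDerivWithinAt t (hu t ht)).congr_deriv ?_
    rw [map_smul, embed_modeField]

/-- The truncated flow in real coordinates. -/
def modeFlow (γ : ℝ) (s : ℕ) [NeZero s] [Fact (1 < γ)] [Fact (γ ≤ 2)] (N : ℕ+) (t : ℝ)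
    (y : Modes N) : Modes N :=
  coords γ N (galerkinFlow γ s N t (embed γ N y))

theorem embed_modeFlow (t : ℝ) (y : Modes N) :
    embed γ N (modeFlow γ s N t y) = galerkinFlow γ s N t (embed γ N y) := by
  rw [modeFlow, embed_coords, ← proj_embed, proj_galerkinFlow]

theorem isFlow_modeFlow : IsFlow (modeField γ s N) (modeFlow γ s N) where
  zero y := by rw [modeFlow, (isFlow_galerkinFlow N).zero, coords_embed]
  hasDerivAt y t := by
    refine ((coords γ N).hasFDerivAt.comp_hasDerivAt t
      ((isFlow_galerkinFlow (γ := γ) (s := s) N).hasDerivAt (embed γ N y) t)).congr_deriv ?_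
    rw [← embed_modeFlow, ← embed_modeField, coords_embed]

theorem lintegral_modeFlow (t : ℝ) (f : Modes N → ℝ≥0∞) :
    ∫⁻ y, f (modeFlow γ s N t y) = ∫⁻ y, f y :=
  isFlow_modeFlow.lintegral_comp hasFDerivAt_modeField lipschitzOnBalls_modeField
    lipschitzOnBalls_modeFieldDeriv hasAPrioriBounds_modeField trace_modeFieldDeriv t f

end FiniteFlow

/-! ### Products of densities -/

section ProductIntegral

variable {ι : Type*} [Fintype ι] {E : Type*} [MeasurableSpace E]

theorem lintegral_pi_prod {μ : ι → Measure E} [∀ i, SigmaFinite (μ i)] {f : ι → E → ℝ}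
    (hf : ∀ i, Integrable (f i) (μ i)) (h0 : ∀ i z, 0 ≤ f i z) :
    ∫⁻ y, ENNReal.ofReal (∏ i, f i (y i)) ∂Measure.pi μ =
      ∏ i, ∫⁻ z, ENNReal.ofReal (f i z) ∂μ i := by
  rw [← ofReal_integral_eq_lintegral_ofReal (Integrable.fintype_prod hf)
    (Eventually.of_forall fun y => Finset.prod_nonneg fun i _ => h0 i _),
    integral_fintype_prod_eq_prod,
    ENNReal.ofReal_prod_of_nonneg fun i _ => integral_nonneg (h0 i)]
  exact Finset.prod_congr rfl fun i _ =>
    ofReal_integral_eq_lintegral_ofReal (hf i) (Eventually.of_forall (h0 i))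

/-- On a box, the indicator of the product factors and Fubini applies to the functions `ρ`
restricted to the sides. -/
theorem pi_withDensity_ofReal {μ : Measure E} [SigmaFinite μ] {ρ : E → ℝ}
    (hρ : Integrable ρ μ) (h0 : ∀ z, 0 ≤ ρ z) :
    Measure.pi (fun _ : ι => μ.withDensity fun z => ENNReal.ofReal (ρ z)) =
      (Measure.pi fun _ : ι => μ).withDensity fun y => ENNReal.ofReal (∏ i, ρ (y i)) := by
  have : IsFiniteMeasure (μ.withDensity fun z => ENNReal.ofReal (ρ z)) :=
    isFiniteMeasure_withDensity_ofReal hρ.2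
  refine Measure.pi_eq fun t ht => ?_
  rw [withDensity_apply _ (MeasurableSet.univ_pi ht), ← lintegral_indicator (MeasurableSet.univ_pi ht)]
  have h1 : ∀ y : ι → E, (Set.univ.pi t).indicator (fun y => ENNReal.ofReal (∏ i, ρ (y i))) y =
      ENNReal.ofReal (∏ i, (t i).indicator ρ (y i)) := by
    intro y
    by_cases hy : y ∈ Set.univ.pi t
    · rw [Set.indicator_of_mem hy]
      congr 1
      exact Finset.prod_congr rfl fun i _ => (Set.indicator_of_mem (hy i trivial) _).symm
    · rw [Set.indicator_of_notMem hy]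
      simp only [Set.mem_pi, Set.mem_univ, true_implies, not_forall] at hy
      obtain ⟨i, hi⟩ := hy
      rw [Finset.prod_eq_zero (Finset.mem_univ i) (Set.indicator_of_notMem hi _), ENNReal.ofReal_zero]
  simp only [h1]
  rw [lintegral_pi_prod (fun i => hρ.indicator (ht i))
    fun i z => Set.indicator_nonneg (fun z _ => h0 z) z]
  refine Finset.prod_congr rfl fun i _ => ?_
  rw [withDensity_apply _ (ht i), ← lintegral_indicator (ht i)]
  refine lintegral_congr fun z => ?_
  by_cases hz : z ∈ t i
  · simp [hz]
  · simp [hz]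

end ProductIntegral

/-! ### The truncated Gaussian measure and its density under the flow -/

section ModeGauss

variable {γ : ℝ} {s : ℕ} {N : ℕ+}

/-- The law of a pair of independent standard normal variables. -/
def pairGauss : Measure (ℝ × ℝ) := (gaussianReal 0 1).prod (gaussianReal 0 1)

instance isProbabilityMeasure_pairGauss : IsProbabilityMeasure pairGauss := by
  unfold pairGauss; infer_instance

/-- The density of `pairGauss`. -/
def pairDensity (z : ℝ × ℝ) : ℝ := gaussianPDFReal 0 1 z.1 * gaussianPDFReal 0 1 z.2

theorem pairDensity_eq (z : ℝ × ℝ) :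
    pairDensity z = (2 * Real.pi)⁻¹ * Real.exp (-((z.1 ^ 2 + z.2 ^ 2) / 2)) := by
  have h : (Real.sqrt (2 * Real.pi))⁻¹ * (Real.sqrt (2 * Real.pi))⁻¹ = (2 * Real.pi)⁻¹ := by
    rw [← mul_inv, Real.mul_self_sqrt (by positivity)]
  rw [pairDensity, gaussianPDFReal, gaussianPDFReal, ← h]
  simp only [NNReal.coe_one, mul_one, sub_zero]
  rw [mul_mul_mul_comm, ← Real.exp_add]
  congr 2
  ring

theorem pairDensity_nonneg (z : ℝ × ℝ) : 0 ≤ pairDensity z :=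
  mul_nonneg (gaussianPDFReal_nonneg _ _ _) (gaussianPDFReal_nonneg _ _ _)

theorem measurable_pairDensity : Measurable pairDensity :=
  ((measurable_gaussianPDFReal 0 1).comp measurable_fst).mul
    ((measurable_gaussianPDFReal 0 1).comp measurable_snd)

theorem integrable_pairDensity : Integrable pairDensity :=
  (integrable_gaussianPDFReal 0 1).mul_prod (integrable_gaussianPDFReal 0 1)

theorem pairGauss_eq_withDensity :
    pairGauss = volume.withDensity fun z => ENNReal.ofReal (pairDensity z) := by
  rw [pairGauss, gaussianReal_of_var_ne_zero 0 one_ne_zero,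
    prod_withDensity (measurable_gaussianPDF 0 1) (measurable_gaussianPDF 0 1)]
  congr 1
  funext z
  rw [pairDensity, ENNReal.ofReal_mul (gaussianPDFReal_nonneg _ _ _)]
  rfl

/-- The law of the real coordinates of the first Fourier modes. -/
def modeGauss (N : ℕ+) : Measure (Modes N) := Measure.pi fun _ => pairGauss

instance isProbabilityMeasure_modeGauss : IsProbabilityMeasure (modeGauss N) := by
  unfold modeGauss; infer_instance

/-- The density of `modeGauss`. -/
def modeDensity (y : Modes N) : ℝ := ∏ i, pairDensity (y i)

theorem measurable_modeDensity : Measurable (modeDensity (N := N)) :=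
  Finset.measurable_prod _ fun i _ => measurable_pairDensity.comp (measurable_pi_apply i)

theorem modeGauss_eq_withDensity :
    modeGauss N = volume.withDensity fun y => ENNReal.ofReal (modeDensity y) := by
  rw [modeGauss, pairGauss_eq_withDensity]
  exact pi_withDensity_ofReal integrable_pairDensity pairDensity_nonneg

theorem lintegral_modeGauss (f : Modes N → ℝ≥0∞) :
    ∫⁻ y, f y ∂modeGauss N = ∫⁻ y, ENNReal.ofReal (modeDensity y) * f y := by
  rw [modeGauss_eq_withDensity, lintegral_withDensity_eq_lintegral_mul_non_measurable _
    measurable_modeDensity.ennreal_ofReal (Eventually.of_forall fun _ => ENNReal.ofReal_lt_top)]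
  rfl

theorem norm_sq_eq_sum_of_support {x : Ell} (hx : ∀ n, N < n → x n = 0) :
    ‖x‖ ^ 2 = ∑ n ∈ Finset.Icc 1 N, ‖x n‖ ^ 2 := by
  rw [← (hasSum_norm_sq x).tsum_eq, tsum_eq_sum fun n hn => ?_]
  rw [hx n (not_le.1 fun h => hn (Finset.mem_Icc.2 ⟨one_le, h⟩))]
  simp

theorem norm_equivRealProdCLM_symm_sq (w : ℝ × ℝ) :
    ‖Complex.equivRealProdCLM.symm w‖ ^ 2 = w.1 ^ 2 + w.2 ^ 2 := by
  rw [← Complex.normSq_eq_norm_sq, Complex.normSq_apply, Complex.equivRealProdCLM_symm_apply]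
  simp
  ring

/-- Since `n^γ` times the square of `modeScale` is `1/2`, the part of the energy with weight `n^γ`
is exactly the exponent of the standard Gaussian density. -/
theorem topEnergy_embed (y : Modes N) : topEnergy γ N (embed γ N y) =
    ‖embed γ N y‖ ^ 2 + ∑ i, ((y i).1 ^ 2 + (y i).2 ^ 2) / 2 := by
  rw [norm_sq_eq_sum_of_support fun n hn => embed_apply_of_lt y hn, topEnergy]
  simp only [add_mul, one_mul, Finset.sum_add_distrib]
  congr 1
  rw [← Finset.sum_coe_sort]
  refine Finset.sum_congr rfl fun i _ => ?_
  have := one_le_pnat (i : ℕ+)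
  rw [embed_apply, norm_smul, Real.norm_eq_abs, mul_pow, sq_abs, modeScale_sq,
    norm_equivRealProdCLM_symm_sq]
  field_simp

theorem modeDensity_eq (y : Modes N) : modeDensity y = (∏ _i : Finset.Icc 1 N, (2 * Real.pi)⁻¹) *
    Real.exp (‖embed γ N y‖ ^ 2 - topEnergy γ N (embed γ N y)) := by
  rw [topEnergy_embed, modeDensity]
  simp only [pairDensity_eq, Finset.prod_mul_distrib, ← Real.exp_sum]
  congr 2
  rw [Finset.sum_neg_distrib]
  ring

variable [NeZero s] [Fact (1 < γ)] [Fact (γ ≤ 2)]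

/-- Change of variables for the Gaussian measure under the truncated flow. -/
theorem lintegral_galerkinFlow_le (t : ℝ) {R : ℝ} {f : Ell → ℝ≥0∞} (hf : ∀ x, R < ‖x‖ → f x = 0) :
    ∫⁻ y, f (galerkinFlow γ s N t (embed γ N y)) ∂modeGauss N ≤
      ENNReal.ofReal (Real.exp (growth γ s R |t| ^ 2)) * ∫⁻ y, f (embed γ N y) *
        ENNReal.ofReal (Real.exp |topEnergy γ N (galerkinFlow γ s N (-t) (embed γ N y)) -
          topEnergy γ N (embed γ N y)|) ∂modeGauss N := by
  set D : Modes N → ℝ≥0∞ := fun y => ENNReal.ofReal (modeDensity y) with hD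
  have hinv : ∀ y, modeFlow γ s N (-t) (modeFlow γ s N t y) = y := fun y =>
    isFlow_modeFlow.neg_apply lipschitzOnBalls_modeField t y
  -- Liouville's theorem, applied to the density composed with the inverse flow.
  have h1 : ∫⁻ y, f (galerkinFlow γ s N t (embed γ N y)) ∂modeGauss N =
      ∫⁻ y, D (modeFlow γ s N (-t) y) * f (embed γ N y) := by
    rw [lintegral_modeGauss, ← lintegral_modeFlow (γ := γ) (s := s) t
      fun y => D (modeFlow γ s N (-t) y) * f (embed γ N y)]
    simp only [hinv, embed_modeFlow, hD]
  rw [h1, ← lintegral_const_mul' _ _ ENNReal.ofReal_ne_top, lintegral_modeGauss]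
  refine lintegral_mono fun y => ?_
  rcases lt_or_ge R ‖embed γ N y‖ with hy | hy
  · simp [hf _ hy]
  set x := embed γ N y with hx
  set x' := galerkinFlow γ s N (-t) x with hx'
  have hnorm : ‖x'‖ ≤ growth γ s R |t| :=
    ((isTame_galerkin N).flow_norm_le (isFlow_galerkinFlow N) _
      (T := |t|) ⟨neg_le_neg (le_abs_self t), neg_le_abs t⟩).trans
      (growth_mono (norm_nonneg _) hy (abs_nonneg t))
  -- The quotient of the densities is `exp(‖x'‖² - ‖x‖² - (E(x') - E(x)))`. The first term is
  -- bounded because `x` lies in the ball, and the second has a favourable sign.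
  have hd : modeDensity (modeFlow γ s N (-t) y) ≤ modeDensity y *
      (Real.exp (growth γ s R |t| ^ 2) * Real.exp |topEnergy γ N x' - topEnergy γ N x|) := by
    rw [modeDensity_eq (γ := γ), modeDensity_eq (γ := γ), embed_modeFlow, ← hx, ← hx', mul_assoc]
    gcongr
    rw [← Real.exp_add, ← Real.exp_add]
    have h3 : ‖x'‖ ^ 2 ≤ growth γ s R |t| ^ 2 := by gcongr
    have h4 := neg_abs_le (topEnergy γ N x' - topEnergy γ N x)
    have h5 := sq_nonneg ‖x‖
    gcongr
    linarith
  have hnn : 0 ≤ modeDensity y := Finset.prod_nonneg fun i _ => pairDensity_nonneg _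
  calc D (modeFlow γ s N (-t) y) * f x
      ≤ ENNReal.ofReal (modeDensity y * (Real.exp (growth γ s R |t| ^ 2) *
          Real.exp |topEnergy γ N x' - topEnergy γ N x|)) * f x := by
        gcongr
        exact ENNReal.ofReal_le_ofReal hd
    _ = _ := by
        rw [ENNReal.ofReal_mul hnn, ENNReal.ofReal_mul (Real.exp_pos _).le]
        ring

end ModeGauss

/-! ### Gaussian moments of the derivative of the linear evolution -/

section ExponentialMoment

variable {γ : ℝ} {s : ℕ} {N : ℕ+}

theorem lintegral_exp_pairGauss (a b : ℝ) :
    ∫⁻ z, ENNReal.ofReal (Real.exp (a * z.1 + b * z.2)) ∂pairGauss =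
      ENNReal.ofReal (Real.exp ((a ^ 2 + b ^ 2) / 2)) := by
  have hm : ∀ c : ℝ, ∫ x, Real.exp (c * x) ∂gaussianReal 0 1 = Real.exp (c ^ 2 / 2) := fun c => by
    have := congrFun (mgf_id_gaussianReal (μ := 0) (v := 1)) c
    simpa [mgf] using this
  have hi : Integrable (fun z : ℝ × ℝ => Real.exp (a * z.1) * Real.exp (b * z.2)) pairGauss :=
    (integrable_exp_mul_gaussianReal a).mul_prod (integrable_exp_mul_gaussianReal b)
  simp only [Real.exp_add]
  rw [← ofReal_integral_eq_lintegral_ofReal hi (Eventually.of_forall fun z => by positivity),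
    pairGauss, integral_prod_mul (fun x => Real.exp (a * x)) (fun x => Real.exp (b * x)), hm, hm,
    ← Real.exp_add, add_div]

theorem integrable_exp_pairGauss (a b : ℝ) :
    Integrable (fun z : ℝ × ℝ => Real.exp (a * z.1 + b * z.2)) pairGauss := by
  simp only [Real.exp_add]
  exact (integrable_exp_mul_gaussianReal a).mul_prod (integrable_exp_mul_gaussianReal b)

theorem lintegral_exp_modeGauss (a b : Finset.Icc 1 N → ℝ) :
    ∫⁻ y, ENNReal.ofReal (Real.exp (∑ i, (a i * (y i).1 + b i * (y i).2))) ∂modeGauss N =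
      ENNReal.ofReal (Real.exp (∑ i, (a i ^ 2 + b i ^ 2) / 2)) := by
  simp only [Real.exp_sum]
  rw [modeGauss, lintegral_pi_prod (μ := fun _ => pairGauss)
    (f := fun i z => Real.exp (a i * z.1 + b i * z.2))
    (fun i => integrable_exp_pairGauss _ _) (fun i z => by positivity)]
  simp only [lintegral_exp_pairGauss]
  rw [ENNReal.ofReal_prod_of_nonneg fun i _ => by positivity]

variable [Fact (1 < γ)]

/-- The series of the variances of the coordinates. -/
def varSum (γ : ℝ) : ℝ := ∑' n : ℕ+, ((n : ℕ) : ℝ) ^ (-γ)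

/-- At a fixed point of space-time the derivative is a linear combination of independent standard
normal variables. Time and position enter only through phases of modulus one, so the variance is at
most `2 ∑ n^(-γ)`, whatever `q` and `N`. -/
theorem lintegral_exp_linDer_le (k : ℝ) (q : ℝ × Torus) :
    ∫⁻ y, ENNReal.ofReal (Real.exp (k * linDer γ N (embed γ N y) q)) ∂modeGauss N ≤
      ENNReal.ofReal (Real.exp (k ^ 2 * varSum γ)) := by
  have hγ : 1 < γ := Fact.out
  set w : Finset.Icc 1 N → ℂ := fun i => 2 * modeScale γ i * (Complex.I *
    Complex.exp (-(Complex.I * (lam γ i : ℂ)) * q.1) * fourier (((i : ℕ+) : ℕ) : ℤ) q.2) with hw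
  have hwn : ∀ i, ‖w i‖ ^ 2 = 2 * (((i : ℕ+) : ℕ) : ℝ) ^ (-γ) := fun i => by
    have := one_le_pnat (i : ℕ+)
    have h1 : ‖w i‖ = 2 * modeScale γ i := by
      simp only [hw, norm_mul, Complex.norm_I, Complex.norm_exp, fourier_apply, Circle.norm_coe,
        Complex.norm_real, Real.norm_eq_abs, abs_of_pos (modeScale_pos γ i)]
      simp
    rw [h1, mul_pow, modeScale_sq, Real.rpow_neg (by positivity)]
    field_simp
  have hlin : ∀ y : Modes N, k * linDer γ N (embed γ N y) q =
      ∑ i, (k * (w i).re * (y i).1 + -(k * (w i).im) * (y i).2) := fun y => by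
    rw [linDer, dfun, ← Finset.sum_coe_sort, Finset.mul_sum]
    refine Finset.sum_congr rfl fun i _ => ?_
    rw [linFlow_apply, embed_apply]
    have h2 : 2 * (Complex.I * (Complex.exp (-(Complex.I * (lam γ i : ℂ)) * q.1) *
        (modeScale γ i • Complex.equivRealProdCLM.symm (y i))) *
          fourier (((i : ℕ+) : ℕ) : ℤ) q.2).re = (w i * Complex.equivRealProdCLM.symm (y i)).re := by
      rw [← Complex.re_ofReal_mul]
      congr 1
      rw [hw, Complex.real_smul]
      push_cast
      ring
    rw [h2, Complex.mul_re, Complex.equivRealProdCLM_symm_apply]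
    simp
    ring
  simp only [hlin]
  rw [lintegral_exp_modeGauss]
  refine ENNReal.ofReal_le_ofReal (Real.exp_le_exp.2 ?_)
  have h3 : ∀ i : Finset.Icc 1 N, ((k * (w i).re) ^ 2 + (-(k * (w i).im)) ^ 2) / 2 =
      k ^ 2 * (((i : ℕ+) : ℕ) : ℝ) ^ (-γ) := fun i => by
    have := hwn i
    rw [← Complex.normSq_eq_norm_sq, Complex.normSq_apply] at this
    linear_combination (k ^ 2 / 2) * this
  simp only [h3]
  rw [← Finset.mul_sum, Finset.sum_coe_sort (Finset.Icc 1 N) fun n : ℕ+ => ((n : ℕ) : ℝ) ^ (-γ)]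
  gcongr
  exact (summable_pnat_rpow (by linarith)).sum_le_tsum _ fun n _ => by positivity

/-- The square is absorbed by raising the rate from `K` to `K + 1`, and the absolute value by
summing over both signs. What remains are Laplace transforms. -/
theorem sq_mul_exp_abs_le (K u : ℝ) : u ^ 2 * Real.exp (K * |u|) ≤
    2 * (Real.exp ((K + 1) * u) + Real.exp (-(K + 1) * u)) := by
  have h1 : u ^ 2 ≤ 2 * Real.exp |u| := by
    have := Real.quadratic_le_exp_of_nonneg (abs_nonneg u)
    rw [sq_abs] at this
    linarith [abs_nonneg u]
  calc u ^ 2 * Real.exp (K * |u|) ≤ 2 * Real.exp |u| * Real.exp (K * |u|) := by gcongr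
    _ = 2 * Real.exp ((K + 1) * |u|) := by rw [mul_assoc, ← Real.exp_add]; ring_nf
    _ ≤ _ := by
      rcases abs_cases u with ⟨h, _⟩ | ⟨h, _⟩
      · rw [h]; linarith [Real.exp_pos (-(K + 1) * u)]
      · rw [h, show (K + 1) * -u = -(K + 1) * u by ring]; linarith [Real.exp_pos ((K + 1) * u)]

theorem lintegral_sq_mul_exp_linDer_le (K : ℝ) (q : ℝ × Torus) :
    ∫⁻ y, ENNReal.ofReal (linDer γ N (embed γ N y) q ^ 2 *
      Real.exp (K * |linDer γ N (embed γ N y) q|)) ∂modeGauss N ≤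
      ENNReal.ofReal (4 * Real.exp ((K + 1) ^ 2 * varSum γ)) := by
  have hc : Measurable fun y : Modes N => linDer γ N (embed γ N y) q := by
    unfold linDer dfun
    simp only [linFlow_apply]
    have : ∀ n, Measurable fun y : Modes N => embed γ N y n := fun n =>
      ((continuous_coord n).comp (embed γ N).continuous).measurable
    fun_prop
  calc _ ≤ ∫⁻ y, 2 * (ENNReal.ofReal (Real.exp ((K + 1) * linDer γ N (embed γ N y) q)) +
        ENNReal.ofReal (Real.exp (-(K + 1) * linDer γ N (embed γ N y) q))) ∂modeGauss N := by
        refine lintegral_mono fun y => ?_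
        refine (ENNReal.ofReal_le_ofReal (sq_mul_exp_abs_le K _)).trans (le_of_eq ?_)
        rw [ENNReal.ofReal_mul (by norm_num), ENNReal.ofReal_add (by positivity) (by positivity)]
        norm_num
    _ ≤ 2 * (ENNReal.ofReal (Real.exp ((K + 1) ^ 2 * varSum γ)) +
        ENNReal.ofReal (Real.exp ((-(K + 1)) ^ 2 * varSum γ))) := by
        rw [lintegral_const_mul _ (by fun_prop), lintegral_add_left (by fun_prop)]
        gcongr
        · exact lintegral_exp_linDer_le _ q
        · exact lintegral_exp_linDer_le _ q
    _ = _ := by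
        rw [neg_sq, ← two_mul, ← mul_assoc, ENNReal.ofReal_mul (by norm_num)]
        norm_num

end ExponentialMoment

/-! ### Quasi-invariance of the truncated measures, uniformly in `N` -/

section UniformEstimate

variable {γ : ℝ} {s : ℕ} [Fact (1 < γ)] {N : ℕ+}

theorem measurable_linDer_embed :
    Measurable fun w : Modes N × (ℝ × Torus) => linDer γ N (embed γ N w.1) w.2 := by
  unfold linDer dfun
  simp only [linFlow_apply]
  have h1 : ∀ n, Measurable fun w : Modes N × (ℝ × Torus) => embed γ N w.1 n := fun n =>
    ((continuous_coord n).comp (embed γ N).continuous).measurable.comp measurable_fst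
  have h2 : ∀ n : ℕ+, Measurable fun w : Modes N × (ℝ × Torus) => fourier ((n : ℕ) : ℤ) w.2.2 :=
    fun n => (fourier ((n : ℕ) : ℤ)).continuous.measurable.comp (measurable_snd.comp measurable_snd)
  fun_prop

variable [NeZero s] [Fact (γ ≤ 2)]

/-- Quantitative quasi-invariance of the truncated Gaussian measures, uniformly in the truncation. -/
theorem exists_lintegral_galerkinFlow_le (s : ℕ) [NeZero s] (hγ : 4 / 3 < γ) (t : ℝ) {R δ : ℝ}
    (hR : 0 ≤ R) (hδ : 0 < δ) (hδ' : δ < 1) :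
    ∃ C : ℝ≥0∞, C ≠ ⊤ ∧ ∀ (N : ℕ+) (f : Ell → ℝ≥0∞), Continuous f → (∀ x, f x ≤ 1) →
      (∀ x, R < ‖x‖ → f x = 0) →
      ∫⁻ y, f (galerkinFlow γ s N t (embed γ N y)) ∂modeGauss N ≤
        C * (∫⁻ y, f (embed γ N y) ∂modeGauss N) ^ (1 - δ) := by
  -- The moment of order `1/δ` is the one Hölder's inequality will require.
  obtain ⟨A, K, hA, hK, hE⟩ := exists_exp_topEnergy_sub_le (γ := γ) (s := s) hγ hR (abs_nonneg t)
    (inv_nonneg.2 hδ.le)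
  set B : ℝ≥0∞ := ENNReal.ofReal A * (1 + ENNReal.ofReal (4 * Real.exp ((K + 1) ^ 2 * varSum γ)) *
    spaceTime |t| Set.univ) with hB
  have hBtop : B ≠ ⊤ := ENNReal.mul_ne_top ENNReal.ofReal_ne_top (ENNReal.add_ne_top.2
    ⟨ENNReal.one_ne_top, ENNReal.mul_ne_top ENNReal.ofReal_ne_top (measure_ne_top _ _)⟩)
  refine ⟨ENNReal.ofReal (Real.exp (growth γ s R |t| ^ 2)) * B ^ δ,
    ENNReal.mul_ne_top ENNReal.ofReal_ne_top (ENNReal.rpow_ne_top_of_nonneg hδ.le hBtop),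
    fun N f hfc hf1 hf0 => ?_⟩
  set W : Modes N → ℝ × Torus → ℝ≥0∞ := fun y q => ENNReal.ofReal (linDer γ N (embed γ N y) q ^ 2 *
    Real.exp (K * |linDer γ N (embed γ N y) q|)) with hW
  have hWm : Measurable (Function.uncurry W) := by
    have := measurable_linDer_embed (γ := γ) (N := N)
    have habs : Measurable fun w : Modes N × (ℝ × Torus) => |linDer γ N (embed γ N w.1) w.2| :=
      continuous_abs.measurable.comp this
    exact ((this.pow_const 2).mul (Real.measurable_exp.comp (habs.const_mul K))).ennreal_ofReal
  set H : Modes N → ℝ≥0∞ := fun y => ENNReal.ofReal A * (1 + ∫⁻ q, W y q ∂spaceTime |t|) with hH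
  have hWI : Measurable fun y => ∫⁻ q, W y q ∂spaceTime |t| := hWm.lintegral_prod_right'
  have hHm : Measurable H := (hWI.const_add 1).const_mul _
  have hHB : ∫⁻ y, H y ∂modeGauss N ≤ B := by
    simp only [hH]
    rw [lintegral_const_mul _ (hWI.const_add 1),
      lintegral_add_left measurable_const, lintegral_const, measure_univ, mul_one, hB]
    gcongr
    -- Tonelli: the moments are bounded at each point of space-time and the measure `spaceTime` is
    -- finite.
    rw [lintegral_lintegral_swap hWm.aemeasurable]
    refine (lintegral_mono fun q => lintegral_sq_mul_exp_linDer_le K q).trans ?_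
    rw [lintegral_const]
  have hexp : ∀ y, ‖embed γ N y‖ ≤ R →
      ENNReal.ofReal (Real.exp |topEnergy γ N (galerkinFlow γ s N (-t) (embed γ N y)) -
        topEnergy γ N (embed γ N y)|) ≤ H y ^ δ := by
    intro y hy
    have h1 := hE N (embed γ N y) hy (-t) ⟨neg_le_neg (le_abs_self t), neg_le_abs t⟩
    rw [proj_embed] at h1
    set a := |topEnergy γ N (galerkinFlow γ s N (-t) (embed γ N y)) - topEnergy γ N (embed γ N y)|
    have h2 : ENNReal.ofReal (Real.exp a) = ENNReal.ofReal (Real.exp (δ⁻¹ * a)) ^ δ := by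
      rw [ENNReal.ofReal_rpow_of_pos (Real.exp_pos _), ← Real.exp_mul]
      congr 2
      field_simp
    rw [h2]
    refine ENNReal.rpow_le_rpow ((ENNReal.ofReal_le_ofReal h1).trans (le_of_eq ?_)) hδ.le
    have hi := integrable_comp_linDer (γ := γ) (N := N) |t| (embed γ N y)
      (F := fun u => u ^ 2 * Real.exp (K * |u|)) (by fun_prop)
    have hnn : ∀ q, 0 ≤ linDer γ N (embed γ N y) q ^ 2 *
      Real.exp (K * |linDer γ N (embed γ N y) q|) := fun q => by positivity
    rw [ENNReal.ofReal_mul hA, ENNReal.ofReal_add zero_le_one (integral_nonneg hnn),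
      ofReal_integral_eq_lintegral_ofReal hi (Eventually.of_forall hnn), ENNReal.ofReal_one]
  have hfm : Measurable fun y => f (embed γ N y) := (hfc.comp (embed γ N).continuous).measurable
  -- With these exponents `H^δ` contributes `(∫ H)^δ`, while the power `1/(1-δ)` of `f` is at most
  -- `f` because `f ≤ 1`.
  have hconj : (1 - δ)⁻¹.HolderConjugate δ⁻¹ :=
    (Real.holderConjugate_iff).2 ⟨(one_lt_inv₀ (by linarith)).2 (by linarith), by
      rw [inv_inv, inv_inv]; ring⟩
  refine (lintegral_galerkinFlow_le t hf0).trans ?_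
  rw [mul_assoc]
  gcongr
  calc _ ≤ ∫⁻ y, ((fun y => f (embed γ N y)) * fun y => H y ^ δ) y ∂modeGauss N := by
        refine lintegral_mono fun y => ?_
        rcases lt_or_ge R ‖embed γ N y‖ with hy | hy
        · simp [hf0 _ hy]
        · exact mul_le_mul_right (hexp y hy) _
    _ ≤ _ := ENNReal.lintegral_mul_le_Lp_mul_Lq _ hconj hfm.aemeasurable
        (hHm.pow_const δ).aemeasurable
    _ ≤ (∫⁻ y, f (embed γ N y) ∂modeGauss N) ^ (1 - δ) * B ^ δ := by
        simp only [one_div, inv_inv, ← ENNReal.rpow_mul, mul_inv_cancel₀ hδ.ne', ENNReal.rpow_one]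
        gcongr with y
        exact ENNReal.rpow_le_self_of_le_one (hf1 _) (one_le_inv₀ (by linarith) |>.2 (by linarith))
    _ = _ := mul_comm _ _

end UniformEstimate

/-! ### The random sequence and the limit of the truncated estimates -/

section RandomSeq

variable {γ : ℝ} {N : ℕ+}

/-- The rescaled Fourier coefficients of the random series. -/
def noiseCoord (γ : ℝ) (ω : ℕ+ → ℝ × ℝ) (n : ℕ+) : ℂ :=
  modeScale γ n • Complex.equivRealProdCLM.symm (ω n)

theorem embed_restrict_apply (ω : ℕ+ → ℝ × ℝ) (n : ℕ+) :
    embed γ N ((Finset.Icc 1 N).restrict ω) n = if n ≤ N then noiseCoord γ ω n else 0 := by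
  split_ifs with h
  · exact embed_apply _ ⟨n, Finset.mem_Icc.2 ⟨one_le, h⟩⟩
  · exact embed_apply_of_lt _ (not_le.1 h)

open Classical in
/-- The random element of `ℓ²` with the coordinates `noiseCoord`. -/
def noiseSeq (γ : ℝ) (ω : ℕ+ → ℝ × ℝ) : Ell :=
  if h : Memℓp (noiseCoord γ ω) 2 then ⟨noiseCoord γ ω, h⟩ else 0

instance isProbabilityMeasure_gaussianNoise : IsProbabilityMeasure gaussianNoise := by
  unfold gaussianNoise; infer_instance

theorem lintegral_gaussianNoise_restrict {F : Modes N → ℝ≥0∞} (hF : Measurable F) :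
    ∫⁻ ω, F ((Finset.Icc 1 N).restrict ω) ∂gaussianNoise = ∫⁻ y, F y ∂modeGauss N := by
  rw [modeGauss, pairGauss, ← Measure.infinitePi_map_restrict
    (μ := fun _ : ℕ+ => (gaussianReal 0 1).prod (gaussianReal 0 1)),
    lintegral_map hF (Finset.measurable_restrict _)]
  rfl

theorem lintegral_sq_pairGauss_ne_top :
    ∫⁻ z, ENNReal.ofReal (z.1 ^ 2 + z.2 ^ 2) ∂pairGauss ≠ ⊤ := by
  have hle : ∀ z : ℝ × ℝ, ENNReal.ofReal (z.1 ^ 2 + z.2 ^ 2) ≤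
      2 * (ENNReal.ofReal (Real.exp (1 * z.1 + 0 * z.2)) +
        ENNReal.ofReal (Real.exp (-1 * z.1 + 0 * z.2)) +
        ENNReal.ofReal (Real.exp (0 * z.1 + 1 * z.2)) +
        ENNReal.ofReal (Real.exp (0 * z.1 + -1 * z.2))) := fun z => by
    have h1 := sq_mul_exp_abs_le 0 z.1
    have h2 := sq_mul_exp_abs_le 0 z.2
    rw [← ENNReal.ofReal_add (by positivity) (by positivity),
      ← ENNReal.ofReal_add (by positivity) (by positivity),
      ← ENNReal.ofReal_add (by positivity) (by positivity), ← ENNReal.ofReal_ofNat,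
      ← ENNReal.ofReal_mul (by norm_num)]
    refine ENNReal.ofReal_le_ofReal ?_
    simp only [zero_mul, Real.exp_zero, mul_one, zero_add, add_zero, one_mul] at h1 h2 ⊢
    linarith
  refine ne_top_of_le_ne_top ?_ (lintegral_mono hle)
  rw [lintegral_const_mul _ (by fun_prop), lintegral_add_left (by fun_prop),
    lintegral_add_left (by fun_prop), lintegral_add_left (by fun_prop)]
  simp only [lintegral_exp_pairGauss]
  finiteness

/-- The expectation of the square of the `ℓ²` norm is a multiple of the sum of the variances, finite
for `γ > 1`. -/
theorem ae_memlp_noiseCoord [Fact (1 < γ)] :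
    ∀ᵐ ω ∂gaussianNoise, Memℓp (noiseCoord γ ω) 2 := by
  have hγ : 1 < γ := Fact.out
  set V := ∫⁻ z, ENNReal.ofReal (z.1 ^ 2 + z.2 ^ 2) ∂pairGauss with hV
  have hnorm : ∀ ω n, ‖noiseCoord γ ω n‖ₑ ^ 2 =
      ENNReal.ofReal (modeScale γ n ^ 2) * ENNReal.ofReal ((ω n).1 ^ 2 + (ω n).2 ^ 2) := fun ω n => by
    rw [enorm_sq_eq_ofReal, noiseCoord, norm_smul, mul_pow, norm_equivRealProdCLM_symm_sq,
      Real.norm_eq_abs, sq_abs, ENNReal.ofReal_mul (by positivity)]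
  have hm : Measurable fun z : ℝ × ℝ => ENNReal.ofReal (z.1 ^ 2 + z.2 ^ 2) := by fun_prop
  have hmn : ∀ n : ℕ+, Measurable fun ω : ℕ+ → ℝ × ℝ =>
      ENNReal.ofReal ((ω n).1 ^ 2 + (ω n).2 ^ 2) := fun n => hm.comp (measurable_pi_apply n)
  have hint : ∀ n : ℕ+, ∫⁻ ω, ‖noiseCoord γ ω n‖ₑ ^ 2 ∂gaussianNoise =
      ENNReal.ofReal (modeScale γ n ^ 2) * V := fun n => by
    simp only [hnorm]
    rw [lintegral_const_mul _ (hmn n)]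
    congr 1
    exact (measurePreserving_eval_infinitePi (fun _ : ℕ+ => pairGauss) n).lintegral_comp hm
  have hsum : ∫⁻ ω, ∑' n, ‖noiseCoord γ ω n‖ₑ ^ 2 ∂gaussianNoise ≠ ⊤ := by
    rw [lintegral_tsum fun n => by simp only [hnorm]; exact ((hmn n).const_mul _).aemeasurable]
    simp only [hint]
    rw [ENNReal.tsum_mul_right]
    refine ENNReal.mul_ne_top ?_ lintegral_sq_pairGauss_ne_top
    have hle : ∀ n : ℕ+, modeScale γ n ^ 2 ≤ ((n : ℕ) : ℝ) ^ (-γ) := fun n => by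
      have := one_le_pnat n
      rw [modeScale_sq, mul_inv, Real.rpow_neg (by positivity)]
      exact mul_le_of_le_one_left (by positivity) (by norm_num)
    exact (Summable.of_nonneg_of_le (fun n => sq_nonneg _) hle
      (summable_pnat_rpow (by linarith))).tsum_ofReal_ne_top
  have hmeas : Measurable fun ω => ∑' n, ‖noiseCoord γ ω n‖ₑ ^ 2 := by
    refine Measurable.tsum fun n => ?_
    simp only [hnorm]
    exact (hmn n).const_mul _
  filter_upwards [ae_lt_top hmeas hsum] with ω hω
  exact memlp_two_of_tsum_lt_top hω.ne

theorem noiseSeq_apply {ω : ℕ+ → ℝ × ℝ} (h : Memℓp (noiseCoord γ ω) 2) (n : ℕ+) :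
    noiseSeq γ ω n = noiseCoord γ ω n := by
  rw [noiseSeq, dif_pos h]

theorem embed_restrict {ω : ℕ+ → ℝ × ℝ} (h : Memℓp (noiseCoord γ ω) 2) (N : ℕ+) :
    embed γ N ((Finset.Icc 1 N).restrict ω) = proj N (noiseSeq γ ω) := by
  refine Subtype.ext (funext fun n => ?_)
  rw [embed_restrict_apply, proj_apply, noiseSeq_apply h]

/-- Quantitative quasi-invariance of the law of the random sequence. -/
theorem exists_lintegral_seqFlow_le [Fact (1 < γ)] [Fact (γ ≤ 2)] (s : ℕ) [NeZero s]
    (hγ : 4 / 3 < γ) (t : ℝ) {R δ : ℝ} (hR : 0 ≤ R) (hδ : 0 < δ) (hδ' : δ < 1) :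
    ∃ C : ℝ≥0∞, C ≠ ⊤ ∧ ∀ f : Ell → ℝ≥0∞, Continuous f → (∀ x, f x ≤ 1) →
      (∀ x, R < ‖x‖ → f x = 0) →
      ∫⁻ ω, f (seqFlow γ s t (noiseSeq γ ω)) ∂gaussianNoise ≤
        C * (∫⁻ ω, f (noiseSeq γ ω) ∂gaussianNoise) ^ (1 - δ) := by
  obtain ⟨C, hC, h⟩ := exists_lintegral_galerkinFlow_le (γ := γ) s hγ t hR hδ hδ'
  refine ⟨C, hC, fun f hfc hf1 hf0 => ?_⟩
  have hm1 : ∀ N, Measurable fun y : Modes N => f (embed γ N y) := fun N =>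
    (hfc.comp (embed γ N).continuous).measurable
  have hm2 : ∀ N, Measurable fun y : Modes N => f (galerkinFlow γ s N t (embed γ N y)) := fun N =>
    (hfc.comp ((continuous_galerkinFlow N t).comp (embed γ N).continuous)).measurable
  have hrestr : ∀ N : ℕ+, Measurable fun ω : ℕ+ → ℝ × ℝ => (Finset.Icc 1 N).restrict ω := fun N =>
    Finset.measurable_restrict _
  -- Continuity and boundedness of `f` are what dominated convergence needs here and in `hlim2`; for
  -- an indicator function pointwise convergence could fail.
  have hlim1 : Tendsto (fun N : ℕ+ => ∫⁻ ω, f (embed γ N ((Finset.Icc 1 N).restrict ω)) ∂gaussianNoise)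
      atTop (𝓝 (∫⁻ ω, f (noiseSeq γ ω) ∂gaussianNoise)) := by
    refine tendsto_lintegral_filter_of_dominated_convergence (fun _ => 1)
      (Eventually.of_forall fun N => (hm1 N).comp (hrestr N))
      (Eventually.of_forall fun N => Eventually.of_forall fun ω => hf1 _) (by simp) ?_
    filter_upwards [ae_memlp_noiseCoord (γ := γ)] with ω hω
    simp only [embed_restrict hω]
    exact (hfc.tendsto _).comp (tendsto_proj _)
  have hlim2 : Tendsto (fun N : ℕ+ => ∫⁻ ω, f (galerkinFlow γ s N t
      (embed γ N ((Finset.Icc 1 N).restrict ω))) ∂gaussianNoise)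
      atTop (𝓝 (∫⁻ ω, f (seqFlow γ s t (noiseSeq γ ω)) ∂gaussianNoise)) := by
    refine tendsto_lintegral_filter_of_dominated_convergence (fun _ => 1)
      (Eventually.of_forall fun N => (hm2 N).comp (hrestr N))
      (Eventually.of_forall fun N => Eventually.of_forall fun ω => hf1 _) (by simp) ?_
    filter_upwards [ae_memlp_noiseCoord (γ := γ)] with ω hω
    simp only [embed_restrict hω]
    exact (hfc.tendsto _).comp (tendsto_galerkinFlow t _)
  refine le_of_tendsto_of_tendsto' hlim2 (ENNReal.Tendsto.const_mul
    ((ENNReal.continuous_rpow_const.tendsto _).comp hlim1) (Or.inr hC)) fun N => ?_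
  rw [Function.comp_apply, lintegral_gaussianNoise_restrict (hm2 N),
    lintegral_gaussianNoise_restrict (hm1 N)]
  exact h N f hfc hf1 hf0

end RandomSeq

/-! ### Identification of the Sobolev space with `ℓ²` -/

section Isometry

variable {s : ℕ}

theorem weighted_natCast (f : RealL2) (n : ℕ+) :
    weighted (s : ℝ) f n = ((n : ℕ) : ℂ) ^ s * coeff f ((n : ℕ) : ℤ) := by
  rw [weighted, Real.rpow_natCast]
  push_cast
  rfl

/-- The rescaled Fourier coefficients, as a linear isometry. -/
def sobolevIsometry (s : ℕ) : Sobolev (s : ℝ) →ₗᵢ[ℝ] Ell where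
  toFun u := toEll s u.toL2 u.summable
  map_add' u v := Subtype.ext (weighted_add s u.toL2 v.toL2)
  map_smul' c u := Subtype.ext (weighted_smul s c u.toL2)
  norm_map' u := norm_toEll s u.toL2 u.summable

theorem sobolevIsometry_apply (u : Sobolev (s : ℝ)) (n : ℕ+) :
    sobolevIsometry s u n = ((n : ℕ) : ℂ) ^ s * coeff u.toL2 ((n : ℕ) : ℤ) :=
  weighted_natCast _ n

theorem natCast_pow_ne_zero (n : ℕ+) (s : ℕ) : ((n : ℕ) : ℂ) ^ s ≠ 0 :=
  pow_ne_zero _ (by exact_mod_cast n.pos.ne')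

theorem sobolevIsometry_mode (n : ℕ+) (z : ℂ) :
    sobolevIsometry s (mode s n z) = lp.single 2 n (((n : ℕ) : ℂ) ^ s * z) := by
  refine Subtype.ext (funext fun m => ?_)
  rw [sobolevIsometry_apply, coeff_mode]
  rcases eq_or_ne m n with rfl | h
  · rw [if_pos rfl, lp.single_apply_self]
  · rw [if_neg h, lp.single_apply_ne _ _ _ h, mul_zero]

/-- The range is closed, being that of an isometry on a complete space, and it contains the dense
set of finitely supported sequences. -/
theorem surjective_sobolevIsometry : Function.Surjective (sobolevIsometry s) := by
  have := Sobolev.completeSpace (s := (s : ℝ)) (Nat.cast_nonneg s)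
  intro x
  have hmem : ∀ N, proj N x ∈ LinearMap.range (sobolevIsometry s).toLinearMap := fun N => by
    rw [proj_eq_sum]
    refine Submodule.sum_mem _ fun n _ => ⟨mode s n ((((n : ℕ) : ℂ) ^ s)⁻¹ * x n), ?_⟩
    exact (sobolevIsometry_mode _ _).trans (by rw [mul_inv_cancel_left₀ (natCast_pow_ne_zero n s)])
  have hcl : IsClosed (Set.range (sobolevIsometry s)) :=
    (sobolevIsometry s).isometry.isClosedEmbedding.isClosed_range
  exact hcl.mem_of_tendsto (tendsto_proj x) (Eventually.of_forall hmem)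

/-- The Sobolev space is isometric to the space of square summable sequences. -/
def sobolevEquiv (s : ℕ) : Sobolev (s : ℝ) ≃ₗᵢ[ℝ] Ell :=
  LinearIsometryEquiv.ofSurjective (sobolevIsometry s) surjective_sobolevIsometry

theorem sobolevEquiv_apply (u : Sobolev (s : ℝ)) (n : ℕ+) :
    sobolevEquiv s u n = ((n : ℕ) : ℂ) ^ s * coeff u.toL2 ((n : ℕ) : ℤ) :=
  sobolevIsometry_apply u n

theorem sobolevEquiv_mode (n : ℕ+) (z : ℂ) :
    sobolevEquiv s (mode s n z) = lp.single 2 n (((n : ℕ) : ℂ) ^ s * z) :=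
  sobolevIsometry_mode n z

theorem coeff_eq_fc (u : Sobolev (s : ℝ)) (a : ℤ) : coeff u.toL2 a = fc s (sobolevEquiv s u) a := by
  have key : ∀ n : ℕ+, coeff u.toL2 ((n : ℕ) : ℤ) = fc s (sobolevEquiv s u) ((n : ℕ) : ℤ) :=
    fun n => by rw [fc_pnat, sobolevEquiv_apply, inv_mul_cancel_left₀ (natCast_pow_ne_zero n s)]
  rcases int_cases_pnat a with rfl | ⟨n, rfl | rfl⟩
  · rw [fc_zero, u.coeff_toL2_zero]
  · exact key n
  · rw [fc_neg, coeff_neg_index, key]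

/-- Parseval's identity for the Fourier coefficients of a square. -/
theorem fourierCoeff_sq (f : RealL2) (n : ℤ) :
    fourierCoeff (fun x : Torus => (((f x) ^ 2 : ℝ) : ℂ)) n = ∑' a, coeff f a * coeff f (n - a) := by
  have hf := Complex.ofRealCLM.coeFn_compLpL (p := 2) (μ := haarT) f
  -- Parseval is applied to `e^{inx} f` and `f`, whose inner product is the `n`-th coefficient of
  -- `f²`, as `f` is real.
  have hmem : MemLp (fun x : Torus => fourier n x * complexify f x) 2 haarT := by
    refine (Lp.memLp (complexify f)).congr_norm
      (((fourier n).continuous.aestronglyMeasurable).mul (Lp.aestronglyMeasurable _))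
      (Eventually.of_forall fun x => ?_)
    rw [norm_mul, fourier_apply, Circle.norm_coe, one_mul]
  set g := hmem.toLp with hg
  have hgc : ∀ a, fourierCoeff g a = coeff f (a - n) := fun a => by
    rw [coeff_eq_complexify, congrFun (fourierCoeff_congr_ae hmem.coeFn_toLp) a, fourierCoeff,
      fourierCoeff]
    congr 1
    funext x
    rw [smul_eq_mul, smul_eq_mul, ← mul_assoc, ← fourier_add]
    ring_nf
  have h := fourierBasis.tsum_inner_mul_inner g (complexify f)
  have hinner : inner ℂ g (complexify f) =
      fourierCoeff (fun x : Torus => (((f x) ^ 2 : ℝ) : ℂ)) n := by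
    rw [L2.inner_def, fourierCoeff]
    refine integral_congr_ae ?_
    filter_upwards [hf, hmem.coeFn_toLp] with x hx hx'
    have hx2 : complexify f x = ((f x : ℝ) : ℂ) := hx
    rw [hg, hx', hx2, RCLike.inner_apply, map_mul, Complex.conj_ofReal, fourier_neg, smul_eq_mul]
    push_cast
    ring
  rw [← hinner, ← h]
  refine tsum_congr fun a => ?_
  have h1 : inner ℂ g (fourierBasis (T := 2 * Real.pi) a) = coeff f (n - a) := by
    rw [← inner_conj_symm, ← HilbertBasis.repr_apply_apply, fourierBasis_repr, hgc,
      ← coeff_neg_index, neg_sub]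
  rw [h1, ← HilbertBasis.repr_apply_apply, ← coeff_eq, mul_comm]

theorem fourierCoeff_sq_eq_conv (u : Sobolev (s : ℝ)) (n : ℤ) :
    fourierCoeff (fun x : Torus => (((u.toL2 x) ^ 2 : ℝ) : ℂ)) n =
      conv s (sobolevEquiv s u) (sobolevEquiv s u) n := by
  rw [fourierCoeff_sq, conv]
  simp only [coeff_eq_fc]

end Isometry

/-! ### Solutions of the equation, well-posedness and the energy -/

section Solution

variable {γ : ℝ} {s : ℕ} [NeZero s] [Fact (1 < γ)]

theorem one_add_rpow_mul_field (x : Ell) (n : ℕ+) :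
    ((1 + |(((n : ℕ) : ℤ) : ℝ)| ^ γ : ℝ) : ℂ) * ((((n : ℕ) : ℂ) ^ s)⁻¹ * field γ s x n) =
      -(Complex.I * (((n : ℕ) : ℤ) : ℂ)) * (fc s x ((n : ℕ) : ℤ) + conv s x x ((n : ℕ) : ℤ)) := by
  have hs := natCast_pow_ne_zero n s
  have h1 : (0 : ℝ) < 1 + ((n : ℕ) : ℝ) ^ γ := by positivity
  have h2 : ((1 + ((n : ℕ) : ℝ) ^ γ : ℝ) : ℂ) ≠ 0 := by exact_mod_cast h1.ne'
  rw [field, linMap_apply, lp.coeFn_add, Pi.add_apply, prodMap_apply, lam, fc_pnat, Int.cast_natCast,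
    Nat.abs_cast, Complex.ofReal_div]
  push_cast at h2 ⊢
  field_simp

omit [NeZero s] in
-- Complex conjugation of the equation, as both functions are real valued. Only the positive
-- frequencies then need attention.
theorem hasDerivAt_coeff_neg {γ : ℝ} {u : ℝ → Sobolev (s : ℝ)} {t : ℝ} {n : ℤ}
    (h : HasDerivAt (fun τ => (((1 + |(n : ℝ)| ^ γ : ℝ)) : ℂ) * coeff (u τ).toL2 n)
      (-(Complex.I * n) * (coeff (u t).toL2 n +
        fourierCoeff (fun x : Torus => ((((u t).toL2 x) ^ 2 : ℝ) : ℂ)) n)) t) :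
    HasDerivAt (fun τ => (((1 + |((-n : ℤ) : ℝ)| ^ γ : ℝ)) : ℂ) * coeff (u τ).toL2 (-n))
      (-(Complex.I * ((-n : ℤ) : ℂ)) * (coeff (u t).toL2 (-n) +
        fourierCoeff (fun x : Torus => ((((u t).toL2 x) ^ 2 : ℝ) : ℂ)) (-n))) t := by
  have h1 := (Complex.conjCLE : ℂ →L[ℝ] ℂ).hasFDerivAt.comp_hasDerivAt t h
  have h2 : fourierCoeff (fun x : Torus => ((((u t).toL2 x) ^ 2 : ℝ) : ℂ)) (-n) =
      (starRingEnd ℂ) (fourierCoeff (fun x : Torus => ((((u t).toL2 x) ^ 2 : ℝ) : ℂ)) n) := by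
    unfold fourierCoeff
    rw [← integral_conj]
    congr 1
    ext x
    simp
  have h3 : (fun τ => (((1 + |((-n : ℤ) : ℝ)| ^ γ : ℝ)) : ℂ) * coeff (u τ).toL2 (-n)) =
      fun τ => (starRingEnd ℂ) ((((1 + |(n : ℝ)| ^ γ : ℝ)) : ℂ) * coeff (u τ).toL2 n) := by
    funext τ
    rw [coeff_neg_index, map_mul, Complex.conj_ofReal, Int.cast_neg, abs_neg]
  rw [h2, h3, coeff_neg_index]
  refine h1.congr_deriv ?_
  change (starRingEnd ℂ) _ = _
  simp

/-- The definition tests one frequency at a time, whereas the flow is built for the norm of `ℓ²`.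
Continuity in `H^s` bridges the two: it makes the field continuous along `u`, so that its integral
is differentiable in norm. -/
theorem isSolution_iff {u : ℝ → Sobolev (s : ℝ)} : IsSolution γ u ↔
    ∀ t, HasDerivAt (fun t => sobolevEquiv s (u t)) (field γ s (sobolevEquiv s (u t))) t := by
  have hcoord : ∀ (n : ℕ+) (t : ℝ), HasDerivAt (fun τ => (((1 + |(((n : ℕ) : ℤ) : ℝ)| ^ γ : ℝ)) : ℂ) *
      coeff (u τ).toL2 ((n : ℕ) : ℤ)) (-(Complex.I * (((n : ℕ) : ℤ) : ℂ)) *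
        (coeff (u t).toL2 ((n : ℕ) : ℤ) +
        fourierCoeff (fun x : Torus => ((((u t).toL2 x) ^ 2 : ℝ) : ℂ)) ((n : ℕ) : ℤ))) t ↔
      HasDerivAt (fun τ => sobolevEquiv s (u τ) n) (field γ s (sobolevEquiv s (u t)) n) t := by
    intro n t
    have hs := natCast_pow_ne_zero n s
    have h1 : (0 : ℝ) < 1 + |(((n : ℕ) : ℤ) : ℝ)| ^ γ := by positivity
    have h2 : ((1 + |(((n : ℕ) : ℤ) : ℝ)| ^ γ : ℝ) : ℂ) ≠ 0 := by exact_mod_cast h1.ne'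
    rw [fourierCoeff_sq_eq_conv, coeff_eq_fc, ← one_add_rpow_mul_field (γ := γ)]
    simp only [coeff_eq_fc, fc_pnat]
    set c : ℂ := ((1 + |(((n : ℕ) : ℤ) : ℝ)| ^ γ : ℝ) : ℂ) * (((n : ℕ) : ℂ) ^ s)⁻¹ with hc
    have hc0 : c ≠ 0 := mul_ne_zero h2 (inv_ne_zero hs)
    simp only [← mul_assoc, ← hc]
    constructor
    · intro h
      simpa [hc0] using h.const_mul c⁻¹
    · intro h
      exact h.const_mul c
  constructor
  · rintro ⟨hcont, hu⟩ t
    have hvc : Continuous fun t => sobolevEquiv s (u t) := (sobolevEquiv s).continuous.comp hcont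
    have hFc : Continuous fun t => field γ s (sobolevEquiv s (u t)) := continuous_field.comp hvc
    -- Each coordinate of this primitive has the same derivative and initial value as that of `u`,
    -- so the two curves coincide.
    set w : ℝ → Ell := fun t => sobolevEquiv s (u 0) +
      ∫ τ in (0 : ℝ)..t, field γ s (sobolevEquiv s (u τ)) with hw
    have hwd : ∀ t, HasDerivAt w (field γ s (sobolevEquiv s (u t))) t := fun t =>
      (intervalIntegral.integral_hasDerivAt_right (hFc.intervalIntegrable _ _)
        (hFc.stronglyMeasurableAtFilter _ _) hFc.continuousAt).const_add _
    have hwv : w = fun t => sobolevEquiv s (u t) := by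
      funext t
      refine Subtype.ext (funext fun n => ?_)
      have hd : ∀ t, HasDerivAt (fun t => w t n - sobolevEquiv s (u t) n) 0 t := fun t => by
        have e1 : HasDerivAt (fun t => w t n) (field γ s (sobolevEquiv s (u t)) n) t :=
          (lp.evalCLM ℝ (fun _ : ℕ+ => ℂ) 2 n).hasFDerivAt.comp_hasDerivAt t (hwd t)
        exact (e1.sub ((hcoord n t).1 (hu _ t))).congr_deriv (sub_self _)
      have := is_const_of_deriv_eq_zero (fun t => (hd t).differentiableAt) (fun t => (hd t).deriv) t 0
      have h0 : w 0 = sobolevEquiv s (u 0) := by simp [hw]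
      rw [h0, sub_self, sub_eq_zero] at this
      exact this
    rw [← hwv]
    exact hwd t
  · intro h
    refine ⟨?_, fun n t => ?_⟩
    · have hc : Continuous fun t => sobolevEquiv s (u t) :=
        continuous_iff_continuousAt.2 fun t => (h t).continuousAt
      have := (sobolevEquiv s).symm.continuous.comp hc
      simpa [Function.comp_def] using this
    · have hpos : ∀ m : ℕ+, _ := fun m => (hcoord m t).2
        ((lp.evalCLM ℝ (fun _ : ℕ+ => ℂ) 2 m).hasFDerivAt.comp_hasDerivAt t (h t))
      rcases int_cases_pnat n with rfl | ⟨m, rfl | rfl⟩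
      · simp only [Sobolev.coeff_toL2_zero, mul_zero, Int.cast_zero, neg_zero, zero_mul]
        exact hasDerivAt_const _ _
      · exact hpos m
      · exact hasDerivAt_coeff_neg (hpos m)

variable [Fact (γ ≤ 2)]

theorem isSolution_seqFlow (u₀ : Sobolev (s : ℝ)) :
    IsSolution γ fun t => (sobolevEquiv s).symm (seqFlow γ s t (sobolevEquiv s u₀)) := by
  rw [isSolution_iff]
  simp only [LinearIsometryEquiv.apply_symm_apply]
  exact isFlow_seqFlow.hasDerivAt _

theorem IsSolution.eq_seqFlow {u : ℝ → Sobolev (s : ℝ)} (hu : IsSolution γ u) (t : ℝ) :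
    u t = (sobolevEquiv s).symm (seqFlow γ s t (sobolevEquiv s (u 0))) := by
  rw [LinearIsometryEquiv.eq_symm_apply]
  exact isFlow_seqFlow.eq_of_hasDerivAt lipschitzOnBalls_field (isSolution_iff.1 hu) t

theorem existsUnique_isSolution (u₀ : Sobolev (s : ℝ)) :
    ∃! u : ℝ → Sobolev (s : ℝ), IsSolution γ u ∧ u 0 = u₀ := by
  refine ⟨_, ⟨isSolution_seqFlow u₀, ?_⟩, fun v hv => funext fun t => ?_⟩
  · simp [isFlow_seqFlow.zero]
  · rw [hv.1.eq_seqFlow, hv.2]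

theorem flow_eq (t : ℝ) (u₀ : Sobolev (s : ℝ)) :
    flow γ t u₀ = (sobolevEquiv s).symm (seqFlow γ s t (sobolevEquiv s u₀)) := by
  have h := (existsUnique_isSolution (γ := γ) u₀).exists
  rw [flow, dif_pos h, h.choose_spec.1.eq_seqFlow, h.choose_spec.2]

theorem sobolevEquiv_flow (t : ℝ) (u : Sobolev (s : ℝ)) :
    sobolevEquiv s (flow γ t u) = seqFlow γ s t (sobolevEquiv s u) := by
  rw [flow_eq, LinearIsometryEquiv.apply_symm_apply]

theorem flow_neg_flow (t : ℝ) (u : Sobolev (s : ℝ)) : flow γ (-t) (flow γ t u) = u :=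
  (sobolevEquiv s).injective (by
    rw [sobolevEquiv_flow, sobolevEquiv_flow, isFlow_seqFlow.neg_apply lipschitzOnBalls_field])

theorem flow_flow_neg (t : ℝ) (u : Sobolev (s : ℝ)) : flow γ t (flow γ (-t) u) = u :=
  (sobolevEquiv s).injective (by
    rw [sobolevEquiv_flow, sobolevEquiv_flow, isFlow_seqFlow.apply_neg lipschitzOnBalls_field])

theorem continuous_flow (t : ℝ) : Continuous (flow γ t : Sobolev (s : ℝ) → Sobolev (s : ℝ)) := by
  have : (flow γ t : Sobolev (s : ℝ) → Sobolev (s : ℝ)) = fun u =>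
    (sobolevEquiv s).symm (seqFlow γ s t (sobolevEquiv s u)) := funext (flow_eq t)
  rw [this]
  exact (sobolevEquiv s).symm.continuous.comp
    ((continuous_seqFlow t).comp (sobolevEquiv s).continuous)

omit [Fact (1 < γ)] in
-- Parseval gives `‖u‖²_{L²} = 4π ∑_{n ≥ 1} |û(n)|²`, one factor 2 for the two signs of `n` and `2π`
-- for the total mass. This matches the `4π` in the definition.
theorem energy_eq (u : Sobolev (s : ℝ)) :
    energy γ u = 4 * Real.pi * ‖energyMap γ s (sobolevEquiv s u)‖ ^ 2 := by
  have hterm : ∀ n : ℕ+, ‖energyMap γ s (sobolevEquiv s u) n‖ ^ 2 =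
      ‖coeff u.toL2 ((n : ℕ) : ℤ)‖ ^ 2 + sobolevTerm (γ / 2) u.toL2 n := fun n => by
    have hn := one_le_pnat n
    have hw : (0 : ℝ) ≤ 1 + ((n : ℕ) : ℝ) ^ γ := by positivity
    rw [energyMap_apply, sobolevEquiv_apply, norm_mul, mul_pow, norm_mul, mul_pow, Complex.norm_real,
      Real.norm_eq_abs, sq_abs, energyWeight_sq, sobolevTerm, norm_pow, Complex.norm_natCast,
      mul_div_cancel₀ γ two_ne_zero]
    field_simp
  have hsum := (hasSum_norm_sq (energyMap γ s (sobolevEquiv s u)))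
  have hs1 : Summable fun n : ℕ+ => ‖coeff u.toL2 ((n : ℕ) : ℤ)‖ ^ 2 :=
    Summable.of_nonneg_of_le (fun n => sq_nonneg _) (fun n => by
      rw [hterm, le_add_iff_nonneg_right, ← norm_weighted_sq]; positivity) hsum.summable
  have hs2 : Summable (sobolevTerm (γ / 2) u.toL2) :=
    Summable.of_nonneg_of_le (fun n => by rw [← norm_weighted_sq]; positivity) (fun n => by
      rw [hterm, le_add_iff_nonneg_left]; positivity) hsum.summable
  have hL2 : ∫ x : Torus, (u.toL2 x) ^ 2 = 2 * Real.pi * ‖u.toL2‖ ^ 2 := by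
    rw [AddCircle.volume_eq_smul_haarAddCircle, integral_smul_measure,
      ENNReal.toReal_ofReal Real.two_pi_pos.le, smul_eq_mul]
    congr 1
    have h := L2.inner_def (𝕜 := ℝ) u.toL2 u.toL2
    rw [real_inner_self_eq_norm_sq] at h
    rw [h]
    congr 1
    funext x
    rw [real_inner_self_eq_norm_sq, Real.norm_eq_abs, sq_abs]
  rw [energy, hL2, norm_sq_eq _ u.coeff_toL2_zero, sobolevNorm,
    Real.sq_sqrt (tsum_nonneg fun n => by rw [← norm_weighted_sq]; positivity),
    ← hsum.tsum_eq]
  simp only [hterm]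
  rw [hs1.tsum_add hs2]
  ring

omit [Fact (1 < γ)] in
theorem continuous_energy : Continuous (energy γ : Sobolev (s : ℝ) → ℝ) := by
  have : (energy γ : Sobolev (s : ℝ) → ℝ) = fun u =>
    4 * Real.pi * ‖energyMap γ s (sobolevEquiv s u)‖ ^ 2 := funext energy_eq
  rw [this]
  have := (sobolevEquiv s).continuous
  fun_prop

theorem energy_flow (t : ℝ) (u : Sobolev (s : ℝ)) : energy γ (flow γ t u) = energy γ u := by
  rw [energy_eq, energy_eq, sobolevEquiv_flow, isTame_field.flow_norm_energyMap isFlow_seqFlow]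

end Solution

/-! ### The random Fourier series in rescaled coefficients -/

section RandomSeries

variable {γ : ℝ} {s : ℕ}

/-- The factor `n^s` of the isometry cancels that of the series. On the event that the coordinates
are square summable the partial sums are projections of `noiseSeq`, hence converge, and `limUnder`
is a true limit. -/
theorem sobolevEquiv_randomSeries {ω : ℕ+ → ℝ × ℝ} (h : Memℓp (noiseCoord γ ω) 2) :
    sobolevEquiv s (randomSeries γ s ω) = noiseSeq γ ω := by
  have hterm : ∀ n : ℕ+, ((n : ℕ) : ℂ) ^ s *
      (gaussianVar n ω / ((((n : ℕ) : ℝ) ^ ((s : ℝ) + γ / 2) : ℝ) : ℂ)) = noiseCoord γ ω n := fun n => by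
    have hn := one_le_pnat n
    have hs := natCast_pow_ne_zero n s
    have h1 : (((((n : ℕ) : ℝ) ^ (γ / 2) : ℝ)) : ℂ) ≠ 0 := by
      exact_mod_cast (by positivity : ((n : ℕ) : ℝ) ^ (γ / 2) ≠ 0)
    have h2 : ((Real.sqrt 2 : ℝ) : ℂ) ≠ 0 := by
      exact_mod_cast (by positivity : Real.sqrt 2 ≠ 0)
    have h3 : Complex.equivRealProdCLM.symm (ω n) = ((ω n).1 : ℂ) + Complex.I * ((ω n).2 : ℂ) := by
      rw [Complex.equivRealProdCLM_symm_apply, mul_comm]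
    rw [noiseCoord, h3, gaussianVar, modeScale, Complex.real_smul, Real.rpow_add (by positivity),
      Real.rpow_natCast]
    push_cast
    field_simp
  have hpart : ∀ N : ℕ+, (∑ n ∈ Finset.Icc 1 N, mode (s : ℝ) n (gaussianVar n ω /
      ((((n : ℕ) : ℝ) ^ ((s : ℝ) + γ / 2) : ℝ) : ℂ))) =
      (sobolevEquiv s).symm (proj N (noiseSeq γ ω)) := fun N => by
    rw [LinearIsometryEquiv.eq_symm_apply, map_sum, proj_eq_sum]
    refine Finset.sum_congr rfl fun n _ => ?_
    rw [sobolevEquiv_mode, hterm, noiseSeq_apply h]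
  have hlim : Tendsto (fun N => (sobolevEquiv s).symm (proj N (noiseSeq γ ω))) atTop
      (𝓝 ((sobolevEquiv s).symm (noiseSeq γ ω))) :=
    ((sobolevEquiv s).symm.continuous.tendsto _).comp (tendsto_proj (noiseSeq γ ω))
  rw [randomSeries]
  simp only [hpart]
  rw [hlim.limUnder_eq, LinearIsometryEquiv.apply_symm_apply]

end RandomSeries

/-! ### From continuous functions to Borel sets -/

section FromFunctionsToSets

/-- An inequality between integrals of continuous functions implies the one between measures of
bounded sets. -/
theorem measure_le_of_lintegral_le {E : Type*} [NormedAddCommGroup E] [MeasurableSpace E]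
    [BorelSpace E] {κ κ' : Measure E} [IsFiniteMeasure κ] [IsFiniteMeasure κ'] {C : ℝ≥0∞} (hC : C ≠ ⊤)
    {R a : ℝ} (ha : 0 < a)
    (h : ∀ f : E → ℝ≥0∞, Continuous f → (∀ x, f x ≤ 1) → (∀ x, R + 1 < ‖x‖ → f x = 0) →
      ∫⁻ x, f x ∂κ' ≤ C * (∫⁻ x, f x ∂κ) ^ a)
    {A : Set E} (hA : MeasurableSet A) (hAR : ∀ x ∈ A, ‖x‖ ≤ R) : κ' A ≤ C * κ A ^ a := by
  have hclosed : ∀ F : Set E, IsClosed F → (∀ x ∈ F, ‖x‖ ≤ R) → κ' F ≤ C * κ F ^ a := by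
    intro F hF hFR
    have hle : ∀ ε : ℝ, 0 < ε → ε ≤ 1 → κ' F ≤ C * κ (Metric.thickening ε F) ^ a := by
      intro ε hε hε1
      -- As `ε ≤ 1`, the thickened indicator vanishes outside the ball of radius `R + 1`, which
      -- explains the radius in the hypothesis.
      have h1 := h (fun x => thickenedIndicator hε F x) ?_ ?_ ?_
      · calc κ' F = ∫⁻ x, F.indicator 1 x ∂κ' := (lintegral_indicator_one hF.measurableSet).symm
          _ ≤ ∫⁻ x, thickenedIndicator hε F x ∂κ' := by
            refine lintegral_mono fun x => ?_
            by_cases hx : x ∈ F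
            · rw [thickenedIndicator_one hε F hx, Set.indicator_of_mem hx]; simp
            · rw [Set.indicator_of_notMem hx]; exact zero_le
          _ ≤ _ := h1
          _ ≤ C * κ (Metric.thickening ε F) ^ a := by
            gcongr
            rw [← lintegral_indicator_one Metric.isOpen_thickening.measurableSet]
            refine lintegral_mono fun x => ?_
            by_cases hx : x ∈ Metric.thickening ε F
            · rw [Set.indicator_of_mem hx, Pi.one_apply]
              exact ENNReal.coe_le_one_iff.2 (thickenedIndicator_le_one hε F x)
            · rw [thickenedIndicator_zero hε F hx]; simp
      · exact ENNReal.continuous_coe.comp (thickenedIndicator hε F).continuous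
      · intro x
        exact_mod_cast thickenedIndicator_le_one hε F x
      · intro x hx
        rw [thickenedIndicator_zero hε F, ENNReal.coe_zero]
        intro hmem
        obtain ⟨z, hz, hxz⟩ := Metric.mem_thickening_iff.1 hmem
        have h2 := hFR z hz
        have h3 := norm_sub_norm_le x z
        rw [dist_eq_norm] at hxz
        linarith
    have hlim := tendsto_measure_thickening_of_isClosed (μ := κ) (s := F)
      ⟨1, one_pos, measure_ne_top _ _⟩ hF
    refine ge_of_tendsto (ENNReal.Tendsto.const_mul
      ((ENNReal.continuous_rpow_const.tendsto _).comp hlim) (Or.inr hC)) ?_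
    filter_upwards [Ioc_mem_nhdsGT one_pos] with ε hε using hle ε hε.1 hε.2
  -- Inner regularity by closed sets for `κ'`; monotonicity of `κ` then returns from `F` to `A`.
  rw [hA.measure_eq_iSup_isClosed_of_ne_top (measure_ne_top κ' A)]
  refine iSup₂_le fun F hFA => iSup_le fun hF => (hclosed F hF fun x hx => hAR x (hFA hx)).trans ?_
  gcongr

end FromFunctionsToSets

/-! ### Quasi-invariance of `μ_s` and `μ_{s,r}` -/

section QuasiInvariance

variable {γ : ℝ} {s : ℕ} [NeZero s] [Fact (1 < γ)] [Fact (γ ≤ 2)]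

theorem image_flow_eq_preimage (t : ℝ) (A : Set (Sobolev (s : ℝ))) :
    flow γ t '' A = flow γ (-t) ⁻¹' A :=
  congrFun (Set.image_eq_preimage_of_inverse (flow_neg_flow t) (flow_flow_neg t)) A

/-- The image under the flow at time `t` is the preimage at time `-t`, so its measure is that of `A`
under the law pushed forward by the flow at `-t`. The estimate for functions is used at `-t` and on
the enlarged ball of radius `R + 1`. -/
theorem exists_gaussianMeasure_image_flow_le (s : ℕ) [NeZero s] (hγ : 4 / 3 < γ) (t : ℝ) {R δ : ℝ}
    (hR : 0 ≤ R) (hδ : 0 < δ) (hδ' : δ < 1) :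
    ∃ C : ℝ≥0∞, C ≠ ⊤ ∧ ∀ A : Set (Sobolev (s : ℝ)), MeasurableSet A → (∀ u ∈ A, ‖u‖ ≤ R) →
      gaussianMeasure γ s (flow γ t '' A) ≤ C * gaussianMeasure γ s A ^ (1 - δ) := by
  obtain ⟨C, hC, h⟩ := exists_lintegral_seqFlow_le (γ := γ) s hγ (-t) (by positivity : 0 ≤ R + 1)
    hδ hδ'
  have hprob := isProbabilityMeasure_gaussianMeasure γ (s := (s : ℝ)) (Nat.cast_nonneg s)
  have hmeas := measurable_randomSeries γ (s := (s : ℝ)) (Nat.cast_nonneg s)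
  have hflow : Measurable (flow γ (-t) : Sobolev (s : ℝ) → Sobolev (s : ℝ)) :=
    (continuous_flow (-t)).measurable
  have : IsProbabilityMeasure ((gaussianMeasure γ s).map (flow γ (-t))) :=
    Measure.isProbabilityMeasure_map hflow.aemeasurable
  refine ⟨C, hC, fun A hA hAR => ?_⟩
  rw [image_flow_eq_preimage, ← Measure.map_apply hflow hA]
  refine measure_le_of_lintegral_le hC (by linarith) (fun f hfc hf1 hf0 => ?_) hA hAR
  have h1 := h (fun x => f ((sobolevEquiv s).symm x)) (hfc.comp (sobolevEquiv s).symm.continuous)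
    (fun x => hf1 _) fun x hx => hf0 _ (by rwa [LinearIsometryEquiv.norm_map])
  rw [lintegral_map hfc.measurable hflow, gaussianMeasure,
    lintegral_map (f := fun u => f (flow γ (-t) u)) (hfc.measurable.comp hflow) hmeas, lintegral_map hfc.measurable hmeas]
  refine le_trans (le_of_eq (lintegral_congr_ae ?_)) (h1.trans (le_of_eq ?_))
  · filter_upwards [ae_memlp_noiseCoord (γ := γ)] with ω hω
    rw [flow_eq, sobolevEquiv_randomSeries hω]
  · congr 2
    refine lintegral_congr_ae ?_
    filter_upwards [ae_memlp_noiseCoord (γ := γ)] with ω hω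
    rw [← sobolevEquiv_randomSeries (s := s) hω, LinearIsometryEquiv.symm_apply_apply]

/-- The energy is invariant, so intersecting with the cutoff set commutes with taking the image, and
the estimate for `μ_s` is applied to the part of `A` inside the cutoff. -/
theorem exists_cutMeasure_image_flow_le (s : ℕ) [NeZero s] (hγ : 4 / 3 < γ) (t r : ℝ) {R δ : ℝ}
    (hR : 0 ≤ R) (hδ : 0 < δ) :
    ∃ C : ℝ, 0 < C ∧ ∀ A : Set (Sobolev (s : ℝ)), MeasurableSet A → (∀ u ∈ A, ‖u‖ ≤ R) →
      cutMeasure γ s r (flow γ t '' A) ≤ ENNReal.ofReal C * cutMeasure γ s r A ^ (1 - δ) := by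
  have hprob := isProbabilityMeasure_gaussianMeasure γ (s := (s : ℝ)) (Nat.cast_nonneg s)
  have hcut : MeasurableSet {u : Sobolev (s : ℝ) | energy γ u ≤ r} :=
    (isClosed_le continuous_energy continuous_const).measurableSet
  rcases lt_or_ge δ 1 with hδ' | hδ'
  · obtain ⟨C, hC, h⟩ := exists_gaussianMeasure_image_flow_le (γ := γ) s hγ t hR hδ hδ'
    refine ⟨C.toReal + 1, by positivity, fun A hA hAR => ?_⟩
    have himage : flow γ t '' A ∩ {u | energy γ u ≤ r} =
        flow γ t '' (A ∩ {u | energy γ u ≤ r}) := by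
      rw [image_flow_eq_preimage, image_flow_eq_preimage, Set.preimage_inter]
      congr 1
      ext u
      simp only [Set.mem_ofPred_eq, Set.mem_preimage, energy_flow]
    rw [cutMeasure, Measure.restrict_apply' hcut, Measure.restrict_apply' hcut, himage]
    refine (h _ (hA.inter hcut) fun u hu => hAR u hu.1).trans ?_
    gcongr
    exact (ENNReal.ofReal_toReal hC).symm.le.trans (ENNReal.ofReal_le_ofReal (by linarith))
  -- For `δ ≥ 1` the exponent is nonpositive and the base at most one, so the right-hand side is at
  -- least one.
  · refine ⟨1, one_pos, fun A _ _ => ?_⟩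
    have hle : ∀ B, cutMeasure γ (s : ℝ) r B ≤ 1 := fun B =>
      (Measure.restrict_apply_le _ _).trans prob_le_one
    rw [ENNReal.ofReal_one, one_mul]
    refine (hle _).trans ?_
    rw [← neg_sub, ENNReal.rpow_neg]
    exact ENNReal.one_le_inv.2 (ENNReal.rpow_le_one (hle A) (by linarith))

end QuasiInvariance

end

end GBBM

theorem lemma8p1 (γ : ℝ) (hγ : 4 / 3 < γ) (hγ' : γ ≤ 2) (s : ℕ) (hs : 1 ≤ s) :
    (∀ u₀ : GBBM.Sobolev (s : ℝ),
      ∃! u : ℝ → GBBM.Sobolev (s : ℝ), GBBM.IsSolution γ u ∧ u 0 = u₀) ∧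
    ∀ t r R δ : ℝ, 0 < r → 0 < R → 0 < δ →
      ∃ C : ℝ, 0 < C ∧ ∀ A : Set (GBBM.Sobolev (s : ℝ)), MeasurableSet A →
        (∀ u ∈ A, ‖u‖ ≤ R) →
        GBBM.cutMeasure γ s r (GBBM.flow γ t '' A) ≤
          ENNReal.ofReal C * (GBBM.cutMeasure γ s r A) ^ (1 - δ) := by
  have : NeZero s := ⟨by omega⟩
  have : Fact (1 < γ) := ⟨by linarith⟩
  have : Fact (γ ≤ 2) := ⟨hγ'⟩
  exact ⟨GBBM.existsUnique_isSolution, fun t r R δ _ hR hδ =>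
    GBBM.exists_cutMeasure_image_flow_le s hγ t r hR.le hδ⟩
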